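/- Fix a dimension $d$. For a finite set $P\subset\mathbb{R}^d$ and an integer $k$ with $1\le k\le |P|$, let $\mathrm{opt}(P,k)$ be the minimum, over all sets $C\subseteq P$ of exactly $k$ centers, of $\max_{p\in P}\min_{c\in C}\|p-c\|$. There are a randomized algorithm, on the unit-cost real RAM with the floor function, random-access arrays and a primitive that draws a uniformly random integer from a given range, and a constant $K$, both depending only on $d$, such that the following holds for all integers $1\le k\le n$ and every set $P$ of $n$ (distinct) points of $\mathbb{R}^d$, given as a list in any order together with $n$ and $k$. The expected running time of the algorithm on $(P,k)$ is at most $K\,n$, and whenever it halts it has output a $2$-approximation to the optimal $k$-center clustering of $P$: a set $C\subseteq P$ of exactly $k$ centers with $\max_{p\in P}\min_{c\in C}\|p-c\|\le 2\,\mathrm{opt}(P,k)$, together with an assignment of every point $p\in P$ to a center of $C$ at distance at most $2\,\mathrm{opt}(P,k)$ from $p$. -/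

import Mathlib

/-! A randomized real RAM with unit-cost arithmetic, the floor function and random-access arrays,
and the `k`-center problem. -/

namespace RealRAM

/-- The two data types of the machine: integers (used also as addresses) and exact reals. -/
inductive Ty where
  | int : Ty
  | real : Ty

/-- The values of each type. -/
@[reducible] def Ty.denote : Ty → Type
  | Ty.int => ℤ
  | Ty.real => ℝ

/-- Expressions. The only literals are integers, so a program cannot carry a real constant. -/
inductive Expr : Ty → Type where
  | litI : ℤ → Expr Ty.int
  | varI : ℕ → Expr Ty.int
  | loadI : ℕ → Expr Ty.int → Expr Ty.int
  | addI : Expr Ty.int → Expr Ty.int → Expr Ty.int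
  | subI : Expr Ty.int → Expr Ty.int → Expr Ty.int
  | mulI : Expr Ty.int → Expr Ty.int → Expr Ty.int
  | leI : Expr Ty.int → Expr Ty.int → Expr Ty.int
  | leR : Expr Ty.real → Expr Ty.real → Expr Ty.int
  | floor : Expr Ty.real → Expr Ty.int
  | ofInt : Expr Ty.int → Expr Ty.real
  | varR : ℕ → Expr Ty.real
  | loadR : ℕ → Expr Ty.int → Expr Ty.real
  | addR : Expr Ty.real → Expr Ty.real → Expr Ty.real
  | subR : Expr Ty.real → Expr Ty.real → Expr Ty.real
  | mulR : Expr Ty.real → Expr Ty.real → Expr Ty.real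
  | divR : Expr Ty.real → Expr Ty.real → Expr Ty.real

/-- Programs. `rand x e` draws a uniformly random integer below the value of `e`.
A test is passed when its value is nonzero. A program names only finitely many variables and
arrays. -/
inductive Prog where
  | skip : Prog
  | setI : ℕ → Expr Ty.int → Prog
  | setR : ℕ → Expr Ty.real → Prog
  | storeI : ℕ → Expr Ty.int → Expr Ty.int → Prog
  | storeR : ℕ → Expr Ty.int → Expr Ty.real → Prog
  | rand : ℕ → Expr Ty.int → Prog
  | seq : Prog → Prog → Prog
  | cond : Expr Ty.int → Prog → Prog → Prog
  | loop : Expr Ty.int → Prog → Prog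

/-- The contents of the variables `ivar x`, `rvar x` and of the array cells `iarr a z`,
`rarr a z` (array `a`, address `z`). -/
structure Store where
  ivar : ℕ → ℤ
  rvar : ℕ → ℝ
  iarr : ℕ → ℤ → ℤ
  rarr : ℕ → ℤ → ℝ

/-- The value of an expression; a comparison has the value `1` if it holds, and `0` otherwise. -/
noncomputable def Expr.eval (s : Store) : {t : Ty} → Expr t → t.denote
  | _, Expr.litI z => z
  | _, Expr.varI x => s.ivar x
  | _, Expr.loadI a e => s.iarr a (e.eval s)
  | _, Expr.addI e f => e.eval s + f.eval s
  | _, Expr.subI e f => e.eval s - f.eval s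
  | _, Expr.mulI e f => e.eval s * f.eval s
  | _, Expr.leI e f => if e.eval s ≤ f.eval s then 1 else 0
  | _, Expr.leR e f => if e.eval s ≤ f.eval s then 1 else 0
  | _, Expr.floor e => ⌊e.eval s⌋
  | _, Expr.ofInt e => ((e.eval s : ℤ) : ℝ)
  | _, Expr.varR x => s.rvar x
  | _, Expr.loadR a e => s.rarr a (e.eval s)
  | _, Expr.addR e f => e.eval s + f.eval s
  | _, Expr.subR e f => e.eval s - f.eval s
  | _, Expr.mulR e f => e.eval s * f.eval s
  | _, Expr.divR e f => e.eval s / f.eval s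

/-- The number of unit-cost operations needed to evaluate an expression. -/
def Expr.size : {t : Ty} → Expr t → ℕ
  | _, Expr.litI _ => 1
  | _, Expr.varI _ => 1
  | _, Expr.loadI _ e => e.size + 1
  | _, Expr.addI e f => e.size + f.size + 1
  | _, Expr.subI e f => e.size + f.size + 1
  | _, Expr.mulI e f => e.size + f.size + 1
  | _, Expr.leI e f => e.size + f.size + 1
  | _, Expr.leR e f => e.size + f.size + 1
  | _, Expr.floor e => e.size + 1
  | _, Expr.ofInt e => e.size + 1
  | _, Expr.varR _ => 1
  | _, Expr.loadR _ e => e.size + 1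
  | _, Expr.addR e f => e.size + f.size + 1
  | _, Expr.subR e f => e.size + f.size + 1
  | _, Expr.mulR e f => e.size + f.size + 1
  | _, Expr.divR e f => e.size + f.size + 1

/-- Set an integer variable. -/
def Store.setI (s : Store) (x : ℕ) (v : ℤ) : Store :=
  { s with ivar := Function.update s.ivar x v }

/-- Set a real variable. -/
def Store.setR (s : Store) (x : ℕ) (v : ℝ) : Store :=
  { s with rvar := Function.update s.rvar x v }

/-- Write one cell of an integer array. -/
def Store.storeI (s : Store) (a : ℕ) (z v : ℤ) : Store :=
  { s with iarr := Function.update s.iarr a (Function.update (s.iarr a) z v) }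

/-- Write one cell of a real array. -/
def Store.storeR (s : Store) (a : ℕ) (z : ℤ) (v : ℝ) : Store :=
  { s with rarr := Function.update s.rarr a (Function.update (s.rarr a) z v) }

/-- A configuration: the stack of programs still to be executed, and the store. The machine has
halted when the stack is empty. -/
abbrev Config : Type := List Prog × Store

/-- One step of the machine, as a probability distribution over the next configuration. In the
case of `rand` the range is `{0, …, v - 1}` for a value `v ≥ 1`, and `{0}` for `v ≤ 0`. -/
noncomputable def step : Config → PMF Config
  | ([], s) => PMF.pure ([], s)
  | (Prog.skip :: K, s) => PMF.pure (K, s)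
  | (Prog.setI x e :: K, s) => PMF.pure (K, s.setI x (e.eval s))
  | (Prog.setR x e :: K, s) => PMF.pure (K, s.setR x (e.eval s))
  | (Prog.storeI a e f :: K, s) => PMF.pure (K, s.storeI a (e.eval s) (f.eval s))
  | (Prog.storeR a e f :: K, s) => PMF.pure (K, s.storeR a (e.eval s) (f.eval s))
  | (Prog.rand x e :: K, s) =>
      (PMF.uniformOfFintype (Fin (((e.eval s : ℤ) - 1).toNat + 1))).map
        fun i => (K, s.setI x (i.val : ℤ))
  | (Prog.seq A B :: K, s) => PMF.pure (A :: B :: K, s)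
  | (Prog.cond e A B :: K, s) =>
      PMF.pure (if (e.eval s : ℤ) ≠ 0 then (A :: K, s) else (B :: K, s))
  | (Prog.loop e A :: K, s) =>
      PMF.pure (if (e.eval s : ℤ) ≠ 0 then (A :: Prog.loop e A :: K, s) else (K, s))

/-- The cost of executing the next step: one unit, and one for each operation in the expressions
that are evaluated. A halted machine costs nothing. -/
def stepCost : Config → ℕ
  | ([], _) => 0
  | (Prog.skip :: _, _) => 1
  | (Prog.setI _ e :: _, _) => e.size + 1
  | (Prog.setR _ e :: _, _) => e.size + 1
  | (Prog.storeI _ e f :: _, _) => e.size + f.size + 1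
  | (Prog.storeR _ e f :: _, _) => e.size + f.size + 1
  | (Prog.rand _ e :: _, _) => e.size + 1
  | (Prog.seq _ _ :: _, _) => 1
  | (Prog.cond e _ _ :: _, _) => e.size + 1
  | (Prog.loop e _ :: _, _) => e.size + 1

/-- The distribution of the configuration after `t` steps. -/
noncomputable def runDist : ℕ → Config → PMF Config
  | 0, c => PMF.pure c
  | t + 1, c => (step c).bind (runDist t)

/-- The expected running time of a program on an initial store: the sum over all `t` of the
expected cost of step `t`. It is infinite unless the program halts with probability one. -/
noncomputable def expectedTime (A : Prog) (s : Store) : ENNReal :=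
  ∑' t : ℕ, ∑' c : Config, runDist t ([A], s) c * (stepCost c : ENNReal)

/-- `s'` is a possible final store of the program `A` started on `s`. -/
def IsOutcome (A : Prog) (s s' : Store) : Prop :=
  ∃ t : ℕ, (([], s') : Config) ∈ (runDist t ([A], s)).support

end RealRAM

namespace KCenter

/-- The radius of the clustering of `P` with the set of centers `C`: the maximum distance of a
point of `P` to its nearest center (for nonempty `C`). -/
noncomputable def radius {d : ℕ} (P C : Finset (EuclideanSpace ℝ (Fin d))) : ℝ :=
  ⨆ x : P, Metric.infDist (x : EuclideanSpace ℝ (Fin d)) (C : Set (EuclideanSpace ℝ (Fin d)))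

/-- The radius of an optimal `k`-center clustering of `P`, with centers chosen in `P`. The
infimum is a minimum over finitely many sets of centers, at least one if `k ≤ |P|`. -/
noncomputable def optRadius {d : ℕ} (P : Finset (EuclideanSpace ℝ (Fin d))) (k : ℕ) : ℝ :=
  sInf {ρ : ℝ | ∃ C : Finset (EuclideanSpace ℝ (Fin d)), C ⊆ P ∧ C.card = k ∧ ρ = radius P C}

open scoped Classical in
/-- The set of points that is listed by `p`. -/
noncomputable def pointSet {d m : ℕ} (p : Fin m → EuclideanSpace ℝ (Fin d)) :
    Finset (EuclideanSpace ℝ (Fin d)) :=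
  Finset.univ.image p

/-- The initial store for the points `p 0, …, p (n - 1)` and the parameter `k`: the integer
variables `0` and `1` hold `n` and `k`, cell `i` of the real array `j` holds the `j`-th coordinate
of `p i`, and everything else is zero. -/
noncomputable def input {d n : ℕ} (p : Fin n → EuclideanSpace ℝ (Fin d)) (k : ℕ) :
    RealRAM.Store where
  ivar x := if x = 0 then (n : ℤ) else if x = 1 then (k : ℤ) else 0
  rvar _ := 0
  iarr _ _ := 0
  rarr j z :=
    if h : j < d ∧ 0 ≤ z ∧ z.toNat < n then p ⟨z.toNat, h.2.2⟩ ⟨j, h.1⟩ else 0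

/-- The store `s` contains a `k`-center clustering of the points `p` that is optimal up to the
factor `α`: cells `0, …, k - 1` of the integer array `0` hold the indices of `k` distinct centers,
whose clustering has radius at most `α` times the optimum, and cell `i` of the integer array `1`
holds the number of a center within that distance of `p i`, the center of the cluster of `p i`. -/
def IsApproxClustering {d n : ℕ} (α : ℝ) (p : Fin n → EuclideanSpace ℝ (Fin d)) (k : ℕ)
    (s : RealRAM.Store) : Prop :=
  ∃ (c : Fin k → Fin n) (a : Fin n → Fin k),
    Function.Injective c ∧
    (∀ j : Fin k, s.iarr 0 (j.val : ℤ) = ((c j).val : ℤ)) ∧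
    (∀ i : Fin n, s.iarr 1 (i.val : ℤ) = ((a i).val : ℤ)) ∧
    radius (pointSet p) (pointSet fun j => p (c j)) ≤ α * optRadius (pointSet p) k ∧
    ∀ i : Fin n, dist (p i) (p (c (a i))) ≤ α * optRadius (pointSet p) k

end KCenter

/-! ### Expected running times -/

namespace RealRAM

open scoped ENNReal

/-! The factor 2 comes from a pigeonhole certificate. If more than `k` points have pairwise
distances at least `t`, two of them share a center in any clustering with `k` centers, so `t` is at
most twice the optimal radius (`le_two_mul_optRadius`). For `k < n` the program stops with a number
`lo`, centers within squared distance `lo` of all points, and more than `k` points with pairwise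
squared distances at least `lo` (`Clustered`). For `k = n` every point is its own center. Exactness
is reached in two phases, each of which costs expected linear time.

The first phase finds the optimal radius up to constant factors, by net-and-prune on grids
(`searchRound_spec`). Sample a remaining point and let `ℓ` be the distance to its nearest neighbor
among the remaining points. If a net on the grid of side `2ℓ` has more points than there are
available centers, `2ℓ` is too small as a scale: continue with the net only, from which the points
with close neighbors have largely disappeared (`IsNet.card_le`, `Pruned.net`). Otherwise pass to a
side at most `ℓ/2`. If its net is too large, the scale has been found (`Pruned.isScale`). If not,
the points that are alone in their grid neighborhood get centers of their own and are discarded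
(`Pruned.prune`), among them all points whose nearest neighbor is at distance at least `ℓ`
(`card_le_isolated`).

The second phase starts from a greedy clustering whose radius is a constant times the scale
(`start_spec`) and keeps a set of active points, those whose squared distance to their center
exceeds the certified bound `lo`. Sample an active point, let `m` be its squared distance to its
center, and add centers greedily until every active point is within squared distance less than `m`
of one. If at most `k` centers result, the clustering improves. If there are more, their pairwise
squared distances are at least `m`, so `m` becomes the new certified bound. A point can be improved
only boundedly often: each time its own center gets closer, one more center lies near it but not
closer than its own, and centers near a point occupy distinct cells of a bounded neighborhood
(`card_others_le`, `refineRound_spec`).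

In both phases the potential drops, up to a constant, by the number of points on one side of the
sample in the order by the relevant distance, and the sample does not know which side. The smaller
side has on average at least an eighth of the points (`sq_le_sum_min_card`), while a round costs
linear time in the number of current points. A drift argument then bounds the expected total by the
initial potential, which is linear in `n` (`ert_sampling_loop`).

A pass over the points takes constant time per point because a cell is encoded by an injective
integer address into a table that is never cleared; each entry is checked against the point to which
it refers (`probe_exec`), so stale contents do no harm.

The machine is analyzed by an expected-cost transformer `ert`, where a loop is the infimum of its
super-invariants. It bounds the expected running time for every final payment `g`
(`expectedTime_le_ert`). Choosing `g = ∞` on wrong outputs turns one finite bound into both claims: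
linear expected time, and correctness of every possible outcome. -/

/-- The expected cost of executing a program and then paying `g` in the final store. -/
noncomputable def ert : Prog → (Store → ℝ≥0∞) → Store → ℝ≥0∞
  | Prog.skip, g, s => 1 + g s
  | Prog.setI x e, g, s => ((e.size + 1 : ℕ) : ℝ≥0∞) + g (s.setI x (e.eval s))
  | Prog.setR x e, g, s => ((e.size + 1 : ℕ) : ℝ≥0∞) + g (s.setR x (e.eval s))
  | Prog.storeI a e f, g, s =>
      ((e.size + f.size + 1 : ℕ) : ℝ≥0∞) + g (s.storeI a (e.eval s) (f.eval s))
  | Prog.storeR a e f, g, s =>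
      ((e.size + f.size + 1 : ℕ) : ℝ≥0∞) + g (s.storeR a (e.eval s) (f.eval s))
  | Prog.rand x e, g, s =>
      ((e.size + 1 : ℕ) : ℝ≥0∞) +
        ∑' i : Fin (((e.eval s : ℤ) - 1).toNat + 1),
          PMF.uniformOfFintype (Fin (((e.eval s : ℤ) - 1).toNat + 1)) i *
            g (s.setI x (i.val : ℤ))
  | Prog.seq A B, g, s => 1 + ert A (ert B g) s
  | Prog.cond e A B, g, s =>
      ((e.size + 1 : ℕ) : ℝ≥0∞) + if (e.eval s : ℤ) ≠ 0 then ert A g s else ert B g s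
  | Prog.loop e A, g, s =>
      ⨅ X : {X : Store → ℝ≥0∞ // ∀ s, ((e.size + 1 : ℕ) : ℝ≥0∞) +
        (if (e.eval s : ℤ) ≠ 0 then ert A X s else g s) ≤ X s}, X.1 s

theorem ert_mono (A : Prog) {g h : Store → ℝ≥0∞} (hgh : ∀ s, g s ≤ h s) (s : Store) :
    ert A g s ≤ ert A h s := by
  induction A generalizing g h s with
  | skip => exact add_le_add le_rfl (hgh _)
  | setI x e => exact add_le_add le_rfl (hgh _)
  | setR x e => exact add_le_add le_rfl (hgh _)
  | storeI a e f => exact add_le_add le_rfl (hgh _)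
  | storeR a e f => exact add_le_add le_rfl (hgh _)
  | rand x e =>
    exact add_le_add le_rfl (ENNReal.tsum_le_tsum fun i => mul_le_mul_right (hgh _) _)
  | seq A B ihA ihB => exact add_le_add le_rfl (ihA (fun s => ihB hgh s) s)
  | cond e A B ihA ihB =>
    refine add_le_add le_rfl ?_
    split_ifs
    · exact ihA hgh s
    · exact ihB hgh s
  | loop e A ihA =>
    refine le_iInf fun X => ?_
    refine iInf_le_of_le ⟨X.1, fun t => le_trans (add_le_add le_rfl ?_) (X.2 t)⟩ le_rfl
    split_ifs
    · exact le_rfl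
    · exact hgh t

theorem ert_loop_le {e : Expr Ty.int} {A : Prog} {g : Store → ℝ≥0∞} (X : Store → ℝ≥0∞)
    (hX : ∀ s, ((e.size + 1 : ℕ) : ℝ≥0∞) +
      (if (e.eval s : ℤ) ≠ 0 then ert A X s else g s) ≤ X s) (s : Store) :
    ert (Prog.loop e A) g s ≤ X s :=
  iInf_le_of_le ⟨X, hX⟩ le_rfl

/-- By monotonicity the infimum of super-invariants is a super-invariant, so the value of a loop is
the least one. Soundness with respect to the step semantics uses this inequality only. -/
theorem le_ert_loop (e : Expr Ty.int) (A : Prog) (g : Store → ℝ≥0∞) (s : Store) :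
    ((e.size + 1 : ℕ) : ℝ≥0∞) +
      (if (e.eval s : ℤ) ≠ 0 then ert A (ert (Prog.loop e A) g) s else g s) ≤
      ert (Prog.loop e A) g s := by
  refine le_iInf fun X => le_trans (add_le_add le_rfl ?_) (X.2 s)
  split_ifs
  · exact ert_mono A (fun t => ert_loop_le X.1 X.2 t) s
  · exact le_rfl

/-- The expected cost of executing a stack of programs and then paying `g`. -/
noncomputable def ertStack : List Prog → (Store → ℝ≥0∞) → Store → ℝ≥0∞
  | [], g => g
  | A :: K, g => ert A (ertStack K g)

theorem tsum_pure_mul {α : Type*} (a : α) (h : α → ℝ≥0∞) :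
    ∑' c, (PMF.pure a) c * h c = h a := by
  classical
  rw [tsum_eq_single a]
  · simp
  · intro b hb
    simp [PMF.pure_apply, hb]

theorem tsum_bind_mul {α β : Type*} (p : PMF α) (f : α → PMF β) (h : β → ℝ≥0∞) :
    ∑' c, (p.bind f) c * h c = ∑' a, p a * ∑' c, f a c * h c := by
  simp only [PMF.bind_apply, ← ENNReal.tsum_mul_right, ← ENNReal.tsum_mul_left, mul_assoc]
  exact ENNReal.tsum_comm

theorem tsum_map_mul {α β : Type*} (p : PMF α) (f : α → β) (h : β → ℝ≥0∞) :
    ∑' c, (p.map f) c * h c = ∑' a, p a * h (f a) := by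
  rw [PMF.map, tsum_bind_mul]
  simp only [Function.comp, tsum_pure_mul]

/-- `ertStack` is a potential function for the machine: each step pays its cost out of the expected
decrease. The inequality is strict at most for loops, where one unfolding is used. -/
theorem stepCost_add_le (g : Store → ℝ≥0∞) (c : Config) :
    (stepCost c : ℝ≥0∞) + ∑' c', step c c' * ertStack c'.1 g c'.2 ≤ ertStack c.1 g c.2 := by
  obtain ⟨K, s⟩ := c
  cases K with
  | nil => simp [stepCost, step]
  | cons A K =>
    cases A with
    | skip => simp [stepCost, step, ertStack, ert]
    | setI x e => simp [stepCost, step, ertStack, ert]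
    | setR x e => simp [stepCost, step, ertStack, ert]
    | storeI a e f => simp [stepCost, step, ertStack, ert]
    | storeR a e f => simp [stepCost, step, ertStack, ert]
    | rand x e =>
      simp only [stepCost, step, tsum_map_mul, ertStack, ert]
      exact le_rfl
    | seq A B => simp [stepCost, step, ertStack, ert]
    | cond e A B =>
      simp only [stepCost, step, tsum_pure_mul, ertStack, ert]
      split_ifs <;> exact le_rfl
    | loop e A =>
      refine le_trans ?_ (le_ert_loop e A (ertStack K g) s)
      simp only [stepCost, step, tsum_pure_mul]
      split_ifs <;> exact le_rfl

/-- Telescoping of `stepCost_add_le`: the cost of the first `T` steps plus the expected remaining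
potential never exceeds the initial potential. -/
theorem sum_runDist_le (g : Store → ℝ≥0∞) (T : ℕ) (c : Config) :
    ∑ t ∈ Finset.range T, ∑' c', runDist t c c' * (stepCost c' : ℝ≥0∞) +
      ∑' c', runDist T c c' * ertStack c'.1 g c'.2 ≤ ertStack c.1 g c.2 := by
  induction T generalizing c with
  | zero => simp [runDist]
  | succ T ih =>
    refine le_trans ?_ (stepCost_add_le g c)
    rw [Finset.sum_range_succ']
    simp only [runDist, tsum_pure_mul, tsum_bind_mul]
    rw [add_comm (∑ t ∈ Finset.range T, _) _, add_assoc]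
    refine add_le_add le_rfl ?_
    rw [← Summable.tsum_finsetSum (fun i _ => ENNReal.summable), ← ENNReal.tsum_add]
    refine ENNReal.tsum_le_tsum fun c' => ?_
    rw [← Finset.mul_sum, ← mul_add]
    exact mul_le_mul_right (ih c') _

theorem expectedTime_le_ert (A : Prog) (g : Store → ℝ≥0∞) (s : Store) :
    expectedTime A s ≤ ert A g s :=
  ENNReal.tsum_le_of_sum_range_le fun T => le_trans le_self_add (sum_runDist_le g T ([A], s))

/-- An outcome has positive probability at some time, so an infinite payment there would make the
expectation infinite. This is how the cost calculus proves partial correctness. -/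
theorem IsOutcome.ne_top_of_ert {A : Prog} {g : Store → ℝ≥0∞} {s s' : Store}
    (h : IsOutcome A s s') (hA : ert A g s ≠ ∞) : g s' ≠ ∞ := by
  intro hg
  obtain ⟨t, ht⟩ := h
  apply hA
  have h1 := le_trans le_add_self (sum_runDist_le g t ([A], s))
  have h2 := le_trans (ENNReal.le_tsum (([], s') : Config)) h1
  simp only [ertStack, hg] at h2
  rw [ENNReal.mul_top ((PMF.mem_support_iff _ _).1 ht)] at h2
  exact top_le_iff.1 h2

/-! ### Worst-case specifications -/

/-- From the store `s`, the program `A` can be charged with cost `c`, and ends in a store that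
satisfies `Q`. -/
def Spec (A : Prog) (s : Store) (c : ℕ) (Q : Store → Prop) : Prop :=
  ∀ (g : Store → ℝ≥0∞) (b : ℝ≥0∞), (∀ s', Q s' → g s' ≤ b) → ert A g s ≤ (c : ℝ≥0∞) + b

theorem Spec.mono {A : Prog} {s : Store} {c c' : ℕ} {Q Q' : Store → Prop} (h : Spec A s c Q)
    (hc : c ≤ c') (hQ : ∀ s', Q s' → Q' s') : Spec A s c' Q' := fun g b hg =>
  le_trans (h g b fun s' hs' => hg s' (hQ s' hs')) (add_le_add (by exact_mod_cast hc) le_rfl)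

theorem Spec.seq {A B : Prog} {s : Store} {c₁ c₂ c : ℕ} {Q Q' : Store → Prop} (h₁ : Spec A s c₁ Q)
    (h₂ : ∀ s', Q s' → Spec B s' c₂ Q') (hc : 1 + c₁ + c₂ ≤ c) : Spec (Prog.seq A B) s c Q' := by
  intro g b hg
  refine le_trans (add_le_add le_rfl (h₁ _ (c₂ + b) fun s' hs' => h₂ s' hs' g b hg)) ?_
  rw [← add_assoc, ← add_assoc]
  refine add_le_add ?_ le_rfl
  exact_mod_cast hc

theorem Spec.cond {e : Expr Ty.int} {A B : Prog} {s : Store} {c₁ c : ℕ} {Q : Store → Prop}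
    (hA : (e.eval s : ℤ) ≠ 0 → Spec A s c₁ Q) (hB : (e.eval s : ℤ) = 0 → Spec B s c₁ Q)
    (hc : e.size + 1 + c₁ ≤ c) : Spec (Prog.cond e A B) s c Q := by
  intro g b hg
  simp only [ert]
  refine le_trans (b := ((e.size + 1 : ℕ) : ℝ≥0∞) + ((c₁ : ℝ≥0∞) + b)) (add_le_add le_rfl ?_) ?_
  · split_ifs with h
    · exact hA h g b hg
    · exact hB (not_not.1 h) g b hg
  · rw [← add_assoc]
    exact add_le_add (by exact_mod_cast hc) le_rfl

/-- Programs without loops and random choices. -/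
def Prog.Simple : Prog → Prop
  | Prog.rand _ _ => False
  | Prog.loop _ _ => False
  | Prog.seq A B => A.Simple ∧ B.Simple
  | Prog.cond _ A B => A.Simple ∧ B.Simple
  | _ => True

/-- The effect of a simple program. -/
noncomputable def Prog.exec : Prog → Store → Store
  | Prog.setI x e, s => s.setI x (e.eval s)
  | Prog.setR x e, s => s.setR x (e.eval s)
  | Prog.storeI a e f, s => s.storeI a (e.eval s) (f.eval s)
  | Prog.storeR a e f, s => s.storeR a (e.eval s) (f.eval s)
  | Prog.seq A B, s => B.exec (A.exec s)
  | Prog.cond e A B, s => if (e.eval s : ℤ) ≠ 0 then A.exec s else B.exec s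
  | _, s => s

/-- A bound for the cost of a simple program. -/
def Prog.cost : Prog → ℕ
  | Prog.skip => 1
  | Prog.setI _ e => e.size + 1
  | Prog.setR _ e => e.size + 1
  | Prog.storeI _ e f => e.size + f.size + 1
  | Prog.storeR _ e f => e.size + f.size + 1
  | Prog.seq A B => 1 + A.cost + B.cost
  | Prog.cond e A B => e.size + 1 + (A.cost + B.cost)
  | _ => 0

theorem Prog.Simple.spec {A : Prog} (hA : A.Simple) (s : Store) :
    Spec A s A.cost (fun s' => s' = A.exec s) := by
  induction A generalizing s with
  | skip => exact fun g b hg => add_le_add (by simp [Prog.cost]) (hg _ rfl)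
  | setI x e => exact fun g b hg => add_le_add le_rfl (hg _ rfl)
  | setR x e => exact fun g b hg => add_le_add le_rfl (hg _ rfl)
  | storeI a e f => exact fun g b hg => add_le_add le_rfl (hg _ rfl)
  | storeR a e f => exact fun g b hg => add_le_add le_rfl (hg _ rfl)
  | rand x e => exact hA.elim
  | loop e A ih => exact hA.elim
  | seq A B ihA ihB =>
    refine Spec.seq (ihA hA.1 s) (fun s' hs' => ?_) le_rfl
    subst hs'
    exact ihB hA.2 _
  | cond e A B ihA ihB =>
    refine Spec.cond (fun h => (ihA hA.1 s).mono (c' := A.cost + B.cost) (by omega) ?_)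
      (fun h => (ihB hA.2 s).mono (by omega) ?_) le_rfl
    · rintro s' rfl; simp [Prog.exec, h]
    · rintro s' rfl; simp [Prog.exec, h]

/-! ### Frames -/

/-- The program may write the integer variable `x`. -/
def Prog.WritesI : Prog → ℕ → Prop
  | Prog.setI y _, x => x = y
  | Prog.rand y _, x => x = y
  | Prog.seq A B, x => A.WritesI x ∨ B.WritesI x
  | Prog.cond _ A B, x => A.WritesI x ∨ B.WritesI x
  | Prog.loop _ A, x => A.WritesI x
  | _, _ => False

/-- The program may write the real variable `x`. -/
def Prog.WritesR : Prog → ℕ → Prop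
  | Prog.setR y _, x => x = y
  | Prog.seq A B, x => A.WritesR x ∨ B.WritesR x
  | Prog.cond _ A B, x => A.WritesR x ∨ B.WritesR x
  | Prog.loop _ A, x => A.WritesR x
  | _, _ => False

/-- The program may write the integer array `a`. -/
def Prog.WritesArr : Prog → ℕ → Prop
  | Prog.storeI b _ _, a => a = b
  | Prog.seq A B, a => A.WritesArr a ∨ B.WritesArr a
  | Prog.cond _ A B, a => A.WritesArr a ∨ B.WritesArr a
  | Prog.loop _ A, a => A.WritesArr a
  | _, _ => False

/-- The program does not write real arrays. -/
def Prog.KeepsRArr : Prog → Prop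
  | Prog.storeR _ _ _ => False
  | Prog.seq A B => A.KeepsRArr ∧ B.KeepsRArr
  | Prog.cond _ A B => A.KeepsRArr ∧ B.KeepsRArr
  | Prog.loop _ A => A.KeepsRArr
  | _ => True

/-- The stores `s` and `s'` agree on everything that `A` does not write. -/
structure Agree (A : Prog) (s s' : Store) : Prop where
  ivar : ∀ x, ¬A.WritesI x → s'.ivar x = s.ivar x
  rvar : ∀ x, ¬A.WritesR x → s'.rvar x = s.rvar x
  iarr : ∀ a, ¬A.WritesArr a → s'.iarr a = s.iarr a
  rarr : A.KeepsRArr → s'.rarr = s.rarr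

theorem Agree.refl (A : Prog) (s : Store) : Agree A s s :=
  ⟨fun _ _ => rfl, fun _ _ => rfl, fun _ _ => rfl, fun _ => rfl⟩

theorem Agree.trans {A : Prog} {s s' s'' : Store} (h : Agree A s s') (h' : Agree A s' s'') :
    Agree A s s'' :=
  ⟨fun x hx => (h'.ivar x hx).trans (h.ivar x hx), fun x hx => (h'.rvar x hx).trans (h.rvar x hx),
    fun x hx => (h'.iarr x hx).trans (h.iarr x hx), fun hx => (h'.rarr hx).trans (h.rarr hx)⟩

theorem Agree.seq_left {A B : Prog} {s s' : Store} (h : Agree A s s') :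
    Agree (Prog.seq A B) s s' :=
  ⟨fun x hx => h.ivar x fun h => hx (Or.inl h), fun x hx => h.rvar x fun h => hx (Or.inl h),
    fun x hx => h.iarr x fun h => hx (Or.inl h), fun hx => h.rarr hx.1⟩

theorem Agree.seq_right {A B : Prog} {s s' : Store} (h : Agree B s s') :
    Agree (Prog.seq A B) s s' :=
  ⟨fun x hx => h.ivar x fun h => hx (Or.inr h), fun x hx => h.rvar x fun h => hx (Or.inr h),
    fun x hx => h.iarr x fun h => hx (Or.inr h), fun hx => h.rarr hx.2⟩

theorem Agree.cond_left {e : Expr Ty.int} {A B : Prog} {s s' : Store} (h : Agree A s s') :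
    Agree (Prog.cond e A B) s s' :=
  ⟨fun x hx => h.ivar x fun h => hx (Or.inl h), fun x hx => h.rvar x fun h => hx (Or.inl h),
    fun x hx => h.iarr x fun h => hx (Or.inl h), fun hx => h.rarr hx.1⟩

theorem Agree.cond_right {e : Expr Ty.int} {A B : Prog} {s s' : Store} (h : Agree B s s') :
    Agree (Prog.cond e A B) s s' :=
  ⟨fun x hx => h.ivar x fun h => hx (Or.inr h), fun x hx => h.rvar x fun h => hx (Or.inr h),
    fun x hx => h.iarr x fun h => hx (Or.inr h), fun hx => h.rarr hx.2⟩

theorem Agree.loop {e : Expr Ty.int} {A : Prog} {s s' : Store} (h : Agree A s s') :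
    Agree (Prog.loop e A) s s' :=
  ⟨h.ivar, h.rvar, h.iarr, h.rarr⟩

theorem agree_setI (x : ℕ) (e : Expr Ty.int) (s : Store) (v : ℤ) :
    Agree (Prog.setI x e) s (s.setI x v) :=
  ⟨fun _ hy => Function.update_of_ne hy _ _, fun _ _ => rfl, fun _ _ => rfl, fun _ => rfl⟩

/-- Only the stores that agree with the initial one matter for the expected cost. -/
theorem ert_congr_of_agree (A : Prog) {g h : Store → ℝ≥0∞} (s : Store)
    (hgh : ∀ s', Agree A s s' → g s' ≤ h s') : ert A g s ≤ ert A h s := by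
  classical
  induction A generalizing g h s with
  | skip => exact add_le_add le_rfl (hgh _ (Agree.refl _ _))
  | setI x e => exact add_le_add le_rfl (hgh _ (agree_setI _ _ _ _))
  | setR x e =>
    exact add_le_add le_rfl (hgh _ ⟨fun _ _ => rfl, fun _ hy => Function.update_of_ne hy _ _,
      fun _ _ => rfl, fun _ => rfl⟩)
  | storeI a e f =>
    exact add_le_add le_rfl (hgh _ ⟨fun _ _ => rfl, fun _ _ => rfl,
      fun _ hy => Function.update_of_ne hy _ _, fun _ => rfl⟩)
  | storeR a e f =>
    exact add_le_add le_rfl (hgh _ ⟨fun _ _ => rfl, fun _ _ => rfl, fun _ _ => rfl,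
      fun h => h.elim⟩)
  | rand x e =>
    refine add_le_add le_rfl (ENNReal.tsum_le_tsum fun i => mul_le_mul_right (hgh _ ?_) _)
    exact ⟨fun _ hy => Function.update_of_ne hy _ _, fun _ _ => rfl, fun _ _ => rfl, fun _ => rfl⟩
  | seq A B ihA ihB =>
    exact add_le_add le_rfl (ihA s fun s' hs' => ihB s' fun s'' hs'' =>
      hgh s'' (hs'.seq_left.trans hs''.seq_right))
  | cond e A B ihA ihB =>
    refine add_le_add le_rfl ?_
    split_ifs
    · exact ihA s fun s' hs' => hgh s' hs'.cond_left
    · exact ihB s fun s' hs' => hgh s' hs'.cond_right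
  | loop e A ih =>
    refine le_iInf fun X => ?_
    -- A super-invariant may be raised to `∞` at stores that are not reachable from `s`; inside the
    -- frame it stays one by the induction hypothesis.
    have key := ert_loop_le (e := e) (A := A) (g := g)
      (fun t => if Agree (Prog.loop e A) s t then X.1 t else ∞) (fun t => ?_) s
    · simpa [Agree.refl] using key
    · by_cases ht : Agree (Prog.loop e A) s t
      · rw [if_pos ht]
        refine le_trans (add_le_add le_rfl ?_) (X.2 t)
        split_ifs
        · exact ih t fun s' hs' => by rw [if_pos (ht.trans hs'.loop)]
        · exact hgh t ht
      · simp [ht]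

/-- Apply the specification to the payment that is `0` wherever the frame is violated; such stores
do not matter by `ert_congr_of_agree`. -/
theorem Spec.frame {A : Prog} {s : Store} {c : ℕ} {Q : Store → Prop} (h : Spec A s c Q) :
    Spec A s c (fun s' => Q s' ∧ Agree A s s') := by
  classical
  intro g b hg
  refine le_trans (ert_congr_of_agree A (h := fun s' => if Agree A s s' then g s' else 0) s
    fun s' hs' => by simp [hs']) (h _ b fun s' hs' => ?_)
  split_ifs with hA
  · exact hg s' ⟨hs', hA⟩
  · exact zero_le

theorem Prog.Simple.agree {A : Prog} (hA : A.Simple) (s : Store) : Agree A s (A.exec s) := by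
  induction A generalizing s with
  | skip => exact Agree.refl _ _
  | setI x e => exact agree_setI _ _ _ _
  | setR x e => exact ⟨fun _ _ => rfl, fun _ hy => Function.update_of_ne hy _ _,
      fun _ _ => rfl, fun _ => rfl⟩
  | storeI a e f => exact ⟨fun _ _ => rfl, fun _ _ => rfl,
      fun _ hy => Function.update_of_ne hy _ _, fun _ => rfl⟩
  | storeR a e f => exact ⟨fun _ _ => rfl, fun _ _ => rfl, fun _ _ => rfl, fun h => h.elim⟩
  | rand x e => exact hA.elim
  | loop e A ih => exact hA.elim
  | seq A B ihA ihB => exact (ihA hA.1 s).seq_left.trans (ihB hA.2 _).seq_right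
  | cond e A B ihA ihB =>
    simp only [Prog.exec]
    split_ifs
    · exact (ihA hA.1 s).cond_left
    · exact (ihB hA.2 s).cond_right

/-! ### Loops -/

/-- The other half of the fixed point equation: unfolding the least super-invariant once gives a
super-invariant again. -/
theorem ert_loop_unfold_le (e : Expr Ty.int) (A : Prog) (g : Store → ℝ≥0∞) (s : Store) :
    ert (Prog.loop e A) g s ≤ ((e.size + 1 : ℕ) : ℝ≥0∞) +
      (if (e.eval s : ℤ) ≠ 0 then ert A (ert (Prog.loop e A) g) s else g s) := by
  refine ert_loop_le (fun s => ((e.size + 1 : ℕ) : ℝ≥0∞) +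
      (if (e.eval s : ℤ) ≠ 0 then ert A (ert (Prog.loop e A) g) s else g s)) (fun t => ?_) s
  refine add_le_add le_rfl ?_
  split_ifs
  · exact ert_mono A (fun u => le_ert_loop e A g u) t
  · exact le_rfl

theorem Spec.loop_exit {e : Expr Ty.int} {A : Prog} {s : Store} {Q : Store → Prop}
    (he : (e.eval s : ℤ) = 0) (hQ : Q s) : Spec (Prog.loop e A) s (e.size + 1) Q := fun g b hg =>
  le_trans (ert_loop_unfold_le e A g s) (add_le_add le_rfl (by simpa [he] using hg s hQ))

theorem Spec.loop_step {e : Expr Ty.int} {A : Prog} {s : Store} {Q Q' : Store → Prop}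
    {c₁ c₂ c : ℕ} (he : (e.eval s : ℤ) ≠ 0) (hA : Spec A s c₁ Q)
    (hloop : ∀ s', Q s' → Spec (Prog.loop e A) s' c₂ Q') (hc : e.size + 1 + c₁ + c₂ ≤ c) :
    Spec (Prog.loop e A) s c Q' := by
  intro g b hg
  refine le_trans (ert_loop_unfold_le e A g s) ?_
  rw [if_pos he]
  refine le_trans (add_le_add le_rfl (hA _ (c₂ + b) fun s' hs' => hloop s' hs' g b hg)) ?_
  rw [← add_assoc, ← add_assoc]
  exact add_le_add (by exact_mod_cast hc) le_rfl

/-- Execute `body` for all values of the variable `v` from that of `lo` up to the value of the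
variable `h`, exclusively. -/
def forRange (v : ℕ) (lo : Expr Ty.int) (h : ℕ) (body : Prog) : Prog :=
  Prog.seq (Prog.setI v lo)
    (Prog.loop (Expr.leI (Expr.addI (Expr.varI v) (Expr.litI 1)) (Expr.varI h))
      (Prog.seq body (Prog.setI v (Expr.addI (Expr.varI v) (Expr.litI 1)))))

theorem spec_forRange {v h : ℕ} {lo : Expr Ty.int} {body : Prog} {s : Store} {z : ℤ}
    (I : ℤ → Store → Prop) (hbody : body.Simple) (hv : ¬body.WritesI v) (hh : ¬body.WritesI h)
    (hvh : h ≠ v) (hz : lo.eval s = z) (hle : z ≤ s.ivar h) (hI : I z (s.setI v z))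
    (hstep : ∀ i s', z ≤ i → i < s.ivar h → s'.ivar v = i →
      Agree (RealRAM.forRange v lo h body) s s' → I i s' →
        I (i + 1) ((body.exec s').setI v (i + 1))) :
    Spec (RealRAM.forRange v lo h body) s
      ((s.ivar h - z).toNat * (body.cost + 12) + lo.size + 10)
      (fun s' => I (s.ivar h) s' ∧ Agree (RealRAM.forRange v lo h body) s s') := by
  set W := RealRAM.forRange v lo h body with hW
  have hWh : ¬W.WritesI h := by
    simp [hW, RealRAM.forRange, Prog.WritesI, hvh, hh]
  have main : ∀ (m : ℕ) (i : ℤ) (s' : Store), z ≤ i → s'.ivar v = i → i + m = s.ivar h →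
      Agree W s s' → I i s' →
      Spec (Prog.loop (Expr.leI (Expr.addI (Expr.varI v) (Expr.litI 1)) (Expr.varI h))
        (Prog.seq body (Prog.setI v (Expr.addI (Expr.varI v) (Expr.litI 1))))) s'
        (m * (body.cost + 12) + 6) (fun s' => I (s.ivar h) s' ∧ Agree W s s') := by
    intro m
    induction m with
    | zero =>
      intro i s' hzi hi him hA hIi
      have h1 := hA.ivar h hWh
      refine (Spec.loop_exit (e := Expr.leI (Expr.addI (Expr.varI v) (Expr.litI 1)) (Expr.varI h))
        (Q := fun s' => I (s.ivar h) s' ∧ Agree W s s') ?_ ⟨?_, hA⟩).mono (by simp [Expr.size])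
        (fun _ h => h)
      · simp only [Expr.eval, hi, h1]
        rw [if_neg]
        have : i = s.ivar h := by simpa using him
        rw [this]; exact not_le.2 (lt_add_one _)
      · rw [← him]; simpa using hIi
    | succ m ih =>
      intro i s' hzi hi him hA hIi
      have h1 := hA.ivar h hWh
      push_cast at him
      have hs : (Prog.seq body (Prog.setI v (Expr.addI (Expr.varI v) (Expr.litI 1)))).Simple :=
        ⟨hbody, trivial⟩
      refine Spec.loop_step ?_ (hs.spec s') ?_ (c₂ := m * (body.cost + 12) + 6) ?_
      · simp only [Expr.eval, hi, h1]
        have : i + 1 ≤ s.ivar h := by rw [← him]; linarith [Int.natCast_nonneg m]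
        rw [if_pos this]
        exact one_ne_zero
      · rintro _ rfl
        have hv' : (body.exec s').ivar v = i := by rw [(hbody.agree s').ivar v hv, hi]
        have hA' := hA.trans ((hs.agree s').loop (e := Expr.leI (Expr.addI (Expr.varI v)
          (Expr.litI 1)) (Expr.varI h))).seq_right
        have hI' := hstep i s' hzi (by omega) hi hA hIi
        simp only [Prog.exec, Expr.eval, hv'] at hA' ⊢
        exact ih (i + 1) _ (by omega) (by simp [Store.setI]) (by omega) hA' hI'
      · simp only [Prog.cost, Expr.size]
        ring_nf
        omega
  refine Spec.seq (Prog.Simple.spec (A := Prog.setI v lo) trivial s) (fun s' hs' => ?_)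
    (c₂ := (s.ivar h - z).toNat * (body.cost + 12) + 6) ?_
  · subst hs'
    simp only [Prog.exec, hz]
    refine main _ z _ le_rfl (by simp [Store.setI]) ?_ (agree_setI v lo s z).seq_left hI
    rw [Int.toNat_of_nonneg (by omega)]
    ring
  · simp only [Prog.cost]
    omega

/-! ### Loops that sample an index: rank statistics and drift. -/

/-- Fewer than a quarter of the indices have fewer than `α / 4` indices above them, and likewise
below. So at least half of the indices have at least `α / 4` on both sides, which gives `α / 2 * (α
/ 4)`. Ties are harmless because both comparisons are weak. -/
theorem sq_le_sum_min_card (α : ℕ) (v : ℕ → ℝ) :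
    α * α ≤ 8 * ∑ i ∈ Finset.range α, min ((Finset.range α).filter fun j => v i ≤ v j).card
      ((Finset.range α).filter fun j => v j ≤ v i).card := by
  classical
  rcases Nat.eq_zero_or_pos α with rfl | hα
  · simp
  have few : ∀ w : ℕ → ℝ, 4 * ((Finset.range α).filter fun i =>
      4 * ((Finset.range α).filter fun j => w i ≤ w j).card < α).card < α := by
    intro w
    set S := (Finset.range α).filter fun i =>
      4 * ((Finset.range α).filter fun j => w i ≤ w j).card < α with hS
    rcases S.eq_empty_or_nonempty with h | h
    · rw [h]; simpa using hα
    · obtain ⟨i, hi, hmin⟩ := S.exists_min_image w h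
      -- All indices in `S` are counted above its minimal one `i`, and that count is small since `i`
      -- belongs to `S`.
      refine lt_of_le_of_lt (Nat.mul_le_mul_left 4 (Finset.card_le_card fun j hj => ?_))
        (Finset.mem_filter.1 hi).2
      exact Finset.mem_filter.2 ⟨(Finset.mem_filter.1 hj).1, hmin j hj⟩
  have h1 := few v
  have h2 := few fun i => -v i
  simp only [neg_le_neg_iff] at h2
  set S₁ := (Finset.range α).filter fun i =>
      4 * ((Finset.range α).filter fun j => v i ≤ v j).card < α
  set S₂ := (Finset.range α).filter fun i =>
      4 * ((Finset.range α).filter fun j => v j ≤ v i).card < α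
  have hG : α ≤ ((Finset.range α) \ (S₁ ∪ S₂)).card + (S₁.card + S₂.card) := by
    have := Finset.le_card_sdiff (S₁ ∪ S₂) (Finset.range α)
    have h3 := Finset.card_union_le S₁ S₂
    simp only [Finset.card_range] at this
    omega
  have h4 : ((Finset.range α) \ (S₁ ∪ S₂)).card * α ≤ 4 * ∑ i ∈ Finset.range α,
      min ((Finset.range α).filter fun j => v i ≤ v j).card
      ((Finset.range α).filter fun j => v j ≤ v i).card := by
    rw [Finset.mul_sum]
    refine le_trans ?_ (Finset.sum_le_sum_of_subset
      (Finset.sdiff_subset (s := Finset.range α) (t := S₁ ∪ S₂)))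
    rw [← smul_eq_mul]
    refine Finset.card_nsmul_le_sum _ _ _ fun i hi => ?_
    simp only [Finset.mem_sdiff, Finset.mem_union, S₁, S₂, Finset.mem_filter, not_or, not_and,
      not_lt] at hi
    have := hi.2.1 hi.1
    have := hi.2.2 hi.1
    omega
  have h5 : α ≤ 2 * ((Finset.range α) \ (S₁ ∪ S₂)).card := by omega
  calc α * α ≤ 2 * ((Finset.range α) \ (S₁ ∪ S₂)).card * α := Nat.mul_le_mul_right _ h5
    _ ≤ _ := by rw [mul_assoc]; omega

theorem tsum_uniform_mul_le {m : ℕ} (hm : 0 < m) (f : Fin m → ℝ≥0∞) (c : ℕ → ℕ) (N : ℕ)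
    (b : ℝ≥0∞) (hf : ∀ i : Fin m, f i ≤ (c i : ℝ≥0∞) + b)
    (hN : ∑ i ∈ Finset.range m, c i ≤ m * N) [Nonempty (Fin m)] :
    ∑' i, PMF.uniformOfFintype (Fin m) i * f i ≤ (N : ℝ≥0∞) + b := by
  have hm0 : (m : ℝ≥0∞) ≠ 0 := by exact_mod_cast hm.ne'
  have hmt : (m : ℝ≥0∞) ≠ ∞ := ENNReal.natCast_ne_top m
  simp only [PMF.uniformOfFintype_apply, Fintype.card_fin, tsum_fintype]
  have h1 : ∑ i, f i ≤ (m : ℝ≥0∞) * ((N : ℝ≥0∞) + b) := by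
    refine le_trans (Finset.sum_le_sum fun i _ => hf i) ?_
    rw [Finset.sum_add_distrib, Finset.sum_const, Finset.card_univ, Fintype.card_fin,
      nsmul_eq_mul, mul_add, Fin.sum_univ_eq_sum_range (fun i => (c i : ℝ≥0∞))]
    refine add_le_add ?_ le_rfl
    exact_mod_cast hN
  rw [← Finset.mul_sum]
  refine le_trans (mul_le_mul_right h1 _) ?_
  rw [← mul_assoc, ENNReal.inv_mul_cancel hm0 hmt, one_mul]

/-- A loop that samples an index uniformly from a range and whose potential drops, in every
iteration, in proportion to the smaller one of the numbers of indices above and below the sample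
has an expected cost proportional to the potential. -/
theorem ert_sampling_loop {e f : Expr Ty.int} {x : ℕ} {A : Prog} (I : Store → Prop)
    (Φ : Store → ℕ) (κ C : ℕ) (g : Store → ℝ≥0∞) (b : ℝ≥0∞)
    (hA : ∀ s, I s → (e.eval s : ℤ) ≠ 0 → ∃ (α : ℕ) (v : ℕ → ℝ), 0 < α ∧
      α ≤ κ * Φ s ∧ f.eval s = (α : ℤ) ∧
      ∀ i < α, Spec A (s.setI x i) (C * α) (fun s' => I s' ∧
        κ * Φ s' + min ((Finset.range α).filter fun j => v i ≤ v j).card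
          ((Finset.range α).filter fun j => v j ≤ v i).card ≤ κ * Φ s))
    (hg : ∀ s, I s → (e.eval s : ℤ) = 0 → g s ≤ b) (s : Store) (hs : I s) :
    ert (Prog.loop e (Prog.seq (Prog.rand x f) A)) g s ≤
      ((8 * (C + e.size + f.size + 3) * (κ * Φ s) + (e.size + 1) : ℕ) : ℝ≥0∞) + b := by
  classical
  -- The body costs at most `C * α`; the test, the `seq` and the draw cost `e.size + f.size + 3`, so
  -- `D * α` covers an iteration. The expected drop of `κ * Φ` is at least `α / 8`, hence a price of
  -- `8 * D` per unit of potential suffices. The extra `e.size + 1` pays for the final test.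
  set D := C + e.size + f.size + 3 with hD
  set X : Store → ℝ≥0∞ := fun s => if I s then
    ((8 * D * (κ * Φ s) + (e.size + 1) : ℕ) : ℝ≥0∞) + b else ∞ with hX
  have key := ert_loop_le (e := e) (A := Prog.seq (Prog.rand x f) A) (g := g) X (fun t => ?_) s
  · simpa [hX, hs] using key
  by_cases ht : I t
  swap
  · simp [hX, ht]
  by_cases he : (e.eval t : ℤ) = 0
  · simp only [hX, ht, he, ne_eq, not_true_eq_false, if_false, if_true]
    refine add_le_add ?_ (hg t ht he)
    exact_mod_cast Nat.le_add_left _ _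
  · obtain ⟨α, v, hα, hαΦ, hf, hspec⟩ := hA t ht he
    rw [if_pos he]
    set μ : ℕ → ℕ := fun i => min ((Finset.range α).filter fun j => v i ≤ v j).card
          ((Finset.range α).filter fun j => v j ≤ v i).card with hμ
    have hm : ((f.eval t : ℤ) - 1).toNat + 1 = α := by rw [hf]; omega
    have hμα : ∀ i, μ i ≤ α := fun i => le_trans (min_le_left _ _)
      (le_trans (Finset.card_filter_le _ _) (by simp))
    have hsum := sq_le_sum_min_card α v
    -- Ensures that the truncated subtraction in `havg` is a genuine one.
    have hbig : f.size + 2 ≤ 8 * D * (κ * Φ t) := by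
      calc f.size + 2 ≤ 8 * D * 1 := by omega
        _ ≤ _ := Nat.mul_le_mul_left _ (by omega)
    have havg : ∑' i : Fin (((f.eval t : ℤ) - 1).toNat + 1),
          PMF.uniformOfFintype (Fin (((f.eval t : ℤ) - 1).toNat + 1)) i *
            ert A X (t.setI x (i.val : ℤ)) ≤
          ((8 * D * (κ * Φ t) - (f.size + 2) : ℕ) : ℝ≥0∞) + b := by
      refine tsum_uniform_mul_le (Nat.succ_pos _) _
        (fun i => C * α + (8 * D * (κ * Φ t - μ i) + (e.size + 1))) _ b (fun i => ?_) ?_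
      · have hi : (i : ℕ) < α := lt_of_lt_of_eq i.2 hm
        push_cast
        rw [add_assoc]
        have := hspec i hi X (((8 * D * (κ * Φ t - μ i) + (e.size + 1) : ℕ) : ℝ≥0∞) + b)
          fun s' hs' => by
            simp only [hX, if_pos hs'.1]
            refine add_le_add ?_ le_rfl
            have h9 : κ * Φ s' + μ i ≤ κ * Φ t := hs'.2
            exact_mod_cast Nat.add_le_add_right (Nat.mul_le_mul_left _ (Nat.le_sub_of_add_le h9)) _
        push_cast at this
        exact this
      · rw [Nat.succ_eq_add_one, hm, Nat.mul_sub, Finset.sum_add_distrib, Finset.sum_add_distrib,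
          ← Finset.mul_sum (Finset.range α) (fun i => κ * Φ t - μ i) (8 * D)]
        have h1 : ∑ i ∈ Finset.range α, (κ * Φ t - μ i) + ∑ i ∈ Finset.range α, μ i =
            α * (κ * Φ t) := by
          rw [← Finset.sum_add_distrib, Finset.sum_congr rfl (g := fun _ => κ * Φ t)]
          · simp
          · intro i _
            have := hμα i
            omega
        simp only [Finset.sum_const, Finset.card_range, smul_eq_mul]
        refine Nat.le_sub_of_add_le ?_
        have h2 : α * (8 * D * (κ * Φ t)) = 8 * D * ∑ i ∈ Finset.range α, (κ * Φ t - μ i) +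
            8 * D * ∑ i ∈ Finset.range α, μ i := by
          rw [← mul_add, h1]; ring
        rw [h2]
        have h3 : D * (α * α) ≤ 8 * D * ∑ i ∈ Finset.range α, μ i := by
          rw [mul_comm 8 D, mul_assoc]
          exact Nat.mul_le_mul_left _ hsum
        have h4 : α ≤ α * α := Nat.le_mul_self α
        have h5 : α * (e.size + 1 + (f.size + 2)) ≤ (e.size + 1 + (f.size + 2)) * (α * α) := by
          rw [mul_comm]; exact Nat.mul_le_mul_left _ h4
        have h6 : D * (α * α) = C * (α * α) + (e.size + 1 + (f.size + 2)) * (α * α) := by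
          rw [hD]; ring
        have h7 : α * (C * α) = C * (α * α) := by ring
        have h8 : α * (e.size + 1) + α * (f.size + 2) = α * (e.size + 1 + (f.size + 2)) := by ring
        omega
    have hXt : X t = ((8 * D * (κ * Φ t) + (e.size + 1) : ℕ) : ℝ≥0∞) + b := by simp [hX, ht]
    rw [hXt]
    simp only [ert]
    refine le_trans (add_le_add le_rfl (add_le_add le_rfl (add_le_add le_rfl havg))) ?_
    rw [← add_assoc, ← add_assoc, ← add_assoc]
    refine add_le_add ?_ le_rfl
    norm_cast
    omega

end RealRAM

/-! ### Grid cells -/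

namespace KCenter

/-- An injective map from the integers to the nonnegative integers. -/
def fold (z : ℤ) : ℤ := 4 * (z * z) + z

/-- An injective map from pairs of integers to integers. -/
def pairing (x y : ℤ) : ℤ := (fold x + fold y) * (fold x + fold y) + fold x

theorem fold_nonneg (z : ℤ) : 0 ≤ fold z := by
  unfold fold
  rcases le_or_gt 0 z with h | h <;> nlinarith

/-- The difference of two values factors as `(x - y) * (4 * (x + y) + 1)`, and the second factor is
odd. -/
theorem fold_injective : Function.Injective fold := by
  intro x y h
  have h1 : (x - y) * (4 * (x + y) + 1) = 0 := by unfold fold at h; linear_combination h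
  rcases mul_eq_zero.1 h1 with h2 | h2 <;> omega

/-- With `s = fold x + fold y`, the value lies between `s ^ 2` and `s ^ 2 + s`, which is less than
`(s + 1) ^ 2`. So it determines `s`, then `fold x`, then `fold y`. -/
theorem pairing_inj {x y x' y' : ℤ} (h : pairing x y = pairing x' y') : x = x' ∧ y = y' := by
  have h1 := fold_nonneg x
  have h2 := fold_nonneg y
  have h3 := fold_nonneg x'
  have h4 := fold_nonneg y'
  have hs : fold x + fold y = fold x' + fold y' := by
    unfold pairing at h
    rcases lt_trichotomy (fold x + fold y) (fold x' + fold y') with h5 | h5 | h5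
    · nlinarith
    · exact h5
    · nlinarith
  have hx : fold x = fold x' := by
    unfold pairing at h
    rw [hs] at h
    linarith
  exact ⟨fold_injective hx, fold_injective (by linarith)⟩

/-- The address of a cell with integer coordinates `z 0, …, z (d - 1)`. -/
def key : ℕ → (ℕ → ℤ) → ℤ
  | 0, _ => 0
  | d + 1, z => pairing (key d z) (z d)

theorem key_inj {d : ℕ} {z w : ℕ → ℤ} : key d z = key d w ↔ ∀ j < d, z j = w j := by
  induction d with
  | zero => simp [key]
  | succ d ih =>
    constructor
    · intro h j hj
      obtain ⟨h1, h2⟩ := pairing_inj h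
      rcases Nat.lt_succ_iff_lt_or_eq.1 hj with h3 | rfl
      · exact ih.1 h1 j h3
      · exact h2
    · intro h
      simp only [key]
      rw [ih.2 fun j hj => h j (Nat.lt_succ_of_lt hj), h d (Nat.lt_succ_self d)]

/-- The coordinates of the grid cell of a point, for a grid of side length `g`. -/
noncomputable def cell (g : ℝ) (x : ℕ → ℝ) : ℕ → ℤ := fun j => ⌊x j / g⌋

/-- The cells `z` and `w` differ by at most `b` in every coordinate. -/
def Near (d b : ℕ) (z w : ℕ → ℤ) : Prop := ∀ j < d, |z j - w j| ≤ b

theorem Near.symm {d b : ℕ} {z w : ℕ → ℤ} (h : Near d b z w) : Near d b w z := fun j hj => by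
  rw [abs_sub_comm]; exact h j hj

theorem near_of_eq {d b : ℕ} {z w : ℕ → ℤ} (h : ∀ j < d, z j = w j) : Near d b z w := by
  intro j hj
  rw [h j hj]
  simp

/-- The maximum distance of points. -/
noncomputable def supd : ℕ → (ℕ → ℝ) → (ℕ → ℝ) → ℝ
  | 0, _, _ => 0
  | d + 1, x, y => max (supd d x y) |x d - y d|

/-- The squared Euclidean distance of points. -/
noncomputable def sqd : ℕ → (ℕ → ℝ) → (ℕ → ℝ) → ℝ
  | 0, _, _ => 0
  | d + 1, x, y => sqd d x y + (x d - y d) * (x d - y d)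

theorem supd_le {d : ℕ} {x y : ℕ → ℝ} {t : ℝ} : supd d x y ≤ t ↔ 0 ≤ t ∧ ∀ j < d, |x j - y j| ≤ t := by
  induction d with
  | zero => simp [supd]
  | succ d ih =>
    simp only [supd, max_le_iff, ih, Nat.forall_lt_succ_right]
    tauto

theorem supd_lt {d : ℕ} {x y : ℕ → ℝ} {t : ℝ} : supd d x y < t ↔ 0 < t ∧ ∀ j < d, |x j - y j| < t := by
  induction d with
  | zero => simp [supd]
  | succ d ih =>
    simp only [supd, max_lt_iff, ih, Nat.forall_lt_succ_right]
    tauto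

theorem supd_nonneg (d : ℕ) (x y : ℕ → ℝ) : 0 ≤ supd d x y := (supd_le.1 le_rfl).1

theorem abs_sub_le_supd {d j : ℕ} (x y : ℕ → ℝ) (hj : j < d) : |x j - y j| ≤ supd d x y :=
  (supd_le.1 le_rfl).2 j hj

theorem supd_comm (d : ℕ) (x y : ℕ → ℝ) : supd d x y = supd d y x := by
  induction d with
  | zero => rfl
  | succ d ih => simp only [supd, ih, abs_sub_comm]

theorem supd_self (d : ℕ) (x : ℕ → ℝ) : supd d x x = 0 := by
  induction d with
  | zero => rfl
  | succ d ih => simp [supd, ih]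

theorem supd_triangle (d : ℕ) (x y z : ℕ → ℝ) : supd d x z ≤ supd d x y + supd d y z := by
  refine supd_le.2 ⟨add_nonneg (supd_nonneg _ _ _) (supd_nonneg _ _ _), fun j hj => ?_⟩
  exact (abs_sub_le _ (y j) _).trans (add_le_add (abs_sub_le_supd x y hj) (abs_sub_le_supd y z hj))

theorem sqd_nonneg (d : ℕ) (x y : ℕ → ℝ) : 0 ≤ sqd d x y := by
  induction d with
  | zero => exact le_rfl
  | succ d ih => exact add_nonneg ih (mul_self_nonneg _)

theorem sqd_comm (d : ℕ) (x y : ℕ → ℝ) : sqd d x y = sqd d y x := by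
  induction d with
  | zero => rfl
  | succ d ih => simp only [sqd, ih]; ring

theorem sqd_self (d : ℕ) (x : ℕ → ℝ) : sqd d x x = 0 := by
  induction d with
  | zero => rfl
  | succ d ih => simp [sqd, ih]

theorem sqd_le_of_supd_le {d : ℕ} {x y : ℕ → ℝ} {t : ℝ} (h : supd d x y ≤ t) :
    sqd d x y ≤ d * (t * t) := by
  induction d with
  | zero => simp [sqd]
  | succ d ih =>
    simp only [supd, max_le_iff] at h
    have h1 := ih h.1
    have h2 : (x d - y d) * (x d - y d) ≤ t * t := by
      rw [← abs_mul_abs_self]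
      exact mul_self_le_mul_self (abs_nonneg _) h.2
    simp only [sqd]
    push_cast
    linarith

theorem supd_mul_self_le_sqd (d : ℕ) (x y : ℕ → ℝ) : supd d x y * supd d x y ≤ sqd d x y := by
  induction d with
  | zero => simp [sqd, supd]
  | succ d ih =>
    simp only [sqd, supd]
    have h1 := mul_self_nonneg (x d - y d)
    have h2 := sqd_nonneg d x y
    rcases max_cases (supd d x y) |x d - y d| with ⟨h, _⟩ | ⟨h, _⟩ <;> rw [h]
    · linarith
    · rw [abs_mul_abs_self]; linarith

theorem abs_sub_lt_of_cell {g u v : ℝ} (hg : 0 < g) {b : ℕ} (h : |⌊u / g⌋ - ⌊v / g⌋| ≤ (b : ℤ)) :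
    |u - v| < (b + 1) * g := by
  have h1 := Int.floor_le (u / g)
  have h2 := Int.lt_floor_add_one (u / g)
  have h3 := Int.floor_le (v / g)
  have h4 := Int.lt_floor_add_one (v / g)
  obtain ⟨h5, h6⟩ := abs_le.1 h
  have h5' : (-(b : ℝ)) ≤ (⌊u / g⌋ : ℝ) - ⌊v / g⌋ := by exact_mod_cast h5
  have h6' : (⌊u / g⌋ : ℝ) - ⌊v / g⌋ ≤ b := by exact_mod_cast h6
  have h7 : |u / g - v / g| < b + 1 := by rw [abs_lt]; constructor <;> linarith
  rwa [← sub_div, abs_div, abs_of_pos hg, div_lt_iff₀ hg] at h7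

theorem abs_floor_sub_le {g u v : ℝ} (hg : 0 < g) {b : ℕ} (h : |u - v| ≤ b * g) :
    |⌊u / g⌋ - ⌊v / g⌋| ≤ (b : ℤ) := by
  have h7 : |u / g - v / g| ≤ b := by
    rwa [← sub_div, abs_div, abs_of_pos hg, div_le_iff₀ hg]
  obtain ⟨h5, h6⟩ := abs_le.1 h7
  rw [abs_le]
  constructor
  · have : ⌊v / g⌋ ≤ ⌊u / g⌋ + b := by
      rw [← Int.floor_add_natCast]
      exact Int.floor_le_floor (by linarith)
    omega
  · have : ⌊u / g⌋ ≤ ⌊v / g⌋ + b := by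
      rw [← Int.floor_add_natCast]
      exact Int.floor_le_floor (by linarith)
    omega

/-- Together with `near_of_supd_le` this is all that is used to pass between distances and cells:
distance at most `b * g` forces nearness, and nearness forces distance below `(b + 1) * g`. -/
theorem supd_lt_of_near {d b : ℕ} {g : ℝ} {x y : ℕ → ℝ} (hg : 0 < g)
    (h : Near d b (cell g x) (cell g y)) : supd d x y < (b + 1) * g :=
  supd_lt.2 ⟨by positivity, fun j hj => abs_sub_lt_of_cell hg (h j hj)⟩

theorem near_of_supd_le {d b : ℕ} {g : ℝ} {x y : ℕ → ℝ} (hg : 0 < g) (h : supd d x y ≤ b * g) :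
    Near d b (cell g x) (cell g y) := fun _ hj =>
  abs_floor_sub_le hg ((abs_sub_le_supd x y hj).trans h)

/-- Distinct cells near a given one are few. -/
theorem card_le_of_near {ι : Type*} {d b : ℕ} (S : Finset ι) (c : ι → ℕ → ℤ) (z : ℕ → ℤ)
    (hnear : ∀ i ∈ S, Near d b z (c i))
    (hinj : ∀ i ∈ S, ∀ i' ∈ S, (∀ j < d, c i j = c i' j) → i = i') :
    S.card ≤ (2 * b + 1) ^ d := by
  classical
  have hcard : (Fintype.piFinset fun _ : Fin d => Finset.Icc (-(b : ℤ)) b).card =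
      (2 * b + 1) ^ d := by
    rw [Fintype.card_piFinset]
    simp only [Int.card_Icc, Finset.prod_const, Finset.card_univ, Fintype.card_fin]
    congr 1
    omega
  rw [← hcard]
  refine Finset.card_le_card_of_injOn (fun i (j : Fin d) => z j - c i j) (fun i hi => ?_)
    fun i hi i' hi' h => hinj i hi i' hi' fun j hj => ?_
  · refine Finset.mem_coe.2 (Fintype.mem_piFinset.2 fun j => Finset.mem_Icc.2 ?_)
    exact abs_le.1 (hnear i hi j j.2)
  · have := congrFun h ⟨j, hj⟩
    simp only at this
    omega

/-- All cells near the origin. -/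
def box (b : ℕ) : ℕ → List (ℕ → ℤ)
  | 0 => [fun _ => 0]
  | d + 1 => (box b d).flatMap fun o => (List.range (2 * b + 1)).map fun m : ℕ =>
      Function.update o d ((m : ℤ) - (b : ℤ))

theorem exists_mem_box {d b : ℕ} {z : ℕ → ℤ} (h : ∀ j < d, |z j| ≤ b) :
    ∃ o ∈ box b d, ∀ j < d, o j = z j := by
  induction d with
  | zero => exact ⟨fun _ => 0, by simp [box], by simp⟩
  | succ d ih =>
    obtain ⟨o, ho, hoz⟩ := ih fun j hj => h j (Nat.lt_succ_of_lt hj)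
    refine ⟨Function.update o d (z d), ?_, fun j hj => ?_⟩
    · simp only [box, List.mem_flatMap, List.mem_map, List.mem_range]
      obtain ⟨h1, h2⟩ := abs_le.1 (h d (Nat.lt_succ_self d))
      refine ⟨o, ho, (z d + b).toNat, by omega, ?_⟩
      rw [Int.toNat_of_nonneg (by omega)]
      simp
    · rcases Nat.lt_succ_iff_lt_or_eq.1 hj with h3 | rfl
      · rw [Function.update_of_ne h3.ne, hoz j h3]
      · simp

theorem abs_le_of_mem_box {d b : ℕ} {o : ℕ → ℤ} (ho : o ∈ box b d) : ∀ j < d, |o j| ≤ b := by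
  induction d generalizing o with
  | zero => simp
  | succ d ih =>
    simp only [box, List.mem_flatMap, List.mem_map, List.mem_range] at ho
    obtain ⟨o', ho', m, hm, rfl⟩ := ho
    intro j hj
    rcases Nat.lt_succ_iff_lt_or_eq.1 hj with h3 | rfl
    · rw [Function.update_of_ne h3.ne]; exact ih ho' j h3
    · rw [Function.update_self, abs_le]
      constructor <;> omega

end KCenter

/-! ### Expressions -/

namespace RealRAM

open KCenter

/-- The point whose coordinates are the cells `z` of the real arrays. -/
def Store.pt (s : Store) (z : ℤ) : ℕ → ℝ := fun j => s.rarr j z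

@[simp] theorem Store.setI_ivar (s : Store) (x : ℕ) (v : ℤ) (y : ℕ) :
    (s.setI x v).ivar y = if y = x then v else s.ivar y := by
  simp [Store.setI, Function.update_apply]

@[simp] theorem Store.setI_rvar (s : Store) (x : ℕ) (v : ℤ) : (s.setI x v).rvar = s.rvar := rfl

@[simp] theorem Store.setI_iarr (s : Store) (x : ℕ) (v : ℤ) : (s.setI x v).iarr = s.iarr := rfl

@[simp] theorem Store.setI_rarr (s : Store) (x : ℕ) (v : ℤ) : (s.setI x v).rarr = s.rarr := rfl

@[simp] theorem Store.setR_ivar (s : Store) (x : ℕ) (v : ℝ) : (s.setR x v).ivar = s.ivar := rfl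

@[simp] theorem Store.setR_rvar (s : Store) (x : ℕ) (v : ℝ) (y : ℕ) :
    (s.setR x v).rvar y = if y = x then v else s.rvar y := by
  simp [Store.setR, Function.update_apply]

@[simp] theorem Store.setR_iarr (s : Store) (x : ℕ) (v : ℝ) : (s.setR x v).iarr = s.iarr := rfl

@[simp] theorem Store.setR_rarr (s : Store) (x : ℕ) (v : ℝ) : (s.setR x v).rarr = s.rarr := rfl

@[simp] theorem Store.storeI_ivar (s : Store) (a : ℕ) (z v : ℤ) :
    (s.storeI a z v).ivar = s.ivar := rfl

@[simp] theorem Store.storeI_rvar (s : Store) (a : ℕ) (z v : ℤ) :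
    (s.storeI a z v).rvar = s.rvar := rfl

@[simp] theorem Store.storeI_iarr (s : Store) (a : ℕ) (z v : ℤ) (b : ℕ) :
    (s.storeI a z v).iarr b = if b = a then Function.update (s.iarr a) z v else s.iarr b := by
  simp [Store.storeI, Function.update_apply]

@[simp] theorem Store.storeI_rarr (s : Store) (a : ℕ) (z v : ℤ) :
    (s.storeI a z v).rarr = s.rarr := rfl

@[simp] theorem Store.setI_pt (s : Store) (x : ℕ) (v : ℤ) : (s.setI x v).pt = s.pt := rfl

@[simp] theorem Store.setR_pt (s : Store) (x : ℕ) (v : ℝ) : (s.setR x v).pt = s.pt := rfl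

@[simp] theorem Store.storeI_pt (s : Store) (a : ℕ) (z v : ℤ) : (s.storeI a z v).pt = s.pt := rfl

namespace Expr

/-- Conjunction. -/
def andI (e f : Expr Ty.int) : Expr Ty.int := mulI e f

/-- Strict comparison of integers. -/
def ltI (e f : Expr Ty.int) : Expr Ty.int := leI (addI e (litI 1)) f

/-- Equality of integers. -/
def eqI (e f : Expr Ty.int) : Expr Ty.int := andI (leI e f) (leI f e)

/-- Inequality of integers. -/
def neI (e f : Expr Ty.int) : Expr Ty.int := subI (litI 1) (eqI e f)

/-- Strict comparison of reals. -/
def ltR (e f : Expr Ty.real) : Expr Ty.int := subI (litI 1) (leR f e)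

theorem andI_ne_zero {e f : Expr Ty.int} {s : Store} :
    ((andI e f).eval s : ℤ) ≠ 0 ↔ (e.eval s : ℤ) ≠ 0 ∧ (f.eval s : ℤ) ≠ 0 :=
  mul_ne_zero_iff

theorem leI_ne_zero {e f : Expr Ty.int} {s : Store} :
    ((leI e f).eval s : ℤ) ≠ 0 ↔ (e.eval s : ℤ) ≤ f.eval s := by
  simp [eval]

theorem ltI_ne_zero {e f : Expr Ty.int} {s : Store} :
    ((ltI e f).eval s : ℤ) ≠ 0 ↔ (e.eval s : ℤ) < f.eval s := by
  rw [ltI, leI_ne_zero]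
  exact Int.add_one_le_iff

theorem eqI_ne_zero {e f : Expr Ty.int} {s : Store} :
    ((eqI e f).eval s : ℤ) ≠ 0 ↔ (e.eval s : ℤ) = f.eval s := by
  rw [eqI, andI_ne_zero, leI_ne_zero, leI_ne_zero]
  exact le_antisymm_iff.symm

theorem neI_ne_zero {e f : Expr Ty.int} {s : Store} :
    ((neI e f).eval s : ℤ) ≠ 0 ↔ (e.eval s : ℤ) ≠ f.eval s := by
  have h : ((eqI e f).eval s : ℤ) = if (e.eval s : ℤ) = f.eval s then 1 else 0 := by
    simp only [eqI, andI, eval]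
    rcases lt_trichotomy (e.eval s : ℤ) (f.eval s) with h | h | h
    · rw [if_pos h.le, if_neg (not_le.2 h), if_neg h.ne]; rfl
    · simp [h]
    · rw [if_neg (not_le.2 h), if_neg h.ne']; simp
  simp only [neI, eval, h]
  by_cases h' : (e.eval s : ℤ) = f.eval s <;> simp [h']

theorem ltR_ne_zero {e f : Expr Ty.real} {s : Store} :
    ((ltR e f).eval s : ℤ) ≠ 0 ↔ (e.eval s : ℝ) < f.eval s := by
  simp only [ltR, eval]
  split_ifs with h
  · simp [h]
  · simpa using h

/-- The greater one of two reals. -/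
def maxR (e f : Expr Ty.real) : Expr Ty.real := addR e (mulR (ofInt (leR e f)) (subR f e))

theorem maxR_eval (e f : Expr Ty.real) (s : Store) :
    ((maxR e f).eval s : ℝ) = max (e.eval s : ℝ) (f.eval s) := by
  simp only [maxR, eval]
  split_ifs with h
  · rw [max_eq_right h]; simp
  · rw [max_eq_left (not_le.1 h).le]; simp

/-- The maximum distance of the points with the numbers `p` and `q`. -/
def sup : ℕ → Expr Ty.int → Expr Ty.int → Expr Ty.real
  | 0, _, _ => ofInt (litI 0)
  | d + 1, p, q => maxR (sup d p q)
      (maxR (subR (loadR d p) (loadR d q)) (subR (loadR d q) (loadR d p)))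

theorem sup_eval (d : ℕ) (p q : Expr Ty.int) (s : Store) :
    ((sup d p q).eval s : ℝ) = supd d (s.pt (p.eval s)) (s.pt (q.eval s)) := by
  induction d with
  | zero => simp [sup, eval, supd]
  | succ d ih =>
    simp only [sup, maxR_eval, ih, supd, eval, Store.pt]
    rw [abs_eq_max_neg, neg_sub]

/-- The squared Euclidean distance of the points with the numbers `p` and `q`. -/
def sqdist : ℕ → Expr Ty.int → Expr Ty.int → Expr Ty.real
  | 0, _, _ => ofInt (litI 0)
  | d + 1, p, q => addR (sqdist d p q)
      (mulR (subR (loadR d p) (loadR d q)) (subR (loadR d p) (loadR d q)))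

theorem sqdist_eval (d : ℕ) (p q : Expr Ty.int) (s : Store) :
    ((sqdist d p q).eval s : ℝ) = sqd d (s.pt (p.eval s)) (s.pt (q.eval s)) := by
  induction d with
  | zero => simp [sqdist, eval, sqd]
  | succ d ih => simp only [sqdist, ih, sqd, eval, Store.pt]

/-- See `KCenter.fold`. -/
def fold (e : Expr Ty.int) : Expr Ty.int := addI (mulI (litI 4) (mulI e e)) e

/-- The address of the cell that is translated by `o` from the cell of the point with the number
`p`, for the grid whose side length is the value of the real variable `g`. -/
def cellKey (g : ℕ) (p : Expr Ty.int) (o : ℕ → ℤ) : ℕ → Expr Ty.int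
  | 0 => litI 0
  | d + 1 =>
      let x := fold (cellKey g p o d)
      let y := fold (addI (floor (divR (loadR d p) (varR g))) (litI (o d)))
      addI (mulI (addI x y) (addI x y)) x

theorem cellKey_eval (g : ℕ) (p : Expr Ty.int) (o : ℕ → ℤ) (d : ℕ) (s : Store) :
    ((cellKey g p o d).eval s : ℤ) =
      key d (fun j => cell (s.rvar g) (s.pt (p.eval s)) j + o j) := by
  induction d with
  | zero => simp [cellKey, eval, key]
  | succ d ih =>
    simp only [cellKey, fold, eval, ih, key, pairing, KCenter.fold, cell, Store.pt]

end Expr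

end RealRAM

/-! ### Permuted segments -/

namespace KCenter

/-- `L'` is obtained from `L` by permuting the entries with indices in `[lo, hi)`. -/
def Shuffle (lo hi : ℤ) (L L' : ℤ → ℤ) : Prop :=
  ∃ π : Equiv.Perm ℤ, (∀ z, z < lo ∨ hi ≤ z → π z = z) ∧ ∀ z, L' z = L (π z)

theorem Shuffle.refl (lo hi : ℤ) (L : ℤ → ℤ) : Shuffle lo hi L L :=
  ⟨Equiv.refl _, fun _ _ => rfl, fun _ => rfl⟩

theorem Shuffle.trans {lo hi : ℤ} {L L' L'' : ℤ → ℤ} (h : Shuffle lo hi L L')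
    (h' : Shuffle lo hi L' L'') : Shuffle lo hi L L'' := by
  obtain ⟨π, h1, h2⟩ := h
  obtain ⟨ρ, h3, h4⟩ := h'
  refine ⟨ρ.trans π, fun z hz => ?_, fun z => ?_⟩
  · simp [h3 z hz, h1 z hz]
  · simp [h4, h2]

theorem Shuffle.mono {lo hi lo' hi' : ℤ} {L L' : ℤ → ℤ} (h : Shuffle lo hi L L') (hlo : lo' ≤ lo)
    (hhi : hi ≤ hi') : Shuffle lo' hi' L L' := by
  obtain ⟨π, h1, h2⟩ := h
  exact ⟨π, fun z hz => h1 z (by omega), h2⟩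

theorem Shuffle.swap {lo hi a b : ℤ} (L : ℤ → ℤ) (ha : lo ≤ a ∧ a < hi) (hb : lo ≤ b ∧ b < hi) :
    Shuffle lo hi L (Function.update (Function.update L a (L b)) b (L a)) := by
  refine ⟨Equiv.swap a b, fun z hz => Equiv.swap_apply_of_ne_of_ne (by omega) (by omega),
    fun z => ?_⟩
  rcases eq_or_ne z b with rfl | h1
  · simp
  · rcases eq_or_ne z a with rfl | h2
    · simp [Function.update_of_ne h1]
    · rw [Function.update_of_ne h1, Function.update_of_ne h2, Equiv.swap_apply_of_ne_of_ne h2 h1]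

theorem Shuffle.outside {lo hi : ℤ} {L L' : ℤ → ℤ} (h : Shuffle lo hi L L') {z : ℤ}
    (hz : z < lo ∨ hi ≤ z) : L' z = L z := by
  obtain ⟨π, h1, h2⟩ := h
  rw [h2, h1 z hz]

theorem Shuffle.inside {lo hi : ℤ} {L L' : ℤ → ℤ} (h : Shuffle lo hi L L') {z : ℤ}
    (hz : lo ≤ z ∧ z < hi) : ∃ w, (lo ≤ w ∧ w < hi) ∧ L' z = L w := by
  obtain ⟨π, h1, h2⟩ := h
  refine ⟨π z, ?_, h2 z⟩
  -- If `π z` were outside the segment it would be a fixed point, and injectivity would give `π z =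
  -- z`.
  by_contra hc
  have h3 : π (π z) = π z := h1 _ (by omega)
  have h4 := π.injective h3
  rw [h4] at hc
  exact hc hz

theorem Shuffle.symm {lo hi : ℤ} {L L' : ℤ → ℤ} (h : Shuffle lo hi L L') : Shuffle lo hi L' L := by
  obtain ⟨π, h1, h2⟩ := h
  refine ⟨π.symm, fun z hz => ?_, fun z => ?_⟩
  · rw [Equiv.symm_apply_eq, h1 z hz]
  · rw [h2, Equiv.apply_symm_apply]

theorem Shuffle.injOn {lo hi a b : ℤ} {L L' : ℤ → ℤ} (h : Shuffle lo hi L L')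
    (hL : Set.InjOn L (Set.Ico a b)) (ha : a ≤ lo) (hb : hi ≤ b) :
    Set.InjOn L' (Set.Ico a b) := by
  obtain ⟨π, h1, h2⟩ := h
  have hmem : ∀ z ∈ Set.Ico a b, π z ∈ Set.Ico a b := by
    intro z hz
    by_contra hc
    have h3 : π (π z) = π z := h1 _ (by simp only [Set.mem_Ico] at hc; omega)
    rw [π.injective h3] at hc
    exact hc hz
  intro z hz w hw hzw
  rw [h2, h2] at hzw
  exact π.injective (hL (hmem z hz) (hmem w hw) hzw)

/-- The set of the entries of `L` with indices in `[lo, hi)`. -/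
noncomputable def seg (L : ℤ → ℤ) (lo hi : ℤ) : Finset ℤ := (Finset.Ico lo hi).image L

theorem mem_seg {L : ℤ → ℤ} {lo hi p : ℤ} : p ∈ seg L lo hi ↔ ∃ z, (lo ≤ z ∧ z < hi) ∧ L z = p := by
  simp [seg]

theorem seg_mem {L : ℤ → ℤ} {lo hi z : ℤ} (h1 : lo ≤ z) (h2 : z < hi) : L z ∈ seg L lo hi :=
  mem_seg.2 ⟨z, ⟨h1, h2⟩, rfl⟩

theorem seg_subset {L : ℤ → ℤ} {lo hi lo' hi' : ℤ} (h1 : lo' ≤ lo) (h2 : hi ≤ hi') :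
    seg L lo hi ⊆ seg L lo' hi' :=
  Finset.image_subset_image (Finset.Ico_subset_Ico h1 h2)

theorem card_seg {L : ℤ → ℤ} {lo hi : ℤ} (h : Set.InjOn L (Set.Ico lo hi)) :
    (seg L lo hi).card = (hi - lo).toNat := by
  rw [seg, Finset.card_image_of_injOn (by simpa using h), Int.card_Ico]

theorem Shuffle.seg_eq {lo hi : ℤ} {L L' : ℤ → ℤ} (h : Shuffle lo hi L L') :
    seg L' lo hi = seg L lo hi := by
  ext p
  simp only [mem_seg]
  constructor
  · rintro ⟨z, hz, rfl⟩
    obtain ⟨w, hw, h1⟩ := h.inside hz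
    exact ⟨w, hw, h1.symm⟩
  · rintro ⟨z, hz, rfl⟩
    obtain ⟨w, hw, h1⟩ := h.symm.inside hz
    exact ⟨w, hw, h1.symm⟩

theorem seg_congr {lo hi : ℤ} {L L' : ℤ → ℤ} (h : ∀ z, lo ≤ z → z < hi → L' z = L z) :
    seg L' lo hi = seg L lo hi :=
  Finset.image_congr fun z hz => by
    simp only [Finset.coe_Ico, Set.mem_Ico] at hz
    exact h z hz.1 hz.2

end KCenter

/-! ### Passes over a segment of the points -/

namespace RealRAM

open KCenter

/-- The number of points. -/
@[simp] def vn : ℕ := 0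
/-- The number of centers. -/
@[simp] def vk : ℕ := 1
/-- The position that a pass has reached. -/
@[simp] def vi : ℕ := 2
/-- The end of the segment of current points. -/
@[simp] def ve : ℕ := 3
/-- The number of tentative centers. -/
@[simp] def vc : ℕ := 4
/-- The current point. -/
@[simp] def vp : ℕ := 5
/-- The current table address. -/
@[simp] def vt : ℕ := 6
/-- The position of a candidate center. -/
@[simp] def vj : ℕ := 7
/-- A candidate center. -/
@[simp] def vq : ℕ := 8
/-- Whether the current point is covered. -/
@[simp] def vf : ℕ := 9
/-- The number of centers, which is the beginning of the segment of current points. -/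
@[simp] def vm : ℕ := 10
/-- The number of centers that are still available when searching for the scale. -/
@[simp] def vk' : ℕ := 11
/-- The end of the part that is kept by a partition. -/
@[simp] def vb : ℕ := 12
/-- Whether the scale is still unknown. -/
@[simp] def vw : ℕ := 13
/-- The sampled index, and then the sampled point. -/
@[simp] def vu : ℕ := 14
/-- The side length of the grid. -/
@[simp] def rg : ℕ := 0
/-- The distance of the sampled point to the nearest other point. -/
@[simp] def rl : ℕ := 1
/-- The side length of the grid when points were discarded last, if at all. -/
@[simp] def rs : ℕ := 2
/-- The square of the covering radius that is tested. -/
@[simp] def rm : ℕ := 3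
/-- The square of a distance such that the optimum is at least half of this distance. -/
@[simp] def rlo : ℕ := 4
/-- The permutation of the points that is being rearranged. -/
@[simp] def aL : ℕ := 0
/-- The output of the numbers of the centers. -/
@[simp] def aout : ℕ := 1
/-- The current center of every point. -/
@[simp] def aasg : ℕ := 2
/-- The tentative center of every point. -/
@[simp] def aasg' : ℕ := 3
/-- The position of the center in a grid cell. -/
@[simp] def aT : ℕ := 4
/-- Marks for points that have neighbors. -/
@[simp] def anear : ℕ := 5
/-- The positions of the centers. -/
@[simp] def apos : ℕ := 6

open RealRAM.Expr RealRAM.Prog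

/-- Execute `body o` for all `o` in a fixed list. -/
def scan (l : List (ℕ → ℤ)) (body : (ℕ → ℤ) → Prog) : Prog :=
  l.foldr (fun o A => seq (body o) A) skip

theorem scan_exec_cons (o : ℕ → ℤ) (l : List (ℕ → ℤ)) (body : (ℕ → ℤ) → Prog) (s : Store) :
    (scan (o :: l) body).exec s = (scan l body).exec ((body o).exec s) := rfl

theorem scan_simple {l : List (ℕ → ℤ)} {body : (ℕ → ℤ) → Prog} (h : ∀ o, (body o).Simple) :
    (scan l body).Simple := by
  induction l with
  | nil => trivial
  | cons o l ih => exact ⟨h o, ih⟩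

theorem scan_keepsRArr {l : List (ℕ → ℤ)} {body : (ℕ → ℤ) → Prog} (h : ∀ o, (body o).KeepsRArr) :
    (scan l body).KeepsRArr := by
  induction l with
  | nil => trivial
  | cons o l ih => exact ⟨h o, ih⟩

theorem scan_writesI {l : List (ℕ → ℤ)} {body : (ℕ → ℤ) → Prog} {x : ℕ} :
    (scan l body).WritesI x ↔ ∃ o ∈ l, (body o).WritesI x := by
  induction l with
  | nil => simp [scan, WritesI]
  | cons o l ih =>
    rw [List.exists_mem_cons_iff, ← ih]
    rfl

theorem scan_writesR {l : List (ℕ → ℤ)} {body : (ℕ → ℤ) → Prog} {x : ℕ} :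
    (scan l body).WritesR x ↔ ∃ o ∈ l, (body o).WritesR x := by
  induction l with
  | nil => simp [scan, WritesR]
  | cons o l ih =>
    rw [List.exists_mem_cons_iff, ← ih]
    rfl

theorem scan_writesArr {l : List (ℕ → ℤ)} {body : (ℕ → ℤ) → Prog} {x : ℕ} :
    (scan l body).WritesArr x ↔ ∃ o ∈ l, (body o).WritesArr x := by
  induction l with
  | nil => simp [scan, WritesArr]
  | cons o l ih =>
    rw [List.exists_mem_cons_iff, ← ih]
    rfl

theorem scan_inv {l : List (ℕ → ℤ)} {body : (ℕ → ℤ) → Prog} {J : Store → Prop}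
    (h : ∀ o ∈ l, ∀ s, J s → J ((body o).exec s)) (s : Store) (hs : J s) :
    J ((scan l body).exec s) := by
  induction l generalizing s with
  | nil => exact hs
  | cons o l ih =>
    rw [scan_exec_cons]
    exact ih (fun o' ho' => h o' (List.mem_cons_of_mem _ ho')) _ (h o List.mem_cons_self s hs)

theorem scan_hit {l : List (ℕ → ℤ)} {body : (ℕ → ℤ) → Prog} {J H : Store → Prop}
    (h : ∀ o ∈ l, ∀ s, J s → J ((body o).exec s))
    (hH : ∀ o ∈ l, ∀ s, J s → H s → H ((body o).exec s)) {o : ℕ → ℤ} (ho : o ∈ l)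
    (hit : ∀ s, J s → H ((body o).exec s)) (s : Store) (hs : J s) :
    H ((scan l body).exec s) := by
  induction l generalizing s with
  | nil => simp at ho
  | cons o' l ih =>
    rw [scan_exec_cons]
    have hJ := h o' List.mem_cons_self s hs
    rcases List.mem_cons.1 ho with rfl | ho'
    · have := scan_inv (J := fun s => J s ∧ H s) (l := l) (body := body)
        (fun o' ho' s hs => ⟨h o' (List.mem_cons_of_mem _ ho') s hs.1,
          hH o' (List.mem_cons_of_mem _ ho') s hs.1 hs.2⟩) _ ⟨hJ, hit s hs⟩
      exact this.2
    · exact ih (fun o' ho' => h o' (List.mem_cons_of_mem _ ho'))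
        (fun o' ho' => hH o' (List.mem_cons_of_mem _ ho')) ho' _ hJ

/-- Look up the center in the cell that is translated by `o` from the cell of the current point,
and execute `act` if there is one that passes a test. -/
def probe (d : ℕ) (test : Expr Ty.int) (act : Prog) (o : ℕ → ℤ) : Prog :=
  seq (setI vt (cellKey rg (varI vp) o d)) <| seq (setI vj (loadI aT (varI vt))) <|
  seq (setI vq (loadI aL (varI vj))) <|
  cond (andI (leI (litI 0) (varI vj)) (andI (ltI (varI vj) (varI vc))
    (andI (eqI (cellKey rg (varI vq) (fun _ => 0) d) (varI vt)) test))) act skip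

/-- The address of the cell of the point `p` in a grid. -/
noncomputable def Store.key (s : Store) (d : ℕ) (p : ℤ) : ℤ :=
  KCenter.key d (cell (s.rvar rg) (s.pt p))

/-- The table may contain garbage. An entry `j` is trusted only if `0 ≤ j < vc` and the point at
position `j` lies in the probed cell, which is the first alternative. If nothing happens, a center
correctly registered for that cell can only have failed `test`. -/
theorem probe_exec (d : ℕ) (test : Expr Ty.int) (act : Prog) (o : ℕ → ℤ) (s : Store) :
    ∃ (t j : ℤ) (s' : Store), s' = ((s.setI vt t).setI vj j).setI vq (s.iarr aL j) ∧
      ((probe d test act o).exec s = act.exec s' ∧ 0 ≤ j ∧ j < s.ivar vc ∧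
        (test.eval s' : ℤ) ≠ 0 ∧ (∀ l < d, cell (s.rvar rg) (s.pt (s.iarr aL j)) l =
          cell (s.rvar rg) (s.pt (s.ivar vp)) l + o l) ∨
      (probe d test act o).exec s = s' ∧ ∀ i, 0 ≤ i → i < s.ivar vc →
        s.iarr aT (s.key d (s.iarr aL i)) = i → (∀ l < d, cell (s.rvar rg) (s.pt (s.iarr aL i)) l =
          cell (s.rvar rg) (s.pt (s.ivar vp)) l + o l) → (i = j ∧ (test.eval s' : ℤ) = 0)) := by
  set t : ℤ := (cellKey rg (varI vp) o d).eval s with ht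
  set j : ℤ := s.iarr aT t with hj
  set s' := ((s.setI vt t).setI vj j).setI vq (s.iarr aL j) with hs'
  refine ⟨t, j, s', hs', ?_⟩
  rw [cellKey_eval] at ht
  have hex : (probe d test act o).exec s = if ((andI (leI (litI 0) (varI vj)) (andI (ltI (varI vj)
      (varI vc)) (andI (eqI (cellKey rg (varI vq) (fun _ => 0) d) (varI vt)) test))).eval s' : ℤ) ≠ 0
      then act.exec s' else s' := by
    rfl
  rw [hex]
  have hval : ∀ i : ℤ, KCenter.key d (fun l => cell (s.rvar rg) (s.pt (s.iarr aL i)) l + 0) = t ↔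
      ∀ l < d, cell (s.rvar rg) (s.pt (s.iarr aL i)) l =
          cell (s.rvar rg) (s.pt (s.ivar vp)) l + o l := by
    intro i
    rw [ht, key_inj]
    simp [eval]
  by_cases hc : ((andI (leI (litI 0) (varI vj)) (andI (ltI (varI vj)
      (varI vc)) (andI (eqI (cellKey rg (varI vq) (fun _ => 0) d) (varI vt)) test))).eval s' : ℤ) ≠ 0
  · left
    rw [if_pos hc]
    rw [andI_ne_zero, andI_ne_zero, andI_ne_zero, leI_ne_zero, ltI_ne_zero, eqI_ne_zero,
      cellKey_eval] at hc
    obtain ⟨h1, h2, h3, h4⟩ := hc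
    refine ⟨rfl, ?_, ?_, h4, (hval j).1 ?_⟩
    · simpa [hs', eval] using h1
    · simpa [hs', eval] using h2
    · simpa [hs', eval] using h3
  · right
    rw [if_neg hc]
    refine ⟨rfl, fun i h0 hic hT hcell => ?_⟩
    have hkey : s.key d (s.iarr aL i) = t := by
      rw [← (hval i).2 hcell]
      simp [Store.key]
    have hij : i = j := by rw [hj, ← hkey, hT]
    refine ⟨hij, ?_⟩
    by_contra h4
    apply hc
    rw [andI_ne_zero, andI_ne_zero, andI_ne_zero, leI_ne_zero, ltI_ne_zero, eqI_ne_zero,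
      cellKey_eval]
    rw [hij] at h0 hic hcell
    have h3 := (hval j).2 hcell
    refine ⟨?_, ?_, ?_, h4⟩
    · simpa [hs', eval] using h0
    · simpa [hs', eval] using hic
    · simpa [hs', eval] using h3

end RealRAM

/-! ### Scanning the neighboring cells of a point. -/

namespace RealRAM

open KCenter RealRAM.Expr RealRAM.Prog

/-- The cells of the points `p` and `q` differ by at most `b` in every coordinate. -/
def Store.Near (s : Store) (d b : ℕ) (p q : ℤ) : Prop :=
  KCenter.Near d b (cell (s.rvar rg) (s.pt p)) (cell (s.rvar rg) (s.pt q))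

/-- The table contains the first `c` points of the permutation. -/
def Store.Table (s : Store) (d : ℕ) (c : ℤ) : Prop :=
  ∀ i, 0 ≤ i → i < c → s.iarr aT (s.key d (s.iarr aL i)) = i

/-- The part of the store that is relevant for looking up centers. -/
def Store.SameTable (s s' : Store) : Prop :=
  s'.ivar vp = s.ivar vp ∧ s'.ivar vc = s.ivar vc ∧ s'.rvar = s.rvar ∧ s'.rarr = s.rarr ∧
    s'.iarr aL = s.iarr aL ∧ s'.iarr aT = s.iarr aT

theorem exists_mem_box_of_near {d b : ℕ} {z w : ℕ → ℤ} (h : KCenter.Near d b z w) :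
    ∃ o ∈ box b d, ∀ l < d, w l = z l + o l := by
  obtain ⟨o, ho, h1⟩ := exists_mem_box (z := fun l => w l - z l) (d := d) (b := b) h.symm
  exact ⟨o, ho, fun l hl => by rw [h1 l hl]; ring⟩

theorem near_of_mem_box {d b : ℕ} {z w o : ℕ → ℤ} (ho : o ∈ box b d)
    (h : ∀ l < d, w l = z l + o l) : KCenter.Near d b z w := fun l hl => by
  rw [h l hl, abs_sub_comm, add_sub_cancel_left]
  exact abs_le_of_mem_box ho l hl

/-- Scanning the cells near the current point. -/
theorem scan_probe {d b : ℕ} {test : Expr Ty.int} {act : Prog} {s : Store} (T : ℤ → ℤ → Prop)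
    (htest : ∀ s', s'.rarr = s.rarr → s'.rvar = s.rvar →
      ((test.eval s' : ℤ) ≠ 0 ↔ T (s'.ivar vp) (s'.ivar vq)))
    (J : Store → Prop) (H : ℤ → Store → Prop) (hJ : J s)
    (hact : ∀ s' t j q, J s' → s.SameTable s' →
      J (((s'.setI vt t).setI vj j).setI vq q) ∧
        ∀ i, H i s' → H i (((s'.setI vt t).setI vj j).setI vq q))
    (hit : ∀ s' t j, J s' → s.SameTable s' → 0 ≤ j → j < s.ivar vc →
      s.Near d b (s.ivar vp) (s.iarr aL j) → T (s.ivar vp) (s.iarr aL j) →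
      (fun s'' => J s'' ∧ H j s'' ∧ (∀ i, H i s' → H i s'') ∧ s.SameTable s'')
        (act.exec (((s'.setI vt t).setI vj j).setI vq (s.iarr aL j)))) :
    J ((scan (box b d) (probe d test act)).exec s) ∧
    (s.Table d (s.ivar vc) → ∀ j, 0 ≤ j → j < s.ivar vc →
      s.Near d b (s.ivar vp) (s.iarr aL j) → T (s.ivar vp) (s.iarr aL j) →
        H j ((scan (box b d) (probe d test act)).exec s)) := by
  have same : ∀ s' t j q, s.SameTable s' → s.SameTable (((s'.setI vt t).setI vj j).setI vq q) := by
    intro s' t j q hs'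
    simpa [Store.SameTable] using hs'
  have step : ∀ o ∈ box b d, ∀ s', (J s' ∧ s.SameTable s') →
      (J ((probe d test act o).exec s') ∧ s.SameTable ((probe d test act o).exec s')) ∧
      ∀ i, H i s' → H i ((probe d test act o).exec s') := by
    intro o ho s' hs'
    obtain ⟨t, j, s'', hs'', h⟩ := probe_exec d test act o s'
    obtain ⟨e1, e2, e3, e4, e5, e6⟩ := id hs'.2
    have hpt : s'.pt = s.pt := by unfold Store.pt; rw [e4]
    have htest' := htest s'' (by rw [hs'']; exact e4) (by rw [hs'']; exact e3)
    have hp : s''.ivar vp = s.ivar vp := by rw [hs'']; simpa using e1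
    have hq : s''.ivar vq = s.iarr aL j := by rw [hs'', e5]; simp
    rw [hp, hq] at htest'
    rcases h with ⟨h1, h2, h3, h4, h5⟩ | ⟨h1, _⟩
    · rw [e5, e1, e3, hpt] at h5
      rw [e2] at h3
      have := hit s' t j hs'.1 hs'.2 h2 h3 (near_of_mem_box ho h5) (htest'.1 h4)
      rw [h1, hs'', e5]
      exact ⟨⟨this.1, this.2.2.2⟩, this.2.2.1⟩
    · rw [h1, hs'']
      exact ⟨⟨(hact s' t j _ hs'.1 hs'.2).1, same s' t j _ hs'.2⟩, (hact s' t j _ hs'.1 hs'.2).2⟩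
  have hs0 : J s ∧ s.SameTable s := ⟨hJ, rfl, rfl, rfl, rfl, rfl, rfl⟩
  refine ⟨(scan_inv (J := fun s' => J s' ∧ s.SameTable s')
    (fun o ho s' hs' => (step o ho s' hs').1) s hs0).1, fun htab i h0 hi hn hT => ?_⟩
  obtain ⟨o, ho, hcell⟩ := exists_mem_box_of_near hn
  refine scan_hit (J := fun s' => J s' ∧ s.SameTable s') (H := H i)
    (fun o ho s' hs' => (step o ho s' hs').1) (fun o ho s' hs' => (step o ho s' hs').2 i) ho
    (fun s' hs' => ?_) s hs0
  obtain ⟨t, j, s'', hs'', h⟩ := probe_exec d test act o s'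
  obtain ⟨e1, e2, e3, e4, e5, e6⟩ := id hs'.2
  have hpt : s'.pt = s.pt := by unfold Store.pt; rw [e4]
  have htest' := htest s'' (by rw [hs'']; exact e4) (by rw [hs'']; exact e3)
  have hp : s''.ivar vp = s.ivar vp := by rw [hs'']; simpa using e1
  have hq : s''.ivar vq = s.iarr aL j := by rw [hs'', e5]; simp
  rw [hp, hq] at htest'
  rcases h with ⟨h1, h2, h3, h4, h5⟩ | ⟨h1, h2⟩
  · rw [e5, e1, e3, hpt] at h5
    rw [e2] at h3
    have := hit s' t j hs'.1 hs'.2 h2 h3 (near_of_mem_box ho h5) (htest'.1 h4)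
    -- Registered centers in the same cell have the same key, hence the same table entry, hence the
    -- same position.
    have hij : j = i := by
      have h6 := htab j h2 h3
      have h7 : s.key d (s.iarr aL j) = s.key d (s.iarr aL i) :=
        key_inj.2 fun l hl => (h5 l hl).trans (hcell l hl).symm
      rw [← h6, h7, htab i h0 hi]
    rw [h1, hs'', e5, ← hij]
    exact this.2.1
  · exfalso
    obtain ⟨rfl, h3⟩ := h2 i h0 (by rw [e2]; exact hi)
      (by rw [e6, e5, Store.key, e3, hpt]; exact htab i h0 hi) (by rw [e5, e1, e3, hpt]; exact hcell)
    exact htest'.2 hT h3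

theorem exec_cond_of_ne {e : Expr Ty.int} {A B : Prog} {s : Store} (h : (e.eval s : ℤ) ≠ 0) :
    (cond e A B).exec s = A.exec s :=
  if_pos h

theorem exec_cond_zero {e : Expr Ty.int} {A B : Prog} {s : Store} (h : (e.eval s : ℤ) = 0) :
    (cond e A B).exec s = B.exec s :=
  if_neg (not_not.2 h)

/-! ### Covering -/

/-- Assign the current point to the current candidate center. -/
def coverAct : Prog := seq (setI vf (litI 1)) (storeI aasg' (varI vp) (varI vq))

/-- Make the current point a tentative center. -/
def addCenter (d : ℕ) : Prog :=
  seq (storeI aasg' (varI vp) (varI vp)) <|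
  seq (storeI aT (cellKey rg (varI vp) (fun _ => 0) d) (varI vc)) <|
  seq (storeI aL (varI vi) (loadI aL (varI vc))) <|
  seq (storeI aL (varI vc) (varI vp)) (setI vc (addI (varI vc) (litI 1)))

/-- Find a tentative center for the current point. -/
def coverBody (d b : ℕ) (pre test : Expr Ty.int) : Prog :=
  seq (setI vp (loadI aL (varI vi))) <| seq (setI vf pre) <|
  seq (storeI anear (varI vp) (litI 0)) <|
  seq (storeI aasg' (varI vp) (loadI aasg (varI vp))) <|
  seq (scan (box b d) (probe d test coverAct)) <| cond (varI vf) skip (addCenter d)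

/-- Extend the set of centers greedily until all points of the current segment are covered. -/
def cover (d b : ℕ) (pre test : Expr Ty.int) : Prog :=
  seq (setI vc (varI vm)) (forRange vi (varI vm) ve (coverBody d b pre test))

theorem coverBody_simple (d b : ℕ) (pre test : Expr Ty.int) : (coverBody d b pre test).Simple :=
  ⟨trivial, trivial, trivial, trivial, scan_simple fun _ => ⟨trivial, trivial, trivial,
    ⟨trivial, trivial⟩, trivial⟩, trivial, trivial, trivial, trivial, trivial, trivial⟩

theorem coverBody_keepsRArr (d b : ℕ) (pre test : Expr Ty.int) :
    (coverBody d b pre test).KeepsRArr :=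
  ⟨trivial, trivial, trivial, trivial, scan_keepsRArr fun _ => ⟨trivial, trivial, trivial,
    ⟨trivial, trivial⟩, trivial⟩, trivial, trivial, trivial, trivial, trivial, trivial⟩

theorem coverBody_writesI {d b : ℕ} {pre test : Expr Ty.int} {x : ℕ}
    (h : (coverBody d b pre test).WritesI x) : 4 ≤ x ∧ x ≤ 9 := by
  simp only [coverBody, addCenter, WritesI, scan_writesI, probe, coverAct, vp, vf, vc, vt, vj,
    vq, or_false, false_or] at h
  rcases h with h | h | ⟨_, _, h⟩ | h <;> omega

theorem coverBody_writesArr {d b : ℕ} {pre test : Expr Ty.int} {x : ℕ}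
    (h : (coverBody d b pre test).WritesArr x) : x = aL ∨ x = aasg' ∨ x = aT ∨ x = anear := by
  simp only [coverBody, addCenter, WritesArr, scan_writesArr, probe, coverAct,
    or_false, false_or] at h
  rcases h with h | h | ⟨_, _, h⟩ | h <;> tauto

theorem coverBody_writesR {d b : ℕ} {pre test : Expr Ty.int} {x : ℕ} :
    ¬(coverBody d b pre test).WritesR x := by
  simp [coverBody, addCenter, WritesR, scan_writesR, probe, coverAct]

/-- What a covering pass achieves: `P` tells which points are covered beforehand, and `T` is the
test that a center has to pass. -/
structure Covered (d b : ℕ) (P : ℤ → Prop) (T : ℤ → ℤ → Prop) (hi : ℤ) (s₀ s : Store) : Prop where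
  shuffle : Shuffle (s₀.ivar vm) hi (s₀.iarr aL) (s.iarr aL)
  le_count : s₀.ivar vm ≤ s.ivar vc
  count_le : s.ivar vc ≤ hi
  table : s.Table d (s.ivar vc)
  not_pre : ∀ j, s₀.ivar vm ≤ j → j < s.ivar vc → ¬P (s.iarr aL j)
  apart : ∀ j, s₀.ivar vm ≤ j → j < s.ivar vc → ∀ i, 0 ≤ i → i < j →
    ¬(s.Near d b (s.iarr aL j) (s.iarr aL i) ∧ T (s.iarr aL j) (s.iarr aL i))
  near_eq : ∀ z, s₀.ivar vm ≤ z → z < hi → s.iarr anear (s.iarr aL z) = 0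
  cov : ∀ z, s₀.ivar vm ≤ z → z < hi →
    P (s.iarr aL z) ∧ s.iarr aasg' (s.iarr aL z) = s₀.iarr aasg (s.iarr aL z) ∨
    ∃ j, 0 ≤ j ∧ j < s.ivar vc ∧ s.iarr aasg' (s.iarr aL z) = s.iarr aL j ∧
      (s.iarr aL j = s.iarr aL z ∨
        s.Near d b (s.iarr aL z) (s.iarr aL j) ∧ T (s.iarr aL z) (s.iarr aL j))


/-- One greedy step. If a near center passes the test, or the point was covered before, the set of
centers is unchanged. Otherwise the point is swapped to position `vc` and registered. It is then
apart from all earlier centers because the scan would have found any near one that passes the test.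
-/
theorem coverBody_covered {d b : ℕ} {pre test : Expr Ty.int} {P : ℤ → Prop} {T : ℤ → ℤ → Prop}
    {s₀ s : Store} {i : ℤ}
    (hpre : ((pre.eval (s.setI vp (s.iarr aL i)) : ℤ) ≠ 0 ↔ P (s.iarr aL i)))
    (htest : ∀ s', s'.rarr = s.rarr → s'.rvar = s.rvar →
      ((test.eval s' : ℤ) ≠ 0 ↔ T (s'.ivar vp) (s'.ivar vq)))
    (hsame : ∀ p q, (∀ l < d, cell (s.rvar rg) (s.pt p) l = cell (s.rvar rg) (s.pt q) l) → T p q)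
    (hm : 0 ≤ s₀.ivar vm) (hasg : s.iarr aasg = s₀.iarr aasg)
    (hinj : Set.InjOn (s.iarr aL) (Set.Ico (s₀.ivar vm) (i + 1))) (hi : s₀.ivar vm ≤ i)
    (hvi : s.ivar vi = i) (h : Covered d b P T i s₀ s) :
    Covered d b P T (i + 1) s₀ (((coverBody d b pre test).exec s).setI vi (i + 1)) := by
  set L := s.iarr aL with hL
  set p := L i with hp
  set c := s.ivar vc with hc
  set s₁ := ((((s.setI vp p).setI vf (pre.eval (s.setI vp p))).storeI anear p 0).storeI aasg' p
    (s.iarr aasg p)) with hs₁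
  have hexec : (coverBody d b pre test).exec s =
      (cond (varI vf) skip (addCenter d)).exec
        ((scan (box b d) (probe d test coverAct)).exec s₁) := by
    rw [hs₁, hp, ← hvi]
    rfl
  have hpt : s₁.pt = s.pt := rfl
  have h1p : s₁.ivar vp = p := by simp [hs₁]
  have h1c : s₁.ivar vc = c := by simp [hs₁, hc]
  have h1f : s₁.ivar vf = pre.eval (s.setI vp p) := by simp [hs₁]
  have h1L : s₁.iarr aL = L := by simp [hs₁, hL]
  have h1T : s₁.iarr aT = s.iarr aT := by simp [hs₁]
  have hnear : ∀ p q, s₁.Near d b p q ↔ s.Near d b p q := fun _ _ => Iff.rfl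
  have hkey : ∀ p, s₁.key d p = s.key d p := fun _ => rfl
  obtain ⟨hdisj, hcomp⟩ := scan_probe (b := b) (d := d) (act := coverAct) (s := s₁) T htest
    (fun s' => s'.ivar vf = s₁.ivar vf ∧ s'.iarr aasg' = s₁.iarr aasg' ∨
      s'.ivar vf ≠ 0 ∧ ∃ j, 0 ≤ j ∧ j < c ∧ s.Near d b p (L j) ∧ T p (L j) ∧
        s'.iarr aasg' = Function.update (s₁.iarr aasg') p (L j))
    (fun _ s' => s'.ivar vf ≠ 0) (Or.inl ⟨rfl, rfl⟩)
    (fun s' t j q hs' _ => by simpa using hs')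
    (fun s' t j hs' hs'' h0 hj hn hT => by
      rw [h1p, h1L] at hn hT
      rw [h1c] at hj
      have hvp : s'.ivar 5 = p := hs''.1.trans h1p
      refine ⟨Or.inr ⟨by simp [coverAct, exec, eval], j, h0, hj, hn, hT, ?_⟩,
        by simp [coverAct, exec, eval], by simp [coverAct, exec, eval], ?_⟩
      · simp only [coverAct, exec, eval]
        simp only [vp, vq, vf, vj, vt, aasg', h1L, Store.storeI_iarr, Store.setI_iarr,
          Store.setI_ivar, if_true, Nat.reduceEqDiff, if_false, hvp]
        rcases hs' with ⟨_, h2⟩ | ⟨_, j', _, _, _, _, h2⟩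
        · rw [show s'.iarr 3 = s₁.iarr 3 from h2]
        · rw [show s'.iarr 3 = _ from h2, Function.update_idem]
          rfl
      · simpa [Store.SameTable, coverAct, exec] using hs'')
  have hagree := (scan_simple (l := box b d) (body := probe d test coverAct) (fun _ =>
    ⟨trivial, trivial, trivial, ⟨trivial, trivial⟩, trivial⟩)).agree s₁
  set s₂ := (scan (box b d) (probe d test coverAct)).exec s₁ with hs₂
  have h2r : s₂.rvar = s.rvar := by
    funext x
    rw [hagree.rvar x (by simp [scan_writesR, probe, coverAct, WritesR])]
    rfl
  have h2a : s₂.rarr = s.rarr := hagree.rarr (scan_keepsRArr fun _ =>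
    ⟨trivial, trivial, trivial, ⟨trivial, trivial⟩, trivial⟩)
  have h2pt : s₂.pt = s.pt := by unfold Store.pt; rw [h2a]
  have h2i : ∀ x, x < 6 → s₂.ivar x = s₁.ivar x := fun x hx => hagree.ivar x (by
  
    rintro h
    simp only [scan_writesI, probe, coverAct, WritesI, vt, vj, vq, vf, or_false] at h
    obtain ⟨_, _, h⟩ := h
    omega)
  have h2arr : ∀ x, x ≠ aasg' → s₂.iarr x = s₁.iarr x := fun x hx => hagree.iarr x (by
    simp only [scan_writesArr, probe, coverAct, WritesArr, not_exists]; tauto)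
  have h2L : s₂.iarr aL = L := (h2arr _ (by simp)).trans h1L
  have h2T : s₂.iarr aT = s.iarr aT := (h2arr _ (by simp)).trans h1T
  have h2near : s₂.iarr anear = Function.update (s.iarr anear) p 0 := by
    rw [h2arr _ (by simp)]; simp [hs₁]
  have h2p : s₂.ivar vp = p := (h2i _ (by simp)).trans h1p
  have h2c : s₂.ivar vc = c := (h2i _ (by simp)).trans h1c
  have h2vi : s₂.ivar vi = i := (h2i _ (by simp)).trans (by rw [← hvi]; simp [hs₁])
  have h1asg : s₁.iarr aasg' = Function.update (s.iarr aasg') p (s₀.iarr aasg p) := by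
    rw [← hasg]; simp [hs₁]
  -- The earlier positions of the segment hold other points, so writing the entries of `p` does not
  -- disturb what is known about them.
  have hne : ∀ z, s₀.ivar vm ≤ z → z < i → L z ≠ p := fun z h1 h2 h3 => by
    have := hinj (x₁ := z) (x₂ := i) (by simp only [Set.mem_Ico]; omega)
      (by simp only [Set.mem_Ico]; omega) h3
    omega
  have hcl := h.count_le
  have hlc := h.le_count
  rw [← hc] at hcl hlc
  have htab2 : s₁.Table d (s₁.ivar vc) := by
    intro j h0 hj
    rw [h1T, h1L]
    exact h.table j h0 (by rw [h1c] at hj; exact hj)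
  rw [hexec]
  by_cases hf : s₂.ivar vf = 0
  · -- a new center
    have hno : ¬∃ j, 0 ≤ j ∧ j < c ∧ s.Near d b p (L j) ∧ T p (L j) := fun hex => by
      obtain ⟨j, h0, hj, hn, hT⟩ := hex
      rw [h1p, h1L, h1c] at hcomp
      exact hcomp (by rwa [h1c] at htab2) j h0 hj hn hT hf
    have h2asg : s₂.iarr aasg' = Function.update (s.iarr aasg') p (s₀.iarr aasg p) ∧ ¬P p := by
      rcases hdisj with ⟨h3, h4⟩ | ⟨h3, _⟩
      · refine ⟨h4.trans h1asg, fun hP => ?_⟩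
        have := hpre.2 hP
        rw [← h1f, ← h3] at this
        exact this hf
      · exact absurd hf h3
    set s₃ := (((((s₂.storeI aasg' p p).storeI aT (s.key d p) c).storeI aL i (L c)).storeI aL c
      p).setI vc (c + 1)) with hs₃
    have hex3 : (cond (varI vf) skip (addCenter d)).exec s₂ = s₃ := by
      have hk : ∀ s' : Store, s'.rvar = s.rvar → s'.rarr = s.rarr → s'.ivar vp = p →
          ((cellKey rg (varI vp) (fun _ => 0) d).eval s' : ℤ) = s.key d p := by
        intro s' h1 h2 h3
        have h4 : s'.pt = s.pt := by unfold Store.pt; rw [h2]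
        rw [cellKey_eval, h1, h4]
        simp only [eval, h3, add_zero]
        rfl
      have h3 : (cond (varI vf) skip (addCenter d)).exec s₂ =
          (((((s₂.storeI aasg' (s₂.ivar vp) (s₂.ivar vp)).storeI aT
            ((cellKey rg (varI vp) (fun _ => 0) d).eval (s₂.storeI aasg' (s₂.ivar vp) (s₂.ivar vp)))
            (s₂.ivar vc)).storeI aL (s₂.ivar vi) (s₂.iarr aL (s₂.ivar vc))).storeI aL (s₂.ivar vc)
            (s₂.ivar vp)).setI vc (s₂.ivar vc + 1)) :=
        (exec_cond_zero (e := varI vf) hf).trans rfl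
      rw [h3, hk (s₂.storeI aasg' _ _) h2r h2a h2p, h2p, h2c, h2vi, h2L]
    rw [hex3]
    set L₃ := Function.update (Function.update L i (L c)) c p with hL₃
    have h3L : (s₃.setI vi (i + 1)).iarr aL = L₃ := by
      simp [hs₃, hL₃, show s₂.iarr 0 = L from h2L]
    have h3T : (s₃.setI vi (i + 1)).iarr aT = Function.update (s.iarr aT) (s.key d p) c := by
      simp [hs₃, show s₂.iarr 4 = s.iarr 4 from h2T]
    have h3c : (s₃.setI vi (i + 1)).ivar vc = c + 1 := by simp [hs₃]
    have h3near : (s₃.setI vi (i + 1)).iarr anear = Function.update (s.iarr anear) p 0 := by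
      simp [hs₃, show s₂.iarr 5 = _ from h2near]
    have h3asg : (s₃.setI vi (i + 1)).iarr aasg' = Function.update (s.iarr aasg') p p := by
      simp [hs₃, show s₂.iarr 3 = _ from h2asg.1]
    have h3key : ∀ q, (s₃.setI vi (i + 1)).key d q = s.key d q := fun q => by
      unfold Store.key Store.pt
      simp [hs₃, h2r, h2a]
    have h3n : ∀ q q', (s₃.setI vi (i + 1)).Near d b q q' ↔ s.Near d b q q' := fun q q' => by
      unfold Store.Near Store.pt
      simp [hs₃, h2r, h2a]
    have hLlt : ∀ z, z < c → L₃ z = L z := fun z hz => by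
      rw [hL₃, Function.update_of_ne (by omega), Function.update_of_ne (by omega)]
    have hLc : L₃ c = p := by simp [hL₃]
    have hsh : Shuffle (s₀.ivar vm) (i + 1) L L₃ :=
      Shuffle.swap L ⟨hi, by omega⟩ ⟨hlc, by omega⟩
    clear_value s₃ s₂ s₁ L₃
    refine ⟨?_, ?_, ?_, ?_, ?_, ?_, ?_, ?_⟩
    · rw [h3L]
      exact (h.shuffle.mono le_rfl (by omega)).trans hsh
    · rw [h3c]; omega
    · rw [h3c]; omega
    · intro j h0 hj
      rw [h3c] at hj
      rw [h3L, h3T, h3key]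
      rcases (Int.lt_add_one_iff.1 hj).lt_or_eq with h4 | rfl
      · rw [hLlt j h4, Function.update_of_ne]
        · exact h.table j h0 h4
        -- Registering the new center overwrites no earlier registration: by `hsame` a center in the
        -- same cell would have passed the test and covered the point.
        · intro h5
          have h6 := key_inj.1 h5
          exact hno ⟨j, h0, h4, near_of_eq fun l hl => (h6 l hl).symm,
            hsame _ _ fun l hl => (h6 l hl).symm⟩
      · rw [hLc, Function.update_self]
    · intro j h0 hj
      rw [h3c] at hj
      rw [h3L]
      rcases (Int.lt_add_one_iff.1 hj).lt_or_eq with h4 | rfl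
      · rw [hLlt j h4]; exact h.not_pre j h0 h4
      · rw [hLc]; exact h2asg.2
    · intro j h0 hj k hk0 hkj
      rw [h3c] at hj
      rw [h3L, h3n, hLlt k (by omega)]
      rcases (Int.lt_add_one_iff.1 hj).lt_or_eq with h4 | rfl
      · rw [hLlt j h4]; exact h.apart j h0 h4 k hk0 hkj
      · rw [hLc]; exact fun h5 => hno ⟨k, hk0, hkj, h5.1, h5.2⟩
    · intro z h0 hz
      rw [h3L, h3near]
      obtain ⟨w, hw, hzw⟩ := hsh.inside (z := z) ⟨h0, hz⟩
      rw [hzw]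
      rcases eq_or_ne w i with rfl | hwi
      · rw [← hp, Function.update_self]
      · rw [Function.update_of_ne (hne w hw.1 (by omega))]
        exact h.near_eq w hw.1 (by omega)
    · intro z h0 hz
      rw [h3L, h3asg, h3c]
      obtain ⟨w, hw, hzw⟩ := hsh.inside (z := z) ⟨h0, hz⟩
      rw [hzw]
      rcases eq_or_ne w i with rfl | hwi
      · right
        refine ⟨c, by omega, by omega, ?_, Or.inl ?_⟩
        · rw [hLc, ← hp, Function.update_self]
        · rw [hLc]
      · rw [Function.update_of_ne (hne w hw.1 (by omega))]
        rcases h.cov w hw.1 (by omega) with h4 | ⟨j, hj0, hjc, h4, h5⟩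
        · exact Or.inl h4
        · refine Or.inr ⟨j, hj0, by omega, ?_, ?_⟩
          · rw [hLlt j hjc]; exact h4
          · rw [hLlt j hjc, h3n]; exact h5
  · -- already covered
    have hex3 : (cond (varI vf) skip (addCenter d)).exec s₂ = s₂ := by
      exact exec_cond_of_ne (e := varI vf) hf
    rw [hex3]
    have h3L : (s₂.setI vi (i + 1)).iarr aL = L := h2L
    have h3T : (s₂.setI vi (i + 1)).iarr aT = s.iarr aT := h2T
    have h3c : (s₂.setI vi (i + 1)).ivar vc = c := by simpa using h2c
    have h3near : (s₂.setI vi (i + 1)).iarr anear = Function.update (s.iarr anear) p 0 := h2near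
    have h3asg : (s₂.setI vi (i + 1)).iarr aasg' = s₂.iarr aasg' := rfl
    have h3key : ∀ q, (s₂.setI vi (i + 1)).key d q = s.key d q := fun q => by
      unfold Store.key Store.pt
      simp [h2r, h2a]
    have h3n : ∀ q q', (s₂.setI vi (i + 1)).Near d b q q' ↔ s.Near d b q q' := fun q q' => by
      unfold Store.Near Store.pt
      simp [h2r, h2a]
    have hasgne : ∀ q, q ≠ p → s₂.iarr aasg' q = s.iarr aasg' q := by
      intro q hq
      rcases hdisj with ⟨_, h4⟩ | ⟨_, j, _, _, _, _, h4⟩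
      · rw [h4, h1asg, Function.update_of_ne hq]
      · rw [h4, h1asg, Function.update_of_ne hq, Function.update_of_ne hq]
    clear_value s₂ s₁
    refine ⟨?_, ?_, ?_, ?_, ?_, ?_, ?_, ?_⟩
    · rw [h3L]; exact h.shuffle.mono le_rfl (by omega)
    · rw [h3c]; omega
    · rw [h3c]; omega
    · intro j h0 hj
      rw [h3L, h3T, h3key]
      exact h.table j h0 (by rw [h3c] at hj; exact hj)
    · intro j h0 hj
      rw [h3L]
      exact h.not_pre j h0 (by rw [h3c] at hj; exact hj)
    · intro j h0 hj k hk0 hkj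
      rw [h3L, h3n]
      exact h.apart j h0 (by rw [h3c] at hj; exact hj) k hk0 hkj
    · intro z h0 hz
      rw [h3L, h3near]
      rcases eq_or_ne z i with rfl | hwi
      · rw [← hp, Function.update_self]
      · rw [Function.update_of_ne (hne z h0 (by omega))]
        exact h.near_eq z h0 (by omega)
    · intro z h0 hz
      rw [h3L, h3asg, h3c]
      rcases eq_or_ne z i with rfl | hwi
      · rw [← hp]
        rcases hdisj with ⟨h4, h5⟩ | ⟨_, j, hj0, hjc, hjn, hjT, h4⟩
        · left
          refine ⟨hpre.1 ?_, ?_⟩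
          · rw [← h1f, ← h4]; exact hf
          · rw [h5, h1asg, Function.update_self]
        · right
          refine ⟨j, hj0, hjc, ?_, Or.inr ⟨(h3n _ _).2 hjn, hjT⟩⟩
          rw [h4, Function.update_self]
      · rw [hasgne _ (hne z h0 (by omega))]
        rcases h.cov z h0 (by omega) with h4 | ⟨j, hj0, hjc, h4, h5⟩
        · exact Or.inl h4
        · exact Or.inr ⟨j, hj0, hjc, h4, by rw [h3n]; exact h5⟩

end RealRAM

/-! ### Complete passes: covering, marking, partitioning, nearest neighbors. -/

namespace RealRAM

open KCenter RealRAM.Expr RealRAM.Prog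

/-- The stores agree except for the integer variables in `I` and the integer arrays in `A`. -/
structure Keeps (I A : List ℕ) (s s' : Store) : Prop where
  ivar : ∀ x, x ∉ I → s'.ivar x = s.ivar x
  rvar : s'.rvar = s.rvar
  rarr : s'.rarr = s.rarr
  iarr : ∀ a, a ∉ A → s'.iarr a = s.iarr a

theorem Keeps.pt {I A : List ℕ} {s s' : Store} (h : Keeps I A s s') : s'.pt = s.pt := by
  unfold Store.pt; rw [h.rarr]

theorem Agree.keeps {B : Prog} {s s' : Store} (h : Agree B s s') (I A : List ℕ)
    (hI : ∀ x, B.WritesI x → x ∈ I) (hR : ∀ x, ¬B.WritesR x) (hK : B.KeepsRArr)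
    (hA : ∀ a, B.WritesArr a → a ∈ A) : Keeps I A s s' :=
  ⟨fun x hx => h.ivar x fun hw => hx (hI x hw), funext fun x => h.rvar x (hR x), h.rarr hK,
    fun a ha => h.iarr a fun hw => ha (hA a hw)⟩

/-- The hypothesis `hsame` makes the test automatic within a cell, so that one table entry per cell
suffices. The old centers must be registered already (`htab`); the pass only appends to them. -/
theorem cover_spec {d b : ℕ} {pre test : Expr Ty.int} {P : ℤ → Prop} {T : ℤ → ℤ → Prop} {s₀ : Store}
    (hpre : ∀ s, s.rarr = s₀.rarr → s.rvar = s₀.rvar → s.iarr aasg = s₀.iarr aasg →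
      ((pre.eval s : ℤ) ≠ 0 ↔ P (s.ivar vp)))
    (htest : ∀ s, s.rarr = s₀.rarr → s.rvar = s₀.rvar →
      ((test.eval s : ℤ) ≠ 0 ↔ T (s.ivar vp) (s.ivar vq)))
    (hsame : ∀ p q, (∀ l < d, cell (s₀.rvar rg) (s₀.pt p) l = cell (s₀.rvar rg) (s₀.pt q) l) →
      T p q)
    (hm : 0 ≤ s₀.ivar vm) (hle : s₀.ivar vm ≤ s₀.ivar ve)
    (hinj : Set.InjOn (s₀.iarr aL) (Set.Ico (s₀.ivar vm) (s₀.ivar ve)))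
    (htab : s₀.Table d (s₀.ivar vm)) :
    Spec (RealRAM.cover d b pre test) s₀
      ((s₀.ivar ve - s₀.ivar vm).toNat * ((coverBody d b pre test).cost + 12) + 14)
      (fun s => Covered d b P T (s₀.ivar ve) s₀ s ∧
        Keeps [vi, vc, vp, vt, vj, vq, vf] [aL, aasg', aT, anear] s₀ s) := by
  have hk : ∀ x, (RealRAM.forRange vi (varI vm) ve (coverBody d b pre test)).WritesI x →
      x ∈ [vi, vc, vp, vt, vj, vq, vf] := by
    intro x hx
    have hx' : x = 2 ∨ (4 ≤ x ∧ x ≤ 9) := by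
      rcases hx with h | h | h
      · exact Or.inl h
      · exact Or.inr (coverBody_writesI h)
      · exact Or.inl h
    simp only [vi, vc, vp, vt, vj, vq, vf, List.mem_cons, List.not_mem_nil, or_false]
    omega
  have hk' : ∀ x, (RealRAM.forRange vi (varI vm) ve (coverBody d b pre test)).WritesArr x →
      x ∈ [aL, aasg', aT, anear] := by
    intro x hx
    have hx' : (coverBody d b pre test).WritesArr x := by
      rcases hx with h | h | h
      · exact h.elim
      · exact h
      · exact h.elim
    simpa using coverBody_writesArr hx'
  have hkR : ∀ x, ¬(RealRAM.forRange vi (varI vm) ve (coverBody d b pre test)).WritesR x := by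
    rintro x (h | h | h)
    · exact h
    · exact coverBody_writesR h
    · exact h
  have hkA : (RealRAM.forRange vi (varI vm) ve (coverBody d b pre test)).KeepsRArr :=
    ⟨trivial, coverBody_keepsRArr d b pre test, trivial⟩
  refine Spec.mono (Spec.frame (Spec.seq (Prog.Simple.spec (A := setI vc (varI vm)) trivial s₀)
    (Q' := Covered d b P T (s₀.ivar ve) s₀)
    (c₂ := (s₀.ivar ve - s₀.ivar vm).toNat * ((coverBody d b pre test).cost + 12) + 11) ?_ le_rfl))
    ?_ ?_
  · rintro _ rfl
    set s₁ := (setI vc (varI vm)).exec s₀ with hs₁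
    have h1i : ∀ x, x ≠ vc → s₁.ivar x = s₀.ivar x := fun x hx => Function.update_of_ne hx _ _
    have h1m : s₁.ivar vm = s₀.ivar vm := h1i _ (by simp)
    have h1e : s₁.ivar ve = s₀.ivar ve := h1i _ (by simp)
    have h1c : s₁.ivar vc = s₀.ivar vm := by simp [hs₁, exec, eval]
    have hfor := spec_forRange (s := s₁) (v := vi) (h := ve) (lo := varI vm)
      (body := coverBody d b pre test) (z := s₀.ivar vm)
      (fun i s => Covered d b P T i s₀ s) (coverBody_simple d b pre test)
      (fun h => by have := coverBody_writesI h; simp at this)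
      (fun h => by have := coverBody_writesI h; simp at this) (by simp) h1m (by rw [h1e]; exact hle)
      ?_ ?_
    · rw [h1e] at hfor
      exact hfor.mono le_rfl (fun s hs => hs.1)
    · have hc : (s₁.setI vi (s₀.ivar vm)).ivar vc = s₀.ivar vm := by simpa using h1c
      refine ⟨Shuffle.refl _ _ _, hc.ge, hc.le, ?_, ?_, ?_, ?_, ?_⟩
      · rw [hc]; exact htab
      · intro j h1 h2; omega
      · intro j h1 h2; omega
      · intro j h1 h2; omega
      · intro j h1 h2; omega
    · intro i s' hzi hie hvi hA hI
      rw [h1e] at hie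
      have hK := hA.keeps _ _ hk hkR hkA hk'
      have ha : s'.rarr = s₀.rarr := hK.rarr
      have hr : s'.rvar = s₀.rvar := hK.rvar
      have hasg : s'.iarr aasg = s₀.iarr aasg := hK.iarr _ (by simp)
      have hpt : s'.pt = s₀.pt := hK.pt
      refine coverBody_covered ?_ ?_ ?_ hm hasg ?_ hzi hvi hI
      · have := hpre (s'.setI vp (s'.iarr aL i)) ha hr hasg
        simpa using this
      · intro s'' h1 h2
        exact htest s'' (h1.trans ha) (h2.trans hr)
      · rw [hr, hpt]; exact hsame
      · refine Set.InjOn.mono (Set.Ico_subset_Ico le_rfl (by omega : i + 1 ≤ s₀.ivar ve)) ?_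
        exact hI.shuffle.injOn hinj le_rfl (by omega)
  · simp only [cost, size]
    omega
  · rintro s ⟨hs, hA⟩
    refine ⟨hs, hA.keeps _ _ ?_ ?_ ⟨trivial, hkA⟩ ?_⟩
    · rintro x (h | h)
      · rw [show x = vc from h]; simp
      · exact hk x h
    · rintro x (h | h)
      · exact h
      · exact hkR x h
    · rintro x (h | h)
      · exact h.elim
      · exact hk' x h

/-! ### Marking the points that have neighbors -/

/-- Mark the current point and a center near it. -/
def markBody (d b : ℕ) : Prog :=
  seq (setI vp (loadI aL (varI vi))) <|
  scan (box b d) (probe d (neI (varI vp) (varI vq))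
    (seq (storeI anear (varI vq) (litI 1)) (storeI anear (varI vp) (litI 1))))

/-- Mark all points that are near a center, and all centers that are near a point. -/
def mark (d b : ℕ) : Prog := forRange vi (litI 0) ve (markBody d b)

theorem markBody_simple (d b : ℕ) : (markBody d b).Simple :=
  ⟨trivial, scan_simple fun _ => ⟨trivial, trivial, trivial, ⟨trivial, trivial⟩, trivial⟩⟩

theorem markBody_keepsRArr (d b : ℕ) : (markBody d b).KeepsRArr :=
  ⟨trivial, scan_keepsRArr fun _ => ⟨trivial, trivial, trivial, ⟨trivial, trivial⟩, trivial⟩⟩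

theorem markBody_writesI {d b : ℕ} {x : ℕ} (h : (markBody d b).WritesI x) : 5 ≤ x ∧ x ≤ 8 := by
  simp only [markBody, WritesI, scan_writesI, probe, vp, vt, vj, vq, or_false] at h
  rcases h with h | ⟨_, _, h⟩ <;> omega

theorem markBody_writesArr {d b : ℕ} {x : ℕ} (h : (markBody d b).WritesArr x) : x = anear := by
  simp only [markBody, WritesArr, scan_writesArr, probe, or_false, false_or] at h
  obtain ⟨_, _, h⟩ := h
  tauto

theorem markBody_writesR {d b : ℕ} {x : ℕ} : ¬(markBody d b).WritesR x := by
  simp [markBody, WritesR, scan_writesR, probe]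

/-- Only centers are registered, so a pass over all points sees every near pair of which one member
is a center. Marking both members makes this enough to detect isolated points once the centers form
a net, see `prune_spec`. -/
theorem mark_spec {d b : ℕ} {s₀ : Store} (he : 0 ≤ s₀.ivar ve) (hc : s₀.ivar vc ≤ s₀.ivar ve)
    (htab : s₀.Table d (s₀.ivar vc)) :
    Spec (RealRAM.mark d b) s₀ ((s₀.ivar ve).toNat * ((markBody d b).cost + 12) + 11)
      (fun s => (∀ p, s.iarr anear p ≠ 0 → s₀.iarr anear p ≠ 0 ∨
          ∃ w, 0 ≤ w ∧ w < s₀.ivar ve ∧ s₀.iarr aL w ≠ p ∧ s₀.Near d b p (s₀.iarr aL w)) ∧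
        (∀ z, 0 ≤ z → z < s₀.ivar ve → ∀ j, 0 ≤ j → j < s₀.ivar vc →
          s₀.iarr aL z ≠ s₀.iarr aL j → s₀.Near d b (s₀.iarr aL z) (s₀.iarr aL j) →
            s.iarr anear (s₀.iarr aL z) ≠ 0 ∧ s.iarr anear (s₀.iarr aL j) ≠ 0) ∧
        Keeps [vi, vp, vt, vj, vq] [anear] s₀ s) := by
  set L := s₀.iarr aL with hL
  have hkeeps : ∀ s, Agree (RealRAM.mark d b) s₀ s → Keeps [vi, vp, vt, vj, vq] [anear] s₀ s := by
    intro s hs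
    refine hs.keeps _ _ ?_ ?_ ⟨trivial, markBody_keepsRArr d b, trivial⟩ ?_
    · intro x hx
      have hx' : x = 2 ∨ (5 ≤ x ∧ x ≤ 8) := by
        rcases hx with h | h | h
        · exact Or.inl h
        · exact Or.inr (markBody_writesI h)
        · exact Or.inl h
      simp only [vi, vp, vt, vj, vq, List.mem_cons, List.not_mem_nil, or_false]
      omega
    · rintro x (h | h | h)
      · exact h
      · exact markBody_writesR h
      · exact h
    · rintro x (h | h | h)
      · exact h.elim
      · simpa using markBody_writesArr h
      · exact h.elim
  have hfor := spec_forRange (s := s₀) (v := vi) (h := ve) (lo := litI 0) (body := markBody d b)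
    (z := 0) (fun i s =>
      (∀ p, s.iarr anear p ≠ 0 → s₀.iarr anear p ≠ 0 ∨
          ∃ w, 0 ≤ w ∧ w < s₀.ivar ve ∧ L w ≠ p ∧ s₀.Near d b p (L w)) ∧
      (∀ z, 0 ≤ z → z < i → ∀ j, 0 ≤ j → j < s₀.ivar vc →
          L z ≠ L j → s₀.Near d b (L z) (L j) →
            s.iarr anear (L z) ≠ 0 ∧ s.iarr anear (L j) ≠ 0)) (markBody_simple d b)
    (fun h => by have := markBody_writesI h; simp at this)
    (fun h => by have := markBody_writesI h; simp at this) (by simp) rfl he ?_ ?_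
  · refine hfor.mono (by simp [Expr.size]) fun s hs => ⟨hs.1.1, hs.1.2, hkeeps s hs.2⟩
  · exact ⟨fun p hp => Or.inl hp, fun z h1 h2 => by omega⟩
  · intro i s' hzi hie hvi hA hI
    have hK := hkeeps s' hA
    have hL' : s'.iarr aL = L := hK.iarr _ (by simp)
    have hN : ∀ p q, s'.Near d b p q ↔ s₀.Near d b p q := fun p q => by
      unfold Store.Near; rw [hK.rvar, hK.pt]
    have hvc : s'.ivar vc = s₀.ivar vc := hK.ivar _ (by simp)
    set s₁ := s'.setI vp (L i) with hs₁
    have hexec : (markBody d b).exec s' = (scan (box b d) (probe d (neI (varI vp) (varI vq))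
        (seq (storeI anear (varI vq) (litI 1)) (storeI anear (varI vp) (litI 1))))).exec s₁ := by
      rw [hs₁, ← hvi, ← hL']
      rfl
    have h1p : s₁.ivar vp = L i := by simp [hs₁]
    have h1c : s₁.ivar vc = s₀.ivar vc := by rw [← hvc]; simp [hs₁]
    have h1L : s₁.iarr aL = L := hL'
    have h1N : ∀ p q, s₁.Near d b p q ↔ s₀.Near d b p q := hN
    have htab1 : s₁.Table d (s₁.ivar vc) := by
      intro j h0 hj
      rw [h1c] at hj
      have : s₁.key d (s₁.iarr aL j) = s₀.key d (L j) := by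
        rw [h1L]
        change s'.key d _ = _
        unfold Store.key; rw [hK.rvar, hK.pt]
      rw [this]
      change s'.iarr aT _ = _
      rw [hK.iarr _ (by simp)]
      exact htab j h0 hj
    obtain ⟨hJ, hH⟩ := scan_probe (b := b) (d := d) (s := s₁) (test := neI (varI vp) (varI vq))
      (act := seq (storeI anear (varI vq) (litI 1)) (storeI anear (varI vp) (litI 1)))
      (fun p q => p ≠ q) (fun s'' _ _ => by rw [neI_ne_zero]; rfl)
      (fun s'' => (∀ p, s''.iarr anear p ≠ 0 → s₀.iarr anear p ≠ 0 ∨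
          ∃ w, 0 ≤ w ∧ w < s₀.ivar ve ∧ L w ≠ p ∧ s₀.Near d b p (L w)) ∧
        ∀ p, s'.iarr anear p ≠ 0 → s''.iarr anear p ≠ 0)
      (fun j s'' => s''.iarr anear (L i) ≠ 0 ∧ s''.iarr anear (L j) ≠ 0)
      ⟨hI.1, fun _ h => h⟩ (fun s'' t j q h _ => ⟨h, fun _ h => h⟩)
      (fun s'' t j h hsame h0 hj hn hT => by
        rw [h1p, h1L] at hn hT
        rw [h1c] at hj
        rw [h1N] at hn
        have hp : s''.ivar vp = L i := hsame.1.trans h1p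
        have hnear : ((seq (storeI anear (varI vq) (litI 1))
            (storeI anear (varI vp) (litI 1))).exec (((s''.setI vt t).setI vj j).setI vq
              (s₁.iarr aL j))).iarr anear =
            Function.update (Function.update (s''.iarr anear) (L j) 1) (L i) 1 := by
          rw [h1L, ← hp]
          simp [exec, eval]
        have hmono : ∀ p, s''.iarr anear p ≠ 0 →
            Function.update (Function.update (s''.iarr anear) (L j) 1) (L i) 1 p ≠ 0 := by
          intro p hp
          simp only [Function.update_apply]
          split_ifs <;> simp_all
        rw [hnear]
        refine ⟨⟨fun p hp => ?_, fun p hp => hmono p (h.2 p hp)⟩, ⟨by simp, ?_⟩,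
          fun j' h' => ⟨hmono _ h'.1, hmono _ h'.2⟩, ?_⟩
        · by_cases h1 : p = L i
          · right
            exact ⟨j, h0, by omega, by rw [h1]; exact hT.symm, by rw [h1]; exact hn⟩
          · by_cases h2 : p = L j
            · right
              exact ⟨i, hzi, hie, by rw [h2]; exact hT, by rw [h2]; exact hn.symm⟩
            · rw [Function.update_of_ne h1, Function.update_of_ne h2] at hp
              exact h.1 p hp
        · simp only [Function.update_apply]
          split_ifs <;> simp
        · simpa [Store.SameTable, exec] using hsame)
    rw [hexec]
    refine ⟨hJ.1, fun z h0 hz j hj0 hj hne hn => ?_⟩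
    rcases (Int.lt_add_one_iff.1 hz).lt_or_eq with h1 | rfl
    · exact ⟨hJ.2 _ (hI.2 z h0 h1 j hj0 hj hne hn).1, hJ.2 _ (hI.2 z h0 h1 j hj0 hj hne hn).2⟩
    · rw [h1p, h1L, h1c] at hH
      exact hH (by rwa [h1c] at htab1) j hj0 hj ((h1N _ _).2 hn) hne

/-! ### Partitioning -/

/-- Move the current point to the part that is kept. -/
def partitionBody (keep : Expr Ty.int) : Prog :=
  seq (setI vp (loadI aL (varI vi))) <|
  cond keep (seq (storeI aL (varI vi) (loadI aL (varI vb))) <|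
    seq (storeI aL (varI vb) (varI vp)) (setI vb (addI (varI vb) (litI 1)))) skip

/-- Move the points that satisfy a condition to the beginning of the current segment. -/
def partition (keep : Expr Ty.int) : Prog :=
  seq (setI vb (varI vm)) (forRange vi (varI vm) ve (partitionBody keep))

theorem partition_spec {keep : Expr Ty.int} {P : ℤ → Prop} {s₀ : Store}
    (hkeep : ∀ s, s.rarr = s₀.rarr → s.rvar = s₀.rvar → (∀ a, a ≠ aL → s.iarr a = s₀.iarr a) →
      ((keep.eval s : ℤ) ≠ 0 ↔ P (s.ivar vp)))
    (hle : s₀.ivar vm ≤ s₀.ivar ve) :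
    Spec (RealRAM.partition keep) s₀
      ((s₀.ivar ve - s₀.ivar vm).toNat * ((partitionBody keep).cost + 12) + 14)
      (fun s => (Shuffle (s₀.ivar vm) (s₀.ivar ve) (s₀.iarr aL) (s.iarr aL) ∧
        s₀.ivar vm ≤ s.ivar vb ∧ s.ivar vb ≤ s₀.ivar ve ∧
        (∀ z, s₀.ivar vm ≤ z → z < s.ivar vb → P (s.iarr aL z)) ∧
        ∀ z, s.ivar vb ≤ z → z < s₀.ivar ve → ¬P (s.iarr aL z)) ∧
        Keeps [vi, vb, vp] [aL] s₀ s) := by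
  refine Spec.mono (Spec.frame (Spec.seq (Prog.Simple.spec (A := setI vb (varI vm)) trivial s₀)
    (Q' := fun s => Shuffle (s₀.ivar vm) (s₀.ivar ve) (s₀.iarr aL) (s.iarr aL) ∧
        s₀.ivar vm ≤ s.ivar vb ∧ s.ivar vb ≤ s₀.ivar ve ∧
        (∀ z, s₀.ivar vm ≤ z → z < s.ivar vb → P (s.iarr aL z)) ∧
        ∀ z, s.ivar vb ≤ z → z < s₀.ivar ve → ¬P (s.iarr aL z))
    (c₂ := (s₀.ivar ve - s₀.ivar vm).toNat * ((partitionBody keep).cost + 12) + 11) ?_ le_rfl))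
    ?_ ?_
  · rintro _ rfl
    set s₁ := (setI vb (varI vm)).exec s₀ with hs₁
    have h1m : s₁.ivar vm = s₀.ivar vm := rfl
    have h1e : s₁.ivar ve = s₀.ivar ve := rfl
    have h1b : s₁.ivar vb = s₀.ivar vm := by simp [hs₁, exec, eval]
    have hfor := spec_forRange (s := s₁) (v := vi) (h := ve) (lo := varI vm)
      (body := partitionBody keep) (z := s₀.ivar vm)
      (fun i s => Shuffle (s₀.ivar vm) i (s₀.iarr aL) (s.iarr aL) ∧
        s₀.ivar vm ≤ s.ivar vb ∧ s.ivar vb ≤ i ∧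
        (∀ z, s₀.ivar vm ≤ z → z < s.ivar vb → P (s.iarr aL z)) ∧
        ∀ z, s.ivar vb ≤ z → z < i → ¬P (s.iarr aL z))
      ⟨trivial, ⟨trivial, trivial, trivial⟩, trivial⟩ (by simp [partitionBody, WritesI])
      (by simp [partitionBody, WritesI]) (by simp) h1m (by rw [h1e]; exact hle) ?_ ?_
    · rw [h1e] at hfor
      exact hfor.mono le_rfl (fun s hs => hs.1)
    · have hb : (s₁.setI vi (s₀.ivar vm)).ivar vb = s₀.ivar vm := by simpa using h1b
      exact ⟨Shuffle.refl _ _ _, hb.ge, hb.le, fun z h1 h2 => by omega, fun z h1 h2 => by omega⟩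
    · intro i s' hzi hie hvi hA hI
      have hK : Keeps [vi, vb, vp] [aL] s₁ s' := hA.keeps _ _
        (by simp [forRange, partitionBody, WritesI]; tauto)
        (by simp [forRange, partitionBody, WritesR])
        ⟨trivial, ⟨trivial, ⟨trivial, trivial, trivial⟩, trivial⟩, trivial⟩
        (by simp [forRange, partitionBody, WritesArr])
      set p := s'.iarr aL i with hp
      have hex : (partitionBody keep).exec s' = (cond keep (seq (storeI aL (varI vi)
          (loadI aL (varI vb))) <| seq (storeI aL (varI vb) (varI vp))
          (setI vb (addI (varI vb) (litI 1)))) skip).exec (s'.setI vp p) := by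
        rw [hp, ← hvi]; rfl
      have hk := hkeep (s'.setI vp p) hK.rarr hK.rvar fun a ha => hK.iarr a (by simpa using ha)
      rw [show (s'.setI vp p).ivar vp = p by simp] at hk
      obtain ⟨h1, h2, h3, h4, h5⟩ := hI
      rw [hex]
      by_cases hP : P p
      · rw [exec_cond_of_ne (hk.2 hP)]
        have hex2 : (seq (storeI aL (varI vi) (loadI aL (varI vb))) <|
            seq (storeI aL (varI vb) (varI vp)) (setI vb (addI (varI vb) (litI 1)))).exec
            (s'.setI vp p) = (((s'.setI vp p).storeI aL i (s'.iarr aL (s'.ivar vb))).storeI aL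
              (s'.ivar vb) p).setI vb (s'.ivar vb + 1) := by
          rw [← hvi]; rfl
        rw [hex2]
        have hL : ((((((s'.setI vp p).storeI aL i (s'.iarr aL (s'.ivar vb))).storeI aL
              (s'.ivar vb) p).setI vb (s'.ivar vb + 1))).setI vi (i + 1)).iarr aL =
            Function.update (Function.update (s'.iarr aL) i (s'.iarr aL (s'.ivar vb)))
              (s'.ivar vb) (s'.iarr aL i) := by simp [hp]
        have hb : ((((((s'.setI vp p).storeI aL i (s'.iarr aL (s'.ivar vb))).storeI aL
              (s'.ivar vb) p).setI vb (s'.ivar vb + 1))).setI vi (i + 1)).ivar vb =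
              s'.ivar vb + 1 := by simp
        rw [hL, hb]
        refine ⟨(h1.mono le_rfl (by omega)).trans (Shuffle.swap _ ⟨hzi, by omega⟩
          ⟨h2, by omega⟩), by omega, by omega, fun z hz0 hz => ?_, fun z hz0 hz => ?_⟩
        · rcases eq_or_ne z (s'.ivar vb) with rfl | hne
          · rw [Function.update_self]; exact hP
          · rw [Function.update_of_ne hne, Function.update_of_ne (by omega)]
            exact h4 z hz0 (by omega)
        · rw [Function.update_of_ne (by omega)]
          rcases eq_or_ne z i with rfl | hne
          · rw [Function.update_self]
            exact h5 _ le_rfl (by omega)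
          · rw [Function.update_of_ne hne]
            exact h5 z (by omega) (by omega)
      · rw [exec_cond_zero (not_not.1 fun h => hP (hk.1 h))]
        have hL : ((skip.exec (s'.setI vp p)).setI vi (i + 1)).iarr aL = s'.iarr aL := rfl
        have hb : ((skip.exec (s'.setI vp p)).setI vi (i + 1)).ivar vb = s'.ivar vb := by
          simp [exec]
        rw [hL, hb]
        refine ⟨h1.mono le_rfl (by omega), h2, by omega, h4, fun z hz0 hz => ?_⟩
        rcases (Int.lt_add_one_iff.1 hz).lt_or_eq with h6 | rfl
        · exact h5 z hz0 h6
        · exact hP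
  · simp only [cost, size]
    omega
  · rintro s ⟨hs, hA⟩
    refine ⟨hs, hA.keeps _ _ ?_ ?_ ?_ ?_⟩
    · simp [RealRAM.partition, forRange, partitionBody, WritesI]; tauto
    · simp [RealRAM.partition, forRange, partitionBody, WritesR]
    · simp [RealRAM.partition, forRange, partitionBody, KeepsRArr]
    · simp [RealRAM.partition, forRange, partitionBody, WritesArr]

/-! ### Nearest neighbors -/

/-- Compare the distance of the current point and the sampled point with the minimum so far. -/
def nearestBody (d : ℕ) : Prog :=
  seq (setI vp (loadI aL (varI vi))) <|
  cond (andI (neI (varI vp) (varI vu)) (ltR (sup d (varI vp) (varI vu)) (varR rl)))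
    (setR rl (sup d (varI vp) (varI vu))) skip

/-- Lower the distance in the variable `rl` to that of the sampled point to its nearest neighbor. -/
def nearest (d : ℕ) : Prog := forRange vi (litI 0) ve (nearestBody d)

/-- The initial value of `rl` takes part in the minimum; `sample` sets it to the distance to some
other point, so that no infinite value is needed. -/
theorem nearest_spec {d : ℕ} {s₀ : Store} (he : 0 ≤ s₀.ivar ve) :
    Spec (RealRAM.nearest d) s₀ ((s₀.ivar ve).toNat * ((nearestBody d).cost + 12) + 11)
      (fun s => (∀ z, 0 ≤ z → z < s₀.ivar ve → s₀.iarr aL z ≠ s₀.ivar vu →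
          s.rvar rl ≤ supd d (s₀.pt (s₀.iarr aL z)) (s₀.pt (s₀.ivar vu))) ∧
        (s.rvar rl = s₀.rvar rl ∨ ∃ z, 0 ≤ z ∧ z < s₀.ivar ve ∧ s₀.iarr aL z ≠ s₀.ivar vu ∧
          s.rvar rl = supd d (s₀.pt (s₀.iarr aL z)) (s₀.pt (s₀.ivar vu))) ∧
        (∀ x, x ≠ vi → x ≠ vp → s.ivar x = s₀.ivar x) ∧ (∀ x, x ≠ rl → s.rvar x = s₀.rvar x) ∧
        s.iarr = s₀.iarr ∧ s.rarr = s₀.rarr) := by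
  have hkeeps : ∀ s, Agree (RealRAM.nearest d) s₀ s →
      (∀ x, x ≠ vi → x ≠ vp → s.ivar x = s₀.ivar x) ∧ (∀ x, x ≠ rl → s.rvar x = s₀.rvar x) ∧
        s.iarr = s₀.iarr ∧ s.rarr = s₀.rarr := by
    intro s hs
    refine ⟨fun x h1 h2 => hs.ivar x ?_, fun x h1 => hs.rvar x ?_,
      funext fun a => hs.iarr a ?_, hs.rarr ?_⟩
    · simp only [RealRAM.nearest, forRange, nearestBody, WritesI]; tauto
    · simp only [RealRAM.nearest, forRange, nearestBody, WritesR]; tauto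
    · simp [RealRAM.nearest, forRange, nearestBody, WritesArr]
    · simp [RealRAM.nearest, forRange, nearestBody, KeepsRArr]
  have hfor := spec_forRange (s := s₀) (v := vi) (h := ve) (lo := litI 0) (body := nearestBody d)
    (z := 0) (fun i s =>
      (∀ z, 0 ≤ z → z < i → s₀.iarr aL z ≠ s₀.ivar vu →
          s.rvar rl ≤ supd d (s₀.pt (s₀.iarr aL z)) (s₀.pt (s₀.ivar vu))) ∧
        (s.rvar rl = s₀.rvar rl ∨ ∃ z, 0 ≤ z ∧ z < s₀.ivar ve ∧ s₀.iarr aL z ≠ s₀.ivar vu ∧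
          s.rvar rl = supd d (s₀.pt (s₀.iarr aL z)) (s₀.pt (s₀.ivar vu))))
      ⟨trivial, trivial, trivial⟩ (by simp [nearestBody, WritesI]) (by simp [nearestBody, WritesI])
      (by simp) rfl he ?_ ?_
  · exact hfor.mono (by simp [Expr.size]) fun s hs => ⟨hs.1.1, hs.1.2, hkeeps s hs.2⟩
  · exact ⟨fun z h1 h2 => by omega, Or.inl rfl⟩
  · intro i s' hzi hie hvi hA hI
    obtain ⟨h1, h2, h3, h4⟩ := hkeeps s' hA
    set p := s₀.iarr aL i with hp
    have hex : (nearestBody d).exec s' =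
        (cond (andI (neI (varI vp) (varI vu)) (ltR (sup d (varI vp) (varI vu)) (varR rl)))
          (setR rl (sup d (varI vp) (varI vu))) skip).exec (s'.setI vp p) := by
      rw [hp, ← hvi, ← h3]; rfl
    have hvp : (s'.setI vp p).ivar vp = p := by simp
    have hvu : (s'.setI vp p).ivar vu = s₀.ivar vu := by
      rw [← h1 vu (by simp) (by simp)]; simp
    have hpt : (s'.setI vp p).pt = s₀.pt := by unfold Store.pt; rw [← h4]; rfl
    have hd : ((sup d (varI vp) (varI vu)).eval (s'.setI vp p) : ℝ) =
        supd d (s₀.pt p) (s₀.pt (s₀.ivar vu)) := by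
      rw [sup_eval, hpt]
      simp only [eval, hvp, hvu]
    have hc : ((andI (neI (varI vp) (varI vu)) (ltR (sup d (varI vp) (varI vu))
        (varR rl))).eval (s'.setI vp p) : ℤ) ≠ 0 ↔ p ≠ s₀.ivar vu ∧
        supd d (s₀.pt p) (s₀.pt (s₀.ivar vu)) < s'.rvar rl := by
      rw [andI_ne_zero, neI_ne_zero, ltR_ne_zero, hd]
      simp only [eval, hvp, hvu, Store.setI_rvar]
    rw [hex]
    by_cases h : p ≠ s₀.ivar vu ∧ supd d (s₀.pt p) (s₀.pt (s₀.ivar vu)) < s'.rvar rl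
    · rw [exec_cond_of_ne (hc.2 h)]
      have hrl : (((setR rl (sup d (varI vp) (varI vu))).exec (s'.setI vp p)).setI vi
          (i + 1)).rvar rl = supd d (s₀.pt p) (s₀.pt (s₀.ivar vu)) := by
        rw [← hd]; simp [exec]
      rw [hrl]
      refine ⟨fun z h0 hz hne => ?_, Or.inr ⟨i, hzi, hie, h.1, rfl⟩⟩
      rcases (Int.lt_add_one_iff.1 hz).lt_or_eq with h6 | rfl
      · exact h.2.le.trans (hI.1 z h0 h6 hne)
      · exact le_rfl
    · rw [exec_cond_zero (not_not.1 fun h' => h (hc.1 h'))]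
      refine ⟨fun z h0 hz hne => ?_, hI.2⟩
      rcases (Int.lt_add_one_iff.1 hz).lt_or_eq with h6 | rfl
      · exact hI.1 z h0 h6 hne
      · exact not_lt.1 fun h' => h ⟨hne, h'⟩

end RealRAM

/-! ### Nets and pruning -/

namespace KCenter

/-- `N` is a maximal subset of `P` whose points are not in neighboring grid cells. -/
structure IsNet (d : ℕ) (g : ℝ) (x : ℤ → ℕ → ℝ) (P N : Finset ℤ) : Prop where
  sub : N ⊆ P
  apart : ∀ u ∈ N, ∀ v ∈ N, u ≠ v → ¬Near d 1 (cell g (x u)) (cell g (x v))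
  cov : ∀ u ∈ P, ∃ v ∈ N, Near d 1 (cell g (x u)) (cell g (x v))

/-- The state of the search for the scale of an optimal clustering of the points `0, …, n - 1` with
`k` centers: the remaining points are those of `P`, with `k'` centers for them. Every other point
is either near a remaining one, or near a point that is so isolated that it needs its own center.
The latter have been discarded, the last of them on a grid with side length `σ`. -/
structure Pruned (d : ℕ) (x : ℤ → ℕ → ℝ) (n k : ℤ) (P : Finset ℤ) (k' : ℤ) (σ : ℝ) : Prop where
  sub : P ⊆ Finset.Ico 0 n
  pos : 1 ≤ k'
  lt : k' < P.card
  ex : ∃ (X : Finset ℤ) (E : ℝ), X ⊆ Finset.Ico 0 n ∧ X.card + k' = k ∧ Disjoint X P ∧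
    (∀ p ∈ Finset.Ico 0 n, ∃ q ∈ X ∪ P, supd d (x p) (x q) ≤ E) ∧
    (∀ u ∈ P, ∀ v ∈ P, u ≠ v → E ≤ 4 * supd d (x u) (x v)) ∧
    (σ = 0 ∧ X = ∅ ∨ 0 < σ ∧ (∀ u ∈ X, ∀ v ∈ X ∪ P, u ≠ v → σ ≤ supd d (x u) (x v)) ∧
      ∃ Y ⊆ Finset.Ico 0 n, Y.card ≤ k' ∧ ∀ u ∈ P, ∃ y ∈ Y, supd d (x u) (x y) ≤ 2 * σ)

/-- The optimal radius is `s`, up to constant factors. -/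
structure IsScale (d : ℕ) (x : ℤ → ℕ → ℝ) (n k : ℤ) (s : ℝ) : Prop where
  pos : 0 < s
  lower : ∃ S ⊆ Finset.Ico 0 n, k < S.card ∧ ∀ u ∈ S, ∀ v ∈ S, u ≠ v → s ≤ supd d (x u) (x v)
  upper : ∃ S ⊆ Finset.Ico 0 n, S.card ≤ k ∧
    ∀ u ∈ Finset.Ico 0 n, ∃ v ∈ S, supd d (x u) (x v) ≤ 18 * s

variable {d : ℕ} {x : ℤ → ℕ → ℝ} {n k k' : ℤ} {P N : Finset ℤ} {σ ℓ g s : ℝ}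

theorem IsNet.lt_supd (hN : IsNet d g x P N) (hg : 0 < g) {u v : ℤ} (hu : u ∈ N) (hv : v ∈ N)
    (huv : u ≠ v) : g < supd d (x u) (x v) := by
  by_contra h
  exact hN.apart u hu v hv huv (near_of_supd_le hg (by simpa using h))

theorem IsNet.exists_supd_le (hN : IsNet d g x P N) (hg : 0 < g) {u : ℤ} (hu : u ∈ P) :
    ∃ v ∈ N, supd d (x u) (x v) ≤ 2 * g := by
  obtain ⟨v, hv, h⟩ := hN.cov u hu
  refine ⟨v, hv, (supd_lt_of_near hg h).le.trans (le_of_eq ?_)⟩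
  push_cast; ring

/-- Since two points of `P` are within `ℓ`, the covering distance satisfies `E ≤ 4 * ℓ`. A net on
side `2 * ℓ` adds `4 * ℓ` to it and separates the points by more than `2 * ℓ`, so the ratio 4 is
preserved. This is why the side is `2 * ℓ` and not `ℓ`. -/
theorem Pruned.net (h : Pruned d x n k P k' σ) (hℓ : 0 < ℓ) (hN : IsNet d (2 * ℓ) x P N)
    (hc : k' < N.card) (hex : ∃ u ∈ P, ∃ v ∈ P, u ≠ v ∧ supd d (x u) (x v) ≤ ℓ) :
    Pruned d x n k N k' σ := by
  obtain ⟨X, E, hX, hXk, hXP, hcov, hE, hσ⟩ := h.ex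
  obtain ⟨u₀, hu₀, v₀, hv₀, hne, huv⟩ := hex
  have hEℓ : E ≤ 4 * ℓ := (hE u₀ hu₀ v₀ hv₀ hne).trans (by linarith)
  refine ⟨hN.sub.trans h.sub, h.pos, hc, X, E + 4 * ℓ, hX, hXk,
    Finset.disjoint_of_subset_right hN.sub hXP, fun p hp => ?_, fun u hu v hv huv => ?_, ?_⟩
  · obtain ⟨q, hq, hpq⟩ := hcov p hp
    rcases Finset.mem_union.1 hq with hq | hq
    · exact ⟨q, Finset.mem_union_left _ hq, hpq.trans (by linarith)⟩
    · obtain ⟨v, hv, hqv⟩ := hN.exists_supd_le (by linarith) hq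
      exact ⟨v, Finset.mem_union_right _ hv, (supd_triangle _ _ (x q) _).trans (by linarith)⟩
  · have := hN.lt_supd (by linarith) hu hv huv
    linarith
  · rcases hσ with h1 | ⟨h1, h2, Y, hY, hYk, h3⟩
    · exact Or.inl h1
    · exact Or.inr ⟨h1, fun u hu v hv => h2 u hu v (Finset.union_subset_union le_rfl hN.sub hv),
        Y, hY, hYk, fun u hu => h3 u (hN.sub hu)⟩

/-- No other point of `P` is in a cell next to that of the point `u`. -/
def IsIsolated (d : ℕ) (g : ℝ) (x : ℤ → ℕ → ℝ) (P : Finset ℤ) (u : ℤ) : Prop :=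
  ∀ v ∈ P, v ≠ u → ¬Near d 1 (cell g (x u)) (cell g (x v))

/-- The points of `P` that have no other point of `P` in a neighboring cell. -/
noncomputable def isolated (d : ℕ) (g : ℝ) (x : ℤ → ℕ → ℝ) (P : Finset ℤ) : Finset ℤ := by
  classical exact P.filter (IsIsolated d g x P)

theorem isolated_subset : isolated d g x P ⊆ P := by
  classical exact Finset.filter_subset _ _

theorem mem_isolated {u : ℤ} : u ∈ isolated d g x P ↔
    u ∈ P ∧ ∀ v ∈ P, v ≠ u → ¬Near d 1 (cell g (x u)) (cell g (x v)) := by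
  simp [isolated, IsIsolated]

/-- An isolated point can be covered by no net point but itself. -/
theorem IsNet.isolated_subset (hN : IsNet d g x P N) : isolated d g x P ⊆ N := by
  intro u hu
  obtain ⟨h1, h2⟩ := mem_isolated.1 hu
  obtain ⟨v, hv, h3⟩ := hN.cov u h1
  by_cases huv : v = u
  · rwa [huv] at hv
  · exact absurd h3 (h2 v (hN.sub hv) huv)

/-- Each isolated point takes one net point, namely itself, so the rest of the net covers the rest
of `P` with the remaining budget of centers; it serves as `Y`. The discarded points stay
`s`-separated from everything because the side never increases (`hsσ`). -/
theorem Pruned.prune (h : Pruned d x n k P k' σ) (hs : 0 < s) (hsσ : σ = 0 ∨ s ≤ σ)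
    (hN : IsNet d s x P N) (hc : N.card ≤ k') :
    Pruned d x n k (P \ isolated d s x P) (k' - (isolated d s x P).card) s := by
  obtain ⟨X, E, hX, hXk, hXP, hcov, hE, hσ⟩ := h.ex
  set Z := isolated d s x P with hZ
  have hZP : Z ⊆ P := KCenter.isolated_subset
  have hZN : Z ⊆ N := hN.isolated_subset
  have hNZ : (N \ Z).card = N.card - Z.card := Finset.card_sdiff_of_subset hZN
  have hPZ : (P \ Z).card = P.card - Z.card := Finset.card_sdiff_of_subset hZP
  have hZNc := Finset.card_le_card hZN
  have hZPc := Finset.card_le_card hZP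
  have hlt := h.lt
  have hcovZ : ∀ u ∈ P \ Z, ∃ v ∈ N \ Z, supd d (x u) (x v) ≤ 2 * s := by
    intro u hu
    obtain ⟨hu1, hu2⟩ := Finset.mem_sdiff.1 hu
    obtain ⟨v, hv, h3⟩ := hN.cov u hu1
    refine ⟨v, Finset.mem_sdiff.2 ⟨hv, fun hvZ => ?_⟩, ?_⟩
    · by_cases huv : u = v
      · exact hu2 (huv ▸ hvZ)
      · exact (mem_isolated.1 hvZ).2 u hu1 huv h3.symm
    · refine (supd_lt_of_near hs h3).le.trans (le_of_eq ?_)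
      push_cast; ring
  have hPZX : X ∪ Z ∪ (P \ Z) = X ∪ P := by
    rw [Finset.union_assoc, Finset.union_sdiff_of_subset hZP]
  refine ⟨Finset.sdiff_subset.trans h.sub, ?_, by omega, X ∪ Z, E,
    Finset.union_subset hX (hZP.trans h.sub), ?_, ?_, ?_, ?_, Or.inr ⟨hs, ?_, ?_⟩⟩
  -- A budget remains: `P` has more than `k'` points and the net at most `k'`, so some point is
  -- left, and a net point outside `Z` covers it.
  · have hne : (P \ Z).Nonempty := Finset.card_pos.1 (by omega)
    obtain ⟨u, hu⟩ := hne
    obtain ⟨v, hv, _⟩ := hcovZ u hu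
    have := Finset.card_pos.2 ⟨v, hv⟩
    omega
  · rw [Finset.card_union_of_disjoint (Finset.disjoint_of_subset_right hZP hXP)]
    push_cast
    omega
  · rw [Finset.disjoint_union_left]
    exact ⟨Finset.disjoint_of_subset_right Finset.sdiff_subset hXP, Finset.disjoint_sdiff⟩
  · rw [hPZX]; exact hcov
  · exact fun u hu v hv => hE u (Finset.mem_sdiff.1 hu).1 v (Finset.mem_sdiff.1 hv).1
  · intro u hu v hv huv
    rw [hPZX] at hv
    have iso : ∀ u ∈ Z, ∀ v ∈ P, u ≠ v → s ≤ supd d (x u) (x v) := by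
      intro u hu v hv huv
      by_contra h4
      exact (mem_isolated.1 hu).2 v hv huv.symm
        (near_of_supd_le hs (by simpa using (not_le.1 h4).le))
    have far : ∀ u ∈ X, ∀ v ∈ X ∪ P, u ≠ v → s ≤ supd d (x u) (x v) := by
      intro u hu v hv huv
      rcases hσ with ⟨_, rfl⟩ | ⟨h1, h2, _⟩
      · simp at hu
      · exact (hsσ.resolve_left h1.ne').trans (h2 u hu v hv huv)
    rcases Finset.mem_union.1 hu with hu | hu
    · exact far u hu v hv huv
    · rcases Finset.mem_union.1 hv with hv | hv
      · rw [supd_comm]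
        exact far v hv u (Finset.mem_union_right _ (hZP hu)) huv.symm
      · exact iso u hu v hv huv
  · refine ⟨N \ Z, Finset.sdiff_subset.trans (hN.sub.trans h.sub), by omega, hcovZ⟩

/-- Lower bound: the discarded points and the too large net are together more than `k` points with
pairwise distances at least `s`. Upper bound: cover `P` by at most `k'` points and let the discarded
points be centers. For `s = ℓ / 2` the net on side `2 * ℓ` covers `P` within `4 * ℓ`, and `E + 4 * ℓ
≤ 8 * ℓ = 16 * s`. For `s = σ` the cover `Y` of the last pruning is used. -/
theorem Pruned.isScale (h : Pruned d x n k P k' σ) (hℓ : 0 < ℓ) {N₂ : Finset ℤ}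
    (hN₂ : IsNet d (2 * ℓ) x P N₂) (hc₂ : N₂.card ≤ k')
    (hex : ∃ u ∈ P, ∃ v ∈ P, u ≠ v ∧ supd d (x u) (x v) ≤ ℓ)
    (hs : s = ℓ / 2 ∧ (σ = 0 ∨ s ≤ σ) ∨ 0 < σ ∧ s = σ) (hN : IsNet d s x P N) (hc : k' < N.card) :
    IsScale d x n k s := by
  obtain ⟨X, E, hX, hXk, hXP, hcov, hE, hσ⟩ := h.ex
  obtain ⟨u₀, hu₀, v₀, hv₀, hne, huv⟩ := hex
  have hEℓ : E ≤ 4 * ℓ := (hE u₀ hu₀ v₀ hv₀ hne).trans (by linarith)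
  have hs0 : 0 < s := by
    rcases hs with ⟨h1, _⟩ | ⟨h1, h2⟩
    · linarith
    · linarith
  have upper : ∀ (Y : Finset ℤ) (r : ℝ), Y ⊆ Finset.Ico 0 n → Y.card ≤ k' → 0 ≤ r →
      (∀ u ∈ P, ∃ y ∈ Y, supd d (x u) (x y) ≤ r) → E + r ≤ 18 * s → ∃ S ⊆ Finset.Ico 0 n,
      S.card ≤ k ∧ ∀ u ∈ Finset.Ico 0 n, ∃ v ∈ S, supd d (x u) (x v) ≤ 18 * s := by
    intro Y r hY hYk hr hcY hEr
    refine ⟨X ∪ Y, Finset.union_subset hX hY, ?_, fun p hp => ?_⟩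
    · have := Finset.card_union_le X Y
      omega
    · obtain ⟨q, hq, hpq⟩ := hcov p hp
      rcases Finset.mem_union.1 hq with hq | hq
      · exact ⟨q, Finset.mem_union_left _ hq, by linarith⟩
      · obtain ⟨y, hy, hqy⟩ := hcY q hq
        exact ⟨y, Finset.mem_union_right _ hy, (supd_triangle _ _ (x q) _).trans (by linarith)⟩
  refine ⟨hs0, ⟨X ∪ N, Finset.union_subset hX (hN.sub.trans h.sub), ?_, ?_⟩, ?_⟩
  · rw [Finset.card_union_of_disjoint (Finset.disjoint_of_subset_right hN.sub hXP)]
    push_cast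
    omega
  · have far : ∀ u ∈ X, ∀ v ∈ X ∪ P, u ≠ v → s ≤ supd d (x u) (x v) := by
      intro u hu v hv huv
      rcases hσ with ⟨_, rfl⟩ | ⟨h1, h2, _⟩
      · simp at hu
      · refine le_trans ?_ (h2 u hu v hv huv)
        rcases hs with ⟨_, h3⟩ | ⟨_, h3⟩
        · exact h3.resolve_left h1.ne'
        · exact h3.le
    intro u hu v hv huv
    have hsub : X ∪ N ⊆ X ∪ P := Finset.union_subset_union le_rfl hN.sub
    rcases Finset.mem_union.1 hu with hu' | hu'
    · exact far u hu' v (hsub hv) huv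
    · rcases Finset.mem_union.1 hv with hv' | hv'
      · rw [supd_comm]
        exact far v hv' u (hsub hu) huv.symm
      · exact (hN.lt_supd hs0 hu' hv' huv).le
  · rcases hs with ⟨h1, _⟩ | ⟨h1, h2⟩
    · refine upper N₂ (4 * ℓ) (hN₂.sub.trans h.sub) hc₂ (by linarith) (fun u hu => ?_)
        (by linarith)
      obtain ⟨v, hv, h3⟩ := hN₂.exists_supd_le (by linarith) hu
      exact ⟨v, hv, h3.trans (by linarith)⟩
    · rcases hσ with ⟨h3, _⟩ | ⟨_, _, Y, hY, hYk, h3⟩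
      · exact absurd h3 h1.ne'
      · choose! f hf using h3
        -- Two points of `P` share an element of `Y`, as `P` has more than `k'` points. They are
        -- within `4 * σ`, so `E ≤ 16 * σ`, and adding `2 * σ` gives the constant 18.
        obtain ⟨u, hu, v, hv, huv', hfuv⟩ := Finset.exists_ne_map_eq_of_card_lt_of_maps_to
          (s := P) (t := Y) (f := f) (by have := h.lt; omega) (fun u hu => (hf u hu).1)
        have h4 := (hf u hu).2
        have h5 := (hf v hv).2
        rw [← hfuv, supd_comm] at h5
        have h6 := supd_triangle d (x u) (x (f u)) (x v)
        have h7 := hE u hu v hv huv'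
        exact upper Y (2 * σ) hY hYk (by linarith) (fun u hu => ⟨f u, hf u hu⟩) (by linarith)

-- A point with a neighbor within `g` either is missing from the net, or its neighbor is, because
-- net points are apart. In the latter case charge it to the neighbor: the net points charged to one
-- point lie in distinct cells next to its cell, so there are at most `3 ^ d` of them.
open scoped Classical in
theorem IsNet.card_le (hN : IsNet d g x P N) (hg : 0 < g) :
    (P.filter fun u => ∃ v ∈ P, v ≠ u ∧ supd d (x u) (x v) ≤ g).card ≤
      (3 ^ d + 1) * (P.card - N.card) := by
  set A := P.filter fun u => ∃ v ∈ P, v ≠ u ∧ supd d (x u) (x v) ≤ g with hA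
  have h1 : (P \ N).card = P.card - N.card := Finset.card_sdiff_of_subset hN.sub
  have h2 : (A.filter fun u => u ∉ N).card ≤ (P \ N).card := by
    refine Finset.card_le_card fun u hu => ?_
    simp only [hA, Finset.mem_filter] at hu
    exact Finset.mem_sdiff.2 ⟨hu.1.1, hu.2⟩
  have h3 : (A.filter fun u => u ∈ N).card ≤ 3 ^ d * (P \ N).card := by
    have hex : ∀ u ∈ A.filter fun u => u ∈ N, ∃ v ∈ P \ N,
        Near d 1 (cell g (x v)) (cell g (x u)) := by
      intro u hu
      simp only [hA, Finset.mem_filter] at hu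
      obtain ⟨⟨_, v, hv, hvu, hd⟩, huN⟩ := hu
      have hn : Near d 1 (cell g (x u)) (cell g (x v)) := near_of_supd_le hg (by simpa using hd)
      exact ⟨v, Finset.mem_sdiff.2 ⟨hv, fun hvN => hN.apart u huN v hvN hvu.symm hn⟩, hn.symm⟩
    choose! f hf using hex
    refine Finset.card_le_mul_card_image_of_maps_to (f := f) (fun u hu => (hf u hu).1) _
      fun v hv => ?_
    refine (card_le_of_near (b := 1) (d := d) _ (fun u => cell g (x u)) (cell g (x v))
      (fun u hu => ?_) fun u hu u' hu' huu' => ?_).trans (by norm_num)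
    · rw [Finset.mem_filter] at hu
      rw [← hu.2]
      exact (hf u hu.1).2
    · rw [Finset.mem_filter, Finset.mem_filter] at hu hu'
      by_contra hne
      exact hN.apart u hu.1.2 u' hu'.1.2 hne (near_of_eq huu')
  have h4 : A.card = (A.filter fun u => u ∈ N).card + (A.filter fun u => u ∉ N).card :=
    (Finset.card_filter_add_card_filter_not _).symm
  rw [← h1]
  calc A.card ≤ 3 ^ d * (P \ N).card + (P \ N).card := by omega
    _ = _ := by ring

/-- The distance of the point `u` to the other points of `P`. -/
noncomputable def nnd (d : ℕ) (x : ℤ → ℕ → ℝ) (P : Finset ℤ) (u : ℤ) : ℝ :=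
  sInf ((fun v => supd d (x v) (x u)) '' (P.erase u : Finset ℤ))

theorem nnd_le {u v : ℤ} (hv : v ∈ P) (hvu : v ≠ u) : nnd d x P u ≤ supd d (x v) (x u) :=
  csInf_le ((Finset.finite_toSet _).image _).bddBelow ⟨v, by simp [hv, hvu], rfl⟩

theorem exists_nnd_eq {u : ℤ} (hP : 1 < P.card) : ∃ v ∈ P, v ≠ u ∧ nnd d x P u = supd d (x v) (x u) := by
  have hne : (P.erase u).Nonempty := by
    rw [← Finset.card_pos]
    have := Finset.pred_card_le_card_erase (s := P) (a := u)
    omega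
  obtain ⟨v, hv, h⟩ := ((Finset.coe_nonempty.2 hne).image (fun v => supd d (x v) (x u))).csInf_mem
    ((Finset.finite_toSet _).image _)
  exact ⟨v, Finset.mem_of_mem_erase hv, Finset.ne_of_mem_erase hv, h.symm⟩

open scoped Classical in
theorem IsNet.card_nnd_le (hN : IsNet d g x P N) (hg : 0 < g) (hP : 1 < P.card) (hℓ : ℓ ≤ g) :
    (P.filter fun u => nnd d x P u ≤ ℓ).card ≤ (3 ^ d + 1) * (P.card - N.card) := by
  refine le_trans (Finset.card_le_card fun u hu => ?_) (hN.card_le hg)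
  simp only [Finset.mem_filter] at hu ⊢
  obtain ⟨v, hv, hvu, h⟩ := exists_nnd_eq (d := d) (x := x) (u := u) hP
  refine ⟨hu.1, v, hv, hvu, ?_⟩
  rw [supd_comm, ← h]
  exact hu.2.trans hℓ

-- Points in adjacent cells are closer than `2 * g ≤ ℓ`, so a point without a neighbor closer than
-- `ℓ` is isolated.
open scoped Classical in
theorem card_le_isolated (hg : 0 < g) (hℓ : 2 * g ≤ ℓ) :
    (P.filter fun u => ℓ ≤ nnd d x P u).card ≤ (isolated d g x P).card := by
  refine Finset.card_le_card fun u hu => ?_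
  simp only [Finset.mem_filter] at hu
  refine mem_isolated.2 ⟨hu.1, fun v hv hvu hn => ?_⟩
  have h1 := supd_lt_of_near hg hn
  have h2 := nnd_le (d := d) (x := x) hv hvu
  rw [supd_comm] at h2
  push_cast at h1
  linarith [hu.2]

end KCenter

/-! ### Searching for the scale -/

namespace RealRAM

open KCenter RealRAM.Expr RealRAM.Prog

theorem Spec.setI_seq {x : ℕ} {e : Expr Ty.int} {B : Prog} {s : Store} {c₂ c : ℕ}
    {Q : Store → Prop} (h : Spec B (s.setI x (e.eval s)) c₂ Q) (hc : e.size + 2 + c₂ ≤ c) :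
    Spec (Prog.seq (setI x e) B) s c Q :=
  Spec.seq (Prog.Simple.spec (A := setI x e) trivial s) (by rintro _ rfl; exact h)
    (by simp only [cost]; omega)

theorem Spec.setR_seq {x : ℕ} {e : Expr Ty.real} {B : Prog} {s : Store} {c₂ c : ℕ}
    {Q : Store → Prop} (h : Spec B (s.setR x (e.eval s)) c₂ Q) (hc : e.size + 2 + c₂ ≤ c) :
    Spec (Prog.seq (setR x e) B) s c Q :=
  Spec.seq (Prog.Simple.spec (A := setR x e) trivial s) (by rintro _ rfl; exact h)
    (by simp only [cost]; omega)

theorem Spec.setI {x : ℕ} {e : Expr Ty.int} {s : Store} {c : ℕ} {Q : Store → Prop}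
    (h : Q (s.setI x (e.eval s))) (hc : e.size + 1 ≤ c) : Spec (Prog.setI x e) s c Q :=
  (Prog.Simple.spec (A := Prog.setI x e) trivial s).mono hc (by rintro _ rfl; exact h)

theorem Spec.setR {x : ℕ} {e : Expr Ty.real} {s : Store} {c : ℕ} {Q : Store → Prop}
    (h : Q (s.setR x (e.eval s))) (hc : e.size + 1 ≤ c) : Spec (Prog.setR x e) s c Q :=
  (Prog.Simple.spec (A := Prog.setR x e) trivial s).mono hc (by rintro _ rfl; exact h)

/-- The store contains the problem with the points `x 0, …, x (n - 1)` and `k` centers, and a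
permutation of the points. -/
structure Base (n k : ℤ) (x : ℤ → ℕ → ℝ) (s : Store) : Prop where
  pt : s.pt = x
  vn_eq : s.ivar vn = n
  vk_eq : s.ivar vk = k
  inj : Set.InjOn (s.iarr aL) (Set.Ico 0 n)
  seg_eq : seg (s.iarr aL) 0 n = Finset.Ico 0 n

variable {d : ℕ} {n k : ℤ} {x : ℤ → ℕ → ℝ}

theorem Base.of_shuffle {lo hi : ℤ} {s s' : Store} (h : Base n k x s)
    (hL : Shuffle lo hi (s.iarr aL) (s'.iarr aL)) (hlo : 0 ≤ lo) (hhi : hi ≤ n)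
    (hr : s'.rarr = s.rarr) (hn : s'.ivar vn = s.ivar vn) (hk : s'.ivar vk = s.ivar vk) :
    Base n k x s' :=
  ⟨by rw [← h.pt]; unfold Store.pt; rw [hr], hn.trans h.vn_eq, hk.trans h.vk_eq,
    hL.injOn h.inj hlo hhi, by rw [(hL.mono hlo hhi).seg_eq, h.seg_eq]⟩

theorem Base.of_eq {s s' : Store} (h : Base n k x s) (hL : s'.iarr aL = s.iarr aL)
    (hr : s'.rarr = s.rarr) (hn : s'.ivar vn = s.ivar vn) (hk : s'.ivar vk = s.ivar vk) :
    Base n k x s' :=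
  ⟨by rw [← h.pt]; unfold Store.pt; rw [hr], hn.trans h.vn_eq, hk.trans h.vk_eq,
    by rw [hL]; exact h.inj, by rw [hL]; exact h.seg_eq⟩

/-- Construct a maximal set of points that are not in neighboring cells. -/
def net (d : ℕ) : Prog := RealRAM.cover d 1 (litI 0) (litI 1)

/-- The first `vc` points are a net of the first `ve` points. -/
structure NetStore (d : ℕ) (x : ℤ → ℕ → ℝ) (s₀ s : Store) : Prop where
  shuffle : Shuffle 0 (s₀.ivar ve) (s₀.iarr aL) (s.iarr aL)
  nonneg : 0 ≤ s.ivar vc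
  le : s.ivar vc ≤ s₀.ivar ve
  table : s.Table d (s.ivar vc)
  isNet : IsNet d (s₀.rvar rg) x (seg (s₀.iarr aL) 0 (s₀.ivar ve)) (seg (s.iarr aL) 0 (s.ivar vc))
  near_eq : ∀ z, 0 ≤ z → z < s₀.ivar ve → s.iarr anear (s.iarr aL z) = 0
  keeps : Keeps [vi, vc, vp, vt, vj, vq, vf] [aL, aasg', aT, anear] s₀ s

/-- A covering pass in which nothing is covered beforehand and every center in an adjacent cell
counts. -/
theorem net_spec {s : Store} (h : Base n k x s) (hm : s.ivar vm = 0) (h0 : 0 ≤ s.ivar ve)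
    (hn : s.ivar ve ≤ n) :
    Spec (net d) s ((s.ivar ve).toNat * ((coverBody d 1 (litI 0) (litI 1)).cost + 12) + 14)
      (NetStore d x s) := by
  have hinj : Set.InjOn (s.iarr aL) (Set.Ico 0 (s.ivar ve)) :=
    h.inj.mono (Set.Ico_subset_Ico le_rfl hn)
  refine (cover_spec (P := fun _ => False) (T := fun _ _ => True) (fun s' _ _ _ => by simp [eval])
    (fun s' _ _ => by simp [eval]) (fun _ _ _ => trivial) hm.ge (by rw [hm]; exact h0)
    (by rw [hm]; exact hinj) (fun i h1 h2 => by omega)).mono (by rw [hm, sub_zero]) ?_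
  rintro s' ⟨hc, hk⟩
  have hsh := hc.shuffle
  have hcnt := hc.le_count
  have hcle := hc.count_le
  have hap := hc.apart
  have hcov := hc.cov
  rw [hm] at hsh hcnt hap hcov
  have hnear : ∀ p q, s'.Near d 1 p q ↔ KCenter.Near d 1 (cell (s.rvar rg) (x p))
      (cell (s.rvar rg) (x q)) := fun p q => by
    rw [← h.pt, ← hk.pt, ← hk.rvar]; rfl
  have hne := hc.near_eq
  rw [hm] at hne
  refine ⟨hsh, hcnt, hcle, hc.table, ⟨?_, ?_, ?_⟩, hne, hk⟩
  · rw [← hsh.seg_eq]; exact seg_subset le_rfl hcle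
  · intro u hu v hv huv hN
    obtain ⟨i, hi, rfl⟩ := mem_seg.1 hu
    obtain ⟨j, hj, rfl⟩ := mem_seg.1 hv
    rcases lt_trichotomy i j with hij | rfl | hij
    · exact hap j hj.1 hj.2 i hi.1 hij ⟨(hnear _ _).2 hN.symm, trivial⟩
    · exact huv rfl
    · exact hap i hi.1 hi.2 j hj.1 hij ⟨(hnear _ _).2 hN, trivial⟩
  · intro u hu
    rw [← hsh.seg_eq] at hu
    obtain ⟨z, hz, rfl⟩ := mem_seg.1 hu
    rcases hcov z hz.1 hz.2 with ⟨h1, _⟩ | ⟨j, hj0, hj, _, h2⟩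
    · exact h1.elim
    · refine ⟨_, seg_mem hj0 hj, ?_⟩
      rcases h2 with h2 | h2
      · rw [h2]; exact near_of_eq fun _ _ => rfl
      · exact (hnear _ _).1 h2.1

theorem NetStore.card_eq {s₀ s : Store} (hs : NetStore d x s₀ s) (h : Base n k x s₀)
    (hn : s₀.ivar ve ≤ n) : ((seg (s.iarr aL) 0 (s.ivar vc)).card : ℤ) = s.ivar vc := by
  rw [card_seg ((hs.shuffle.injOn h.inj le_rfl hn).mono
    (Set.Ico_subset_Ico le_rfl (hs.le.trans hn))), sub_zero, Int.toNat_of_nonneg hs.nonneg]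

theorem NetStore.base {s₀ s : Store} (hs : NetStore d x s₀ s) (h : Base n k x s₀)
    (hn : s₀.ivar ve ≤ n) : Base n k x s :=
  h.of_shuffle hs.shuffle le_rfl hn hs.keeps.rarr (hs.keeps.ivar _ (by simp))
    (hs.keeps.ivar _ (by simp))

/-- Discard the isolated points, after computing a net. -/
def prune (d : ℕ) : Prog :=
  seq (mark d 1) <| seq (partition (loadI anear (varI vp))) <|
  seq (setI vk' (subI (varI vk') (subI (varI ve) (varI vb)))) <|
  seq (setI ve (varI vb)) (setR rs (varR rg))

/-- The marks start at `0` since the covering pass has reset them. After `mark`, a point is unmarked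
exactly if it is isolated, so partitioning by the marks removes the isolated points. -/
theorem prune_spec {s₀ s : Store} (h : Base n k x s₀) (hm : s₀.ivar vm = 0) (hs : NetStore d x s₀ s)
    (h0 : 0 ≤ s₀.ivar ve) (hn : s₀.ivar ve ≤ n) :
    Spec (prune d) s ((s₀.ivar ve).toNat * ((markBody d 1).cost + 12) +
        (s₀.ivar ve).toNat * ((partitionBody (loadI anear (varI vp))).cost + 12) + 41)
      (fun s' => Base n k x s' ∧ s'.ivar vm = 0 ∧ s'.ivar vw = s₀.ivar vw ∧ 0 ≤ s'.ivar ve ∧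
        s'.ivar ve ≤ s₀.ivar ve ∧
        seg (s'.iarr aL) 0 (s'.ivar ve) = seg (s₀.iarr aL) 0 (s₀.ivar ve) \
          isolated d (s₀.rvar rg) x (seg (s₀.iarr aL) 0 (s₀.ivar ve)) ∧
        s'.ivar vk' = s₀.ivar vk' -
          (isolated d (s₀.rvar rg) x (seg (s₀.iarr aL) 0 (s₀.ivar ve))).card ∧
        s'.ivar ve = s₀.ivar ve -
          (isolated d (s₀.rvar rg) x (seg (s₀.iarr aL) 0 (s₀.ivar ve))).card ∧
        s'.rvar rs = s₀.rvar rg) := by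
  have hK := hs.keeps
  have hve : s.ivar ve = s₀.ivar ve := hK.ivar _ (by simp)
  have hvm : s.ivar vm = 0 := (hK.ivar _ (by simp)).trans hm
  have hseg := hs.shuffle.seg_eq
  have hinj : Set.InjOn (s.iarr aL) (Set.Ico 0 (s₀.ivar ve)) :=
    (hs.shuffle.injOn h.inj le_rfl hn).mono (Set.Ico_subset_Ico le_rfl hn)
  have hnear : ∀ p q, s.Near d 1 p q ↔ KCenter.Near d 1 (cell (s₀.rvar rg) (x p))
      (cell (s₀.rvar rg) (x q)) := fun p q => by
    rw [← h.pt, ← hK.pt, ← hK.rvar]; rfl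
  set P := seg (s₀.iarr aL) 0 (s₀.ivar ve) with hP
  set Z := isolated d (s₀.rvar rg) x P with hZ
  have hmark := mark_spec (d := d) (b := 1) (s₀ := s) (by omega) (by rw [hve]; exact hs.le) hs.table
  rw [hve] at hmark
  refine Spec.seq hmark (c₂ := (s₀.ivar ve).toNat *
    ((partitionBody (loadI anear (varI vp))).cost + 12) + 29) ?_ (by omega)
  rintro s₁ ⟨hm1, hm2, hK1⟩
  have hL1 : s₁.iarr aL = s.iarr aL := hK1.iarr _ (by simp)
  have hve1 : s₁.ivar ve = s₀.ivar ve := (hK1.ivar _ (by simp)).trans hve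
  have hvm1 : s₁.ivar vm = 0 := (hK1.ivar _ (by simp)).trans hvm
  have hiso : ∀ z, 0 ≤ z → z < s₀.ivar ve → (s₁.iarr anear (s.iarr aL z) ≠ 0 ↔ s.iarr aL z ∉ Z) := by
    intro z hz0 hz
    have hzP : s.iarr aL z ∈ P := by rw [← hseg]; exact seg_mem hz0 hz
    constructor
    · intro h1 h2
      rcases hm1 _ h1 with h3 | ⟨w, hw0, hw, hne, hN⟩
      · exact h3 (hs.near_eq z hz0 hz)
      · exact (mem_isolated.1 h2).2 _ (by rw [← hseg]; exact seg_mem hw0 hw) hne ((hnear _ _).1 hN)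
    · intro h1
      rw [mem_isolated] at h1
      push Not at h1
      obtain ⟨v, hv, hvz, hN⟩ := h1 hzP
      rw [← hseg] at hv
      obtain ⟨w, hw, rfl⟩ := mem_seg.1 hv
      obtain ⟨c, hc, hNc⟩ := hs.isNet.cov _ hzP
      obtain ⟨j, hj, rfl⟩ := mem_seg.1 hc
      -- If the net point near this one is the point itself, it is marked when its neighbor `w` is
      -- processed. Otherwise it is marked when its own turn comes.
      by_cases hzj : s.iarr aL z = s.iarr aL j
      · rw [hzj] at hvz hN ⊢
        exact (hm2 w hw.1 hw.2 j hj.1 hj.2 hvz ((hnear _ _).2 hN.symm)).2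
      · exact (hm2 z hz0 hz j hj.1 hj.2 hzj ((hnear _ _).2 hNc)).1
  have hpart := partition_spec (keep := loadI anear (varI vp))
    (P := fun p => s₁.iarr anear p ≠ 0) (s₀ := s₁)
    (fun s' _ _ h3 => by simp only [eval]; rw [h3 anear (by simp)]) (by rw [hvm1, hve1]; exact h0)
  rw [hvm1, hve1, sub_zero] at hpart
  refine Spec.seq hpart (c₂ := 14) ?_ (by omega)
  rintro s₂ ⟨⟨hsh, hb0, hbe, hkeep, hdrop⟩, hK2⟩
  rw [hL1] at hsh
  have hsh0 := hs.shuffle.trans hsh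
  have hinj2 := hsh.injOn hinj le_rfl le_rfl
  have hve2 : s₂.ivar ve = s₀.ivar ve := (hK2.ivar _ (by simp)).trans hve1
  have hvk2 : s₂.ivar vk' = s₀.ivar vk' :=
    ((hK2.ivar _ (by simp)).trans (hK1.ivar _ (by simp))).trans (hK.ivar _ (by simp))
  have hvm2 : s₂.ivar vm = 0 := (hK2.ivar _ (by simp)).trans hvm1
  have hvw2 : s₂.ivar vw = s₀.ivar vw :=
    ((hK2.ivar _ (by simp)).trans (hK1.ivar _ (by simp))).trans (hK.ivar _ (by simp))
  have hrv2 : s₂.rvar = s₀.rvar := (hK2.rvar.trans hK1.rvar).trans hK.rvar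
  have hbase2 : Base n k x s₂ := h.of_shuffle hsh0 le_rfl hn
    ((hK2.rarr.trans hK1.rarr).trans hK.rarr)
    (((hK2.ivar _ (by simp)).trans (hK1.ivar _ (by simp))).trans (hK.ivar _ (by simp)))
    (((hK2.ivar _ (by simp)).trans (hK1.ivar _ (by simp))).trans (hK.ivar _ (by simp)))
  have hcls : ∀ z, 0 ≤ z → z < s₀.ivar ve → (z < s₂.ivar vb ↔ s₂.iarr aL z ∉ Z) := by
    intro z hz0 hz
    obtain ⟨w, hw, hzw⟩ := hsh.inside ⟨hz0, hz⟩
    rw [hzw, ← hiso w hw.1 hw.2, ← hzw]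
    constructor
    · exact hkeep z hz0
    · intro h1
      by_contra h2
      exact hdrop z (not_lt.1 h2) hz h1
  have hsegP : seg (s₂.iarr aL) 0 (s₀.ivar ve) = P := hsh0.seg_eq
  have hseg2 : seg (s₂.iarr aL) 0 (s₂.ivar vb) = P \ Z := by
    ext p
    rw [Finset.mem_sdiff, ← hsegP, mem_seg, mem_seg]
    constructor
    · rintro ⟨z, hz, rfl⟩
      exact ⟨⟨z, ⟨hz.1, by omega⟩, rfl⟩, (hcls z hz.1 (by omega)).1 hz.2⟩
    · rintro ⟨⟨z, hz, rfl⟩, h2⟩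
      exact ⟨z, ⟨hz.1, (hcls z hz.1 hz.2).2 h2⟩, rfl⟩
  have hcard : s₂.ivar vb = s₀.ivar ve - Z.card := by
    have h1 : (P \ Z).card = P.card - Z.card := Finset.card_sdiff_of_subset isolated_subset
    have h2 := Finset.card_le_card (isolated_subset (d := d) (g := s₀.rvar rg) (x := x) (P := P))
    rw [← hseg2, ← hsegP, card_seg hinj2,
      card_seg (hinj2.mono (Set.Ico_subset_Ico le_rfl hbe))] at h1
    rw [← hsegP, card_seg hinj2, hsegP, ← hZ] at h2
    omega
  refine Spec.setI_seq (c₂ := 7) ?_ (by simp [Expr.size])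
  refine Spec.setI_seq (c₂ := 3) ?_ (by simp [Expr.size])
  refine Spec.setR ?_ (by simp [Expr.size])
  set s₃ := ((s₂.setI vk' _).setI ve _).setR rs _ with hs₃
  have e1 : s₃.ivar ve = s₂.ivar vb := by simp [hs₃, eval]
  have e2 : s₃.ivar vk' = s₂.ivar vk' - (s₂.ivar ve - s₂.ivar vb) := by simp [hs₃, eval]
  have e3 : s₃.rvar rs = s₂.rvar rg := by simp [hs₃, eval]
  have e4 : s₃.ivar vm = s₂.ivar vm := by simp [hs₃]
  have e5 : s₃.ivar vw = s₂.ivar vw := by simp [hs₃]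
  refine ⟨hbase2.of_eq rfl rfl (by simp [hs₃]) (by simp [hs₃]), ?_, ?_, ?_, ?_, ?_, ?_, ?_, ?_⟩
  · rw [e4, hvm2]
  · rw [e5, hvw2]
  · rw [e1]; exact hb0
  · rw [e1]; exact hbe
  · rw [e1]; exact hseg2
  · rw [e2, hvk2, hve2]; omega
  · rw [e1, hcard]
  · rw [e3, hrv2]

end RealRAM

/-! ### One round of the search for the scale. -/

namespace RealRAM

open KCenter RealRAM.Expr RealRAM.Prog

variable {d : ℕ} {n k : ℤ} {x : ℤ → ℕ → ℝ}

/-- Compute the distance of the point with the sampled index to its nearest neighbor. -/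
def sample (d : ℕ) : Prog :=
  seq (setR rl (sup d (loadI aL (varI vu)) (loadI aL (leI (varI vu) (litI 0))))) <|
  seq (setI vu (loadI aL (varI vu))) (nearest d)

theorem sample_spec {s : Store} {r : ℤ} (h : Base n k x s) (hr : s.ivar vu = r) (hr0 : 0 ≤ r)
    (hre : r < s.ivar ve) (he : 2 ≤ s.ivar ve) (hn : s.ivar ve ≤ n) :
    Spec (sample d) s ((s.ivar ve).toNat * ((nearestBody d).cost + 12) +
        ((sup d (loadI aL (varI vu)) (loadI aL (leI (varI vu) (litI 0)))).size + 17))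
      (fun s' => s'.rvar rl = nnd d x (seg (s.iarr aL) 0 (s.ivar ve)) (s.iarr aL r) ∧
        (∀ y, y ≠ vi → y ≠ vp → y ≠ vu → s'.ivar y = s.ivar y) ∧
        (∀ y, y ≠ rl → s'.rvar y = s.rvar y) ∧ s'.iarr = s.iarr ∧ s'.rarr = s.rarr) := by
  set L := s.iarr aL with hL
  set e := s.ivar ve with he'
  have hinj : Set.InjOn L (Set.Ico 0 e) := h.inj.mono (Set.Ico_subset_Ico le_rfl hn)
  refine Spec.setR_seq (c₂ := e.toNat * ((nearestBody d).cost + 12) + 15) ?_ (by omega)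
  refine Spec.setI_seq (c₂ := e.toNat * ((nearestBody d).cost + 12) + 11) ?_
    (by simp only [Expr.size]; omega)
  -- The comparison `vu ≤ 0` is itself used as an index: it is `1` for `r = 0` and `0` otherwise,
  -- hence always a valid index different from `r`.
  obtain ⟨o, ho, hor, hov⟩ : ∃ o, (0 ≤ o ∧ o < e) ∧ o ≠ r ∧
      (leI (varI vu) (litI 0)).eval s = o := by
    simp only [eval, hr]
    rcases hr0.eq_or_lt with h1 | h1
    · exact ⟨1, ⟨by omega, by omega⟩, by omega, by simp [← h1]⟩
    · exact ⟨0, ⟨by omega, by omega⟩, by omega, by simp [h1]⟩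
  set s₁ := (s.setR rl _).setI vu _ with hs₁
  have e1 : s₁.rvar rl = supd d (x (L r)) (x (L o)) := by
    have h1 : ((sup d (loadI aL (varI vu)) (loadI aL (leI (varI vu) (litI 0)))).eval s : ℝ) =
        supd d (x (L r)) (x (L o)) := by
      rw [sup_eval, ← h.pt, ← hr, ← hov]; rfl
    rw [← h1, hs₁]; simp
  have e2 : s₁.ivar vu = L r := by rw [← hr, hs₁]; simp [eval, hL]
  have e3 : s₁.ivar ve = e := by simp [hs₁, he']
  have e4 : s₁.iarr aL = L := rfl
  have e5 : s₁.pt = x := h.pt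
  have hspec := nearest_spec (d := d) (s₀ := s₁) (by omega)
  rw [e3] at hspec
  refine hspec.mono le_rfl ?_
  rintro s' ⟨h1, h2, h3, h4, h5, h6⟩
  rw [e2, e4, e5] at h1 h2
  set P := seg L 0 e with hP
  have hne : ∀ z, 0 ≤ z → z < e → z ≠ r → L z ≠ L r := fun z h0 h1 hzr hz =>
    hzr (hinj ⟨h0, h1⟩ ⟨hr0, hre⟩ hz)
  refine ⟨le_antisymm ?_ ?_, ?_, ?_, h5, h6⟩
  · obtain ⟨v, hv, hvr, h7⟩ := exists_nnd_eq (d := d) (x := x) (P := P) (u := L r) (by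
      rw [hP, card_seg hinj]; omega)
    obtain ⟨z, hz, rfl⟩ := mem_seg.1 hv
    rw [h7]
    exact h1 z hz.1 hz.2 hvr
  · rcases h2 with h2 | ⟨z, h0, hz, hzr, h2⟩
    · rw [h2, e1, supd_comm]
      exact nnd_le (seg_mem ho.1 ho.2) (hne o ho.1 ho.2 hor)
    · rw [h2]
      exact nnd_le (seg_mem h0 hz) hzr
  · intro y hy1 hy2 hy3
    rw [h3 y hy1 hy2, hs₁, Store.setI_ivar, if_neg hy3]; rfl
  · intro y hy
    rw [h4 y hy, hs₁, Store.setI_rvar, Store.setR_rvar, if_neg hy]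

/-- One round of the search for the scale, for the point with a sampled index. -/
def searchRound (d : ℕ) : Prog :=
  seq (sample d) <| seq (setR rg (addR (varR rl) (varR rl))) <| seq (net d) <|
  cond (ltI (varI vk') (varI vc)) (setI ve (varI vc)) <|
  seq (setR rg (divR (varR rl) (ofInt (litI 2)))) <|
  seq (cond (andI (ltR (ofInt (litI 0)) (varR rs)) (ltR (varR rs) (varR rg)))
    (setR rg (varR rs)) skip) <| seq (net d) <|
  cond (ltI (varI vk') (varI vc)) (setI vw (litI 0)) (prune d)

/-- The invariant of the search for the scale. -/
structure Searching (d : ℕ) (n k : ℤ) (x : ℤ → ℕ → ℝ) (s : Store) : Prop where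
  base : Base n k x s
  vm_eq : s.ivar vm = 0
  nonneg : 0 ≤ s.ivar ve
  le : s.ivar ve ≤ n
  pruned : s.ivar vw ≠ 0 → Pruned d x n k (seg (s.iarr aL) 0 (s.ivar ve)) (s.ivar vk') (s.rvar rs)
  isScale : s.ivar vw = 0 → IsScale d x n k (s.rvar rg)

/-- The potential of the search for the scale. -/
def searchPotential (s : Store) : ℕ := if s.ivar vw = 0 then 0 else (s.ivar ve).toNat

/-- A bound for the cost of one round per point. -/
def searchCost (d : ℕ) : ℕ :=
  ((nearestBody d).cost + 12) + 2 * ((coverBody d 1 (litI 0) (litI 1)).cost + 12) +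
    ((markBody d 1).cost + 12) + ((partitionBody (loadI anear (varI vp))).cost + 12) +
    (sup d (loadI aL (varI vu)) (loadI aL (leI (varI vu) (litI 0)))).size + 200

/-- Sampling concerns indices, whereas the counting lemmas concern points; without repetitions the
counts agree. -/
theorem card_filter_range_seg {L : ℤ → ℤ} {e : ℤ} {p : ℤ → Prop} [DecidablePred p]
    [DecidablePred fun j : ℕ => p (L j)] (h : Set.InjOn L (Set.Ico 0 e)) :
    ((Finset.range e.toNat).filter fun j : ℕ => p (L j)).card = ((seg L 0 e).filter p).card := by
  refine Finset.card_bij (fun j _ => L j) (fun j hj => ?_) (fun j hj j' hj' hjj => ?_)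
    fun q hq => ?_
  · rw [Finset.mem_filter, Finset.mem_range] at hj
    exact Finset.mem_filter.2 ⟨seg_mem (by omega) (by omega), hj.2⟩
  · rw [Finset.mem_filter, Finset.mem_range] at hj hj'
    have := h (x₁ := (j : ℤ)) (x₂ := (j' : ℤ)) ⟨by omega, by omega⟩ ⟨by omega, by omega⟩ hjj
    omega
  · obtain ⟨hq1, hq2⟩ := Finset.mem_filter.1 hq
    obtain ⟨z, hz, rfl⟩ := mem_seg.1 hq1
    refine ⟨z.toNat, Finset.mem_filter.2 ⟨Finset.mem_range.2 (by omega), ?_⟩, ?_⟩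
    · rwa [Int.toNat_of_nonneg hz.1]
    · rw [Int.toNat_of_nonneg hz.1]

/-- Three outcomes. Passing to the net removes a `1 / (3 ^ d + 1)` share of the number of points
whose nearest neighbor is no farther than that of the sample. Pruning removes all points whose
nearest neighbor is at least as far. Finding the scale sets the potential to zero. The minimum of
the two counts bounds the drop in each case. -/
theorem searchRound_spec {s₀ : Store} {r : ℕ} (h : Searching d n k x s₀) (hw : s₀.ivar vw ≠ 0)
    (hx : ∀ p ∈ Finset.Ico 0 n, ∀ q ∈ Finset.Ico 0 n, p ≠ q → 0 < supd d (x p) (x q))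
    (hr : r < (s₀.ivar ve).toNat) :
    Spec (searchRound d) (s₀.setI vu r) (searchCost d * (s₀.ivar ve).toNat)
      (fun s => Searching d n k x s ∧ (3 ^ d + 1) * searchPotential s +
        min ((Finset.range (s₀.ivar ve).toNat).filter fun j : ℕ =>
            nnd d x (seg (s₀.iarr aL) 0 (s₀.ivar ve)) (s₀.iarr aL r) ≤
            nnd d x (seg (s₀.iarr aL) 0 (s₀.ivar ve)) (s₀.iarr aL j)).card
          ((Finset.range (s₀.ivar ve).toNat).filter fun j : ℕ =>
            nnd d x (seg (s₀.iarr aL) 0 (s₀.ivar ve)) (s₀.iarr aL j) ≤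
            nnd d x (seg (s₀.iarr aL) 0 (s₀.ivar ve)) (s₀.iarr aL r)).card ≤
        (3 ^ d + 1) * searchPotential s₀) := by
  classical
  set L := s₀.iarr aL with hL
  set e := s₀.ivar ve with he
  set P := seg L 0 e with hP
  set u := L r with hu
  set ℓ := nnd d x P u with hℓ
  have hpr := h.pruned hw
  have hinj : Set.InjOn L (Set.Ico 0 e) := h.base.inj.mono (Set.Ico_subset_Ico le_rfl h.le)
  have hcardP : P.card = e.toNat := by rw [hP, card_seg hinj, sub_zero]
  have he2 : 2 ≤ e := by
    have h1 := hpr.lt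
    have h2 := hpr.pos
    have h3 := h.nonneg
    change s₀.ivar vk' < (P.card : ℤ) at h1
    rw [hcardP] at h1
    omega
  have hΦ : searchPotential s₀ = e.toNat := if_neg hw
  obtain ⟨v, hv, hvu, hvℓ⟩ := exists_nnd_eq (d := d) (x := x) (P := P) (u := u) (by omega)
  have huP : u ∈ P := seg_mem (by omega) (by omega)
  -- Distinctness of the input points enters here: the grid sides are positive.
  have hℓ0 : 0 < ℓ := by
    rw [hℓ, hvℓ]; exact hx v (hpr.sub hv) u (hpr.sub huP) hvu
  have hex : ∃ u ∈ P, ∃ v ∈ P, u ≠ v ∧ supd d (x u) (x v) ≤ ℓ := ⟨v, hv, u, huP, hvu, hvℓ.ge⟩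
  have hup : ((Finset.range e.toNat).filter fun j : ℕ => ℓ ≤ nnd d x P (L j)).card =
      (P.filter fun w => ℓ ≤ nnd d x P w).card :=
    card_filter_range_seg (p := fun w => ℓ ≤ nnd d x P w) hinj
  have hdown : ((Finset.range e.toNat).filter fun j : ℕ => nnd d x P (L j) ≤ ℓ).card =
      (P.filter fun w => nnd d x P w ≤ ℓ).card :=
    card_filter_range_seg (p := fun w => nnd d x P w ≤ ℓ) hinj
  rw [hΦ, hup, hdown]
  set N := e.toNat with hN
  set A := N * ((nearestBody d).cost + 12) with hA
  set B := N * ((coverBody d 1 (litI 0) (litI 1)).cost + 12) with hB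
  set M := N * ((markBody d 1).cost + 12) with hM
  set Q := N * ((partitionBody (loadI anear (varI vp))).cost + 12) with hQ
  have hcost : A + 2 * B + M + Q +
      (sup d (loadI aL (varI vu)) (loadI aL (leI (varI vu) (litI 0)))).size + 200 ≤
      searchCost d * N := by
    have h1 : searchCost d * N = A + 2 * B + M + Q +
        (sup d (loadI aL (varI vu)) (loadI aL (leI (varI vu) (litI 0)))).size * N + 200 * N := by
      rw [searchCost, hA, hB, hM, hQ]; ring
    have h2 : (sup d (loadI aL (varI vu)) (loadI aL (leI (varI vu) (litI 0)))).size * 1 ≤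
        (sup d (loadI aL (varI vu)) (loadI aL (leI (varI vu) (litI 0)))).size * N :=
      Nat.mul_le_mul_left _ (by omega)
    omega
  have hbase : Base n k x (s₀.setI vu r) := h.base.of_eq rfl rfl (by simp) (by simp)
  have hsample := sample_spec (d := d) hbase (r := r) (by simp) (by omega)
    (by simp only [Store.setI_ivar]; rw [if_neg (by simp)]; omega)
    (by simp only [Store.setI_ivar]; rw [if_neg (by simp)]; omega)
    (by simp only [Store.setI_ivar]; rw [if_neg (by simp)]; exact h.le)
  rw [show (s₀.setI vu r).ivar ve = e by simp [he], ← hN] at hsample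
  refine Spec.seq hsample (c₂ := 2 * B + M + Q + 150) ?_ (by omega)
  rintro s₁ ⟨h1l, h1i, h1r, h1a, h1ra⟩
  change s₁.rvar rl = ℓ at h1l
  refine Spec.setR_seq (c₂ := 2 * B + M + Q + 140) ?_ (by simp only [Expr.size]; omega)
  set s₁' := s₁.setR rg _ with hs₁'
  have h1L : s₁'.iarr aL = L := by rw [hs₁', Store.setR_iarr, h1a]; rfl
  have h1i' : ∀ y, y ≠ vi → y ≠ vp → y ≠ vu → s₁'.ivar y = s₀.ivar y := fun y hy1 hy2 hy3 => by
    rw [hs₁', Store.setR_ivar, h1i y hy1 hy2 hy3, Store.setI_ivar, if_neg hy3]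
  have h1e : s₁'.ivar ve = e := h1i' _ (by simp) (by simp) (by simp)
  have h1g : s₁'.rvar rg = 2 * ℓ := by
    rw [hs₁', Store.setR_rvar, if_pos rfl, two_mul, ← h1l]; rfl
  have h1r' : ∀ y, y ≠ rl → y ≠ rg → s₁'.rvar y = s₀.rvar y := fun y hy1 hy2 => by
    rw [hs₁', Store.setR_rvar, if_neg hy2, h1r y hy1]; rfl
  have h1ℓ : s₁'.rvar rl = ℓ := by rw [hs₁', Store.setR_rvar, if_neg (by simp), h1l]
  have hb1 : Base n k x s₁' := h.base.of_eq h1L h1ra (h1i' _ (by simp) (by simp) (by simp))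
    (h1i' _ (by simp) (by simp) (by simp))
  have hnet := net_spec (d := d) hb1 ((h1i' _ (by simp) (by simp) (by simp)).trans h.vm_eq)
    (by rw [h1e]; omega) (by rw [h1e]; exact h.le)
  rw [h1e, ← hN] at hnet
  refine Spec.seq hnet (c₂ := B + M + Q + 120) ?_ (by omega)
  clear hnet hsample
  clear_value s₁'
  intro s₂ hs₂
  have hK2 := hs₂.keeps
  have hb2 := hs₂.base hb1 (by rw [h1e]; exact h.le)
  have hc2 := hs₂.card_eq hb1 (by rw [h1e]; exact h.le)
  have h2net := hs₂.isNet
  have h2sh := hs₂.shuffle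
  have h2le := hs₂.le
  rw [h1g, h1L, h1e] at h2net
  rw [h1L, h1e] at h2sh
  rw [h1e] at h2le
  have h2i : ∀ y, 10 ≤ y → y ≠ vu → s₂.ivar y = s₀.ivar y := fun y hy hy2 =>
    (hK2.ivar y (by simp; omega)).trans (h1i' y (by simp; omega) (by simp; omega) hy2)
  have h2e : s₂.ivar ve = e := (hK2.ivar _ (by simp)).trans h1e
  have h2k : s₂.ivar vk' = s₀.ivar vk' := h2i _ (by simp) (by simp)
  have h2m : s₂.ivar vm = 0 := (h2i _ (by simp) (by simp)).trans h.vm_eq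
  have h2w : s₂.ivar vw = s₀.ivar vw := h2i _ (by simp) (by simp)
  have h2rs : s₂.rvar rs = s₀.rvar rs := by rw [hK2.rvar]; exact h1r' _ (by simp) (by simp)
  have h2rl : s₂.rvar rl = ℓ := by rw [hK2.rvar]; exact h1ℓ
  refine Spec.cond (c₁ := B + M + Q + 110) (fun hc => ?_) (fun hc => ?_)
    (by simp only [ltI, Expr.size]; omega)
  · -- many centers
    replace hc : s₂.ivar vk' < s₂.ivar vc := ltI_ne_zero.1 hc
    rw [h2k] at hc
    refine Spec.setI ?_ (by simp only [Expr.size]; omega)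
    set s₃ := s₂.setI ve _ with hs₃
    have h3e : s₃.ivar ve = s₂.ivar vc := by simp [hs₃, eval]
    have h3w : s₃.ivar vw = s₀.ivar vw := by rw [hs₃, Store.setI_ivar, if_neg (by simp), h2w]
    have h3k : s₃.ivar vk' = s₀.ivar vk' := by rw [hs₃, Store.setI_ivar, if_neg (by simp), h2k]
    have h3m : s₃.ivar vm = 0 := by rw [hs₃, Store.setI_ivar, if_neg (by simp), h2m]
    refine ⟨⟨hb2.of_eq rfl rfl (by simp [hs₃]) (by simp [hs₃]), h3m, ?_, ?_, fun _ => ?_,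
      fun h0 => ?_⟩, ?_⟩
    · rw [h3e]; exact hs₂.nonneg
    · rw [h3e]; exact h2le.trans h.le
    · rw [h3e, h3k, show s₃.rvar rs = s₀.rvar rs from h2rs]
      exact hpr.net hℓ0 h2net (by rw [show s₃.iarr = s₂.iarr from rfl, hc2]; exact hc) hex
    · exact absurd (h3w.symm.trans h0) hw
    · rw [searchPotential, h3w, if_neg hw, h3e]
      have h4 := h2net.card_nnd_le (by linarith) (by rw [hcardP]; omega) (ℓ := ℓ) (by linarith)
      have h5 : (s₂.ivar vc).toNat ≤ N := by omega
      rw [hcardP, show (seg (s₂.iarr aL) 0 (s₂.ivar vc)).card = (s₂.ivar vc).toNat by omega,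
        Nat.mul_sub] at h4
      have h6 := Nat.mul_le_mul_left (3 ^ d + 1) h5
      refine (add_le_add le_rfl (min_le_right _ _)).trans ?_
      refine (add_le_add le_rfl h4).trans ?_
      omega
  · replace hc : s₂.ivar vc ≤ s₂.ivar vk' := not_lt.1 fun h' => (ltI_ne_zero (e := varI vk') (f := varI vc)).2 h' hc
    rw [h2k] at hc
    refine Spec.setR_seq (c₂ := B + M + Q + 100) ?_ (by simp only [Expr.size]; omega)
    set s₂' := s₂.setR rg _ with hs₂'
    have h2g : s₂'.rvar rg = ℓ / 2 := by
      rw [hs₂', Store.setR_rvar, if_pos rfl, ← h2rl]; simp [eval]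
    have h2s : s₂'.rvar rs = s₀.rvar rs := by rw [hs₂', Store.setR_rvar, if_neg (by simp), h2rs]
    refine Spec.seq (Prog.Simple.spec (A := cond (andI (ltR (ofInt (litI 0)) (varR rs))
      (ltR (varR rs) (varR rg))) (Prog.setR rg (varR rs)) skip) ⟨trivial, trivial⟩ s₂')
      (Q' := _) (c₂ := B + M + Q + 70) ?_
      (by simp only [cost, Expr.size, andI, ltR]; omega)
    rintro s₃ hs₃
    obtain ⟨σ, hσ⟩ : ∃ σ, σ = s₀.rvar rs := ⟨_, rfl⟩
    rw [← hσ] at hpr h2s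
    have hσ0 : σ = 0 ∨ 0 < σ := by
      obtain ⟨_, _, _, _, _, _, _, h1 | h1⟩ := hpr.ex
      · exact Or.inl h1.1
      · exact Or.inr h1.1
    -- The side is `ℓ / 2`, lowered to `σ` if an earlier pruning used a smaller side. So `t ≤ σ`
    -- unless nothing was discarded, and `2 * t ≤ ℓ` always.
    obtain ⟨t, ht, h3g, h3i, h3a, h3r⟩ : ∃ t, (t = ℓ / 2 ∧ (σ = 0 ∨ t ≤ σ) ∨ 0 < σ ∧ t = σ ∧ t ≤ ℓ / 2) ∧
        s₃.rvar rg = t ∧ s₃.ivar = s₂.ivar ∧ s₃.iarr = s₂.iarr ∧ s₃.rarr = s₂.rarr := by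
      have hiff : ((andI (ltR (ofInt (litI 0)) (varR rs)) (ltR (varR rs) (varR rg))).eval s₂' : ℤ) ≠ 0
          ↔ 0 < σ ∧ σ < ℓ / 2 := by
        rw [andI_ne_zero, ltR_ne_zero, ltR_ne_zero, ← h2s, ← h2g]
        simp [eval]
      by_cases h4 : 0 < σ ∧ σ < ℓ / 2
      · rw [exec_cond_of_ne (hiff.2 h4)] at hs₃
        refine ⟨σ, Or.inr ⟨h4.1, rfl, h4.2.le⟩, ?_, ?_, ?_, ?_⟩ <;> rw [hs₃]
        · rw [← h2s]; simp [exec, eval]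
        · rfl
        · rfl
        · rfl
      · rw [exec_cond_zero (not_not.1 fun h' => h4 (hiff.1 h'))] at hs₃
        refine ⟨ℓ / 2, Or.inl ⟨rfl, hσ0.imp id fun h5 => ?_⟩, ?_, ?_, ?_, ?_⟩
        · by_contra h6; exact h4 ⟨h5, not_le.1 h6⟩
        · rw [hs₃]; exact h2g
        · rw [hs₃]; rfl
        · rw [hs₃]; rfl
        · rw [hs₃]; rfl
    clear_value s₂'
    clear hs₃
    have ht0 : 0 < t := by
      rcases ht with h4 | h4
      · linarith [h4.1]
      · linarith [h4.1, h4.2.1]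
    have h2t : 2 * t ≤ ℓ := by
      rcases ht with h4 | h4
      · linarith [h4.1]
      · linarith [h4.2.2]
    have h3e : s₃.ivar ve = e := by rw [h3i, h2e]
    have h3m : s₃.ivar vm = 0 := by rw [h3i, h2m]
    have hb3 : Base n k x s₃ := hb2.of_eq (by rw [h3a]) h3r (by rw [h3i]) (by rw [h3i])
    have hseg3 : seg (s₃.iarr aL) 0 e = P := by rw [h3a, h2sh.seg_eq]
    have hnet := net_spec (d := d) hb3 h3m (by rw [h3e]; omega) (by rw [h3e]; exact h.le)
    rw [h3e, ← hN] at hnet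
    refine Spec.seq hnet (c₂ := M + Q + 50) ?_ (by omega)
    intro s₄ hs₄
    have hK4 := hs₄.keeps
    have hb4 := hs₄.base hb3 (by rw [h3e]; exact h.le)
    have hc4 := hs₄.card_eq hb3 (by rw [h3e]; exact h.le)
    have h4net := hs₄.isNet
    rw [h3g, h3e, hseg3] at h4net
    have h4k : s₄.ivar vk' = s₀.ivar vk' := by rw [hK4.ivar _ (by simp), h3i, h2k]
    refine Spec.cond (c₁ := M + Q + 41) (fun hc' => ?_) (fun hc' => ?_)
      (by simp only [ltI, Expr.size]; omega)
    · replace hc' : s₄.ivar vk' < s₄.ivar vc := ltI_ne_zero.1 hc'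
      rw [h4k] at hc'
      refine Spec.setI ?_ (by simp only [Expr.size]; omega)
      set s₅ := s₄.setI vw _ with hs₅
      have h5e : s₅.ivar ve = e := by
        rw [hs₅, Store.setI_ivar, if_neg (by simp), hK4.ivar _ (by simp), h3e]
      have h5w : s₅.ivar vw = 0 := by simp [hs₅, eval]
      refine ⟨⟨hb4.of_eq rfl rfl (by simp [hs₅]) (by simp [hs₅]), ?_, ?_, ?_,
        fun h0 => absurd h5w h0, fun _ => ?_⟩, ?_⟩
      · rw [hs₅, Store.setI_ivar, if_neg (by simp), hK4.ivar _ (by simp), h3m]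
      · rw [h5e]; exact h.nonneg
      · rw [h5e]; exact h.le
      · rw [hs₅, Store.setI_rvar, hK4.rvar, h3g]
        refine hpr.isScale hℓ0 h2net (by rw [hc2]; exact hc) hex ?_ h4net (by rw [hc4]; exact hc')
        exact ht.imp id fun h6 => ⟨h6.1, h6.2.1⟩
      -- The search ends, so the potential becomes zero, and the count is at most the number of
      -- current points.
      · rw [searchPotential, if_pos h5w, mul_zero, zero_add]
        refine (min_le_left _ _).trans ((Finset.card_filter_le _ _).trans ?_)
        rw [hcardP]
        exact Nat.le_mul_of_pos_left _ (Nat.succ_pos _)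
    · replace hc' : s₄.ivar vc ≤ s₄.ivar vk' := not_lt.1 fun h' => (ltI_ne_zero (e := varI vk') (f := varI vc)).2 h' hc'
      rw [h4k] at hc'
      have hprune := prune_spec hb3 h3m hs₄ (by rw [h3e]; omega) (by rw [h3e]; exact h.le)
      rw [h3e, h3g, hseg3, ← hN] at hprune
      refine hprune.mono (by omega) ?_
      rintro s₅ ⟨hb5, h5m, h5w, h5e0, h5e, h5P, h5k, h5ev, h5s⟩
      have h3w : s₃.ivar vw = s₀.ivar vw := by rw [h3i, h2w]
      rw [h3w] at h5w
      refine ⟨⟨hb5, h5m, h5e0, h5e.trans h.le, fun _ => ?_, fun h0 => absurd (h5w.symm.trans h0) hw⟩,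
        ?_⟩
      · rw [h5P, h5k, h5s, h3i, h2k]
        refine hpr.prune ht0 ?_ h4net ?_
        · rcases ht with h6 | h6
          · exact h6.2
          · exact Or.inr h6.2.1.le
        · rw [hc4]; exact hc'
      · rw [searchPotential, h5w, if_neg hw]
        have h6 := card_le_isolated (P := P) (x := x) (d := d) ht0 h2t
        refine (add_le_add le_rfl ((min_le_left _ _).trans h6)).trans ?_
        set I := (isolated d t x P).card
        have h7 : (s₅.ivar ve).toNat + I = N := by omega
        rw [← h7, mul_add]
        exact add_le_add le_rfl (Nat.le_mul_of_pos_left _ (Nat.succ_pos _))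

end RealRAM

/-! ### Refining the clustering -/

namespace RealRAM

open KCenter RealRAM.Expr RealRAM.Prog

variable {d : ℕ} {n k : ℤ} {x : ℤ → ℕ → ℝ}

/-- Make the tentative center of the current point its center, unless `keep` holds. -/
def commitBody (keep : Expr Ty.int) : Prog :=
  seq (setI vp (loadI aL (varI vi))) <|
  cond keep skip (storeI aasg (varI vp) (loadI aasg' (varI vp)))

/-- Make the tentative centers of the points of the current segment their centers, unless `keep`
holds. -/
def commit (keep : Expr Ty.int) : Prog := forRange vi (varI vm) ve (commitBody keep)

theorem commit_spec {keep : Expr Ty.int} {P : ℤ → Prop} {s₀ : Store}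
    (hkeep : ∀ s, s.rarr = s₀.rarr → s.rvar = s₀.rvar →
      s.iarr aasg (s.ivar vp) = s₀.iarr aasg (s.ivar vp) →
      ((keep.eval s : ℤ) ≠ 0 ↔ P (s.ivar vp)))
    (hle : s₀.ivar vm ≤ s₀.ivar ve)
    (hinj : Set.InjOn (s₀.iarr aL) (Set.Ico (s₀.ivar vm) (s₀.ivar ve))) :
    Spec (RealRAM.commit keep) s₀
      ((s₀.ivar ve - s₀.ivar vm).toNat * ((commitBody keep).cost + 12) + 11)
      (fun s => (∀ p ∈ seg (s₀.iarr aL) (s₀.ivar vm) (s₀.ivar ve), ¬P p →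
          s.iarr aasg p = s₀.iarr aasg' p) ∧
        (∀ p, p ∉ seg (s₀.iarr aL) (s₀.ivar vm) (s₀.ivar ve) ∨ P p →
          s.iarr aasg p = s₀.iarr aasg p) ∧ Keeps [vi, vp] [aasg] s₀ s) := by
  have hkeeps : ∀ s, Agree (RealRAM.commit keep) s₀ s → Keeps [vi, vp] [aasg] s₀ s := fun s hs =>
    hs.keeps _ _ (by simp [RealRAM.commit, forRange, commitBody, WritesI])
      (by simp [RealRAM.commit, forRange, commitBody, WritesR])
      (by simp [RealRAM.commit, forRange, commitBody, KeepsRArr])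
      (by simp [RealRAM.commit, forRange, commitBody, WritesArr])
  have hfor := spec_forRange (s := s₀) (v := vi) (h := ve) (lo := varI vm)
    (body := commitBody keep) (z := s₀.ivar vm) (fun i s =>
      (∀ p ∈ seg (s₀.iarr aL) (s₀.ivar vm) i, ¬P p → s.iarr aasg p = s₀.iarr aasg' p) ∧
        (∀ p, p ∉ seg (s₀.iarr aL) (s₀.ivar vm) i ∨ P p → s.iarr aasg p = s₀.iarr aasg p))
    ⟨trivial, trivial, trivial⟩ (by simp [commitBody, WritesI]) (by simp [commitBody, WritesI])
    (by simp) rfl hle ?_ ?_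
  · exact hfor.mono (by simp [Expr.size]) fun s hs => ⟨hs.1.1, hs.1.2, hkeeps s hs.2⟩
  · refine ⟨fun p hp => ?_, fun p _ => rfl⟩
    obtain ⟨z, hz, _⟩ := mem_seg.1 hp
    omega
  · intro i s' hzi hie hvi hA hI
    have hK := hkeeps s' hA
    have hL : s'.iarr aL = s₀.iarr aL := hK.iarr _ (by simp)
    have hasg' : s'.iarr aasg' = s₀.iarr aasg' := hK.iarr _ (by simp)
    set q := s₀.iarr aL i with hq
    have hqs : q ∉ seg (s₀.iarr aL) (s₀.ivar vm) i := by
      rw [mem_seg]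
      -- The current point does not occur at an earlier position, so its center has not been changed
      -- yet and `keep` is evaluated on the original one.
      rintro ⟨z, hz, hzq⟩
      have := hinj (x₁ := z) (x₂ := i) ⟨hz.1, by omega⟩ ⟨hzi, hie⟩ hzq
      omega
    have hasg : s'.iarr aasg q = s₀.iarr aasg q := hI.2 q (Or.inl hqs)
    have hmem : ∀ p, p ∈ seg (s₀.iarr aL) (s₀.ivar vm) (i + 1) ↔
        p = q ∨ p ∈ seg (s₀.iarr aL) (s₀.ivar vm) i := by
      intro p
      simp only [mem_seg]
      constructor
      · rintro ⟨z, hz, rfl⟩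
        rcases (Int.lt_add_one_iff.1 hz.2).lt_or_eq with h6 | rfl
        · exact Or.inr ⟨z, ⟨hz.1, h6⟩, rfl⟩
        · exact Or.inl rfl
      · rintro (rfl | ⟨z, hz, rfl⟩)
        · exact ⟨i, by omega, rfl⟩
        · exact ⟨z, by omega, rfl⟩
    have hex : (commitBody keep).exec s' = (cond keep skip (storeI aasg (varI vp)
        (loadI aasg' (varI vp)))).exec (s'.setI vp q) := by
      rw [hq, ← hL, ← hvi]; rfl
    have hvp : (s'.setI vp q).ivar vp = q := by simp
    have hk : ((keep.eval (s'.setI vp q) : ℤ) ≠ 0 ↔ P q) := by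
      rw [← hvp]
      exact hkeep (s'.setI vp q) hK.rarr hK.rvar (by rw [hvp]; exact hasg)
    rw [hex]
    by_cases hP : P q
    · rw [exec_cond_of_ne (hk.2 hP)]
      refine ⟨fun p hp hPp => ?_, fun p hp => ?_⟩
      · rcases (hmem p).1 hp with rfl | h
        · exact absurd hP hPp
        · exact hI.1 p h hPp
      · refine hI.2 p (hp.imp (fun h h' => h ((hmem p).2 (Or.inr h'))) id)
    · rw [exec_cond_zero (not_not.1 fun h => hP (hk.1 h))]
      have hup : (((storeI aasg (varI vp) (loadI aasg' (varI vp))).exec (s'.setI vp q)).setI vi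
          (i + 1)).iarr aasg = Function.update (s'.iarr aasg) q (s₀.iarr aasg' q) := by
        rw [← hasg']; simp [exec, eval]
      rw [hup]
      refine ⟨fun p hp hPp => ?_, fun p hp => ?_⟩
      · by_cases hpq : p = q
        · rw [hpq, Function.update_self]
        · rw [Function.update_of_ne hpq]
          exact hI.1 p (((hmem p).1 hp).resolve_left hpq) hPp
      · have hpq : p ≠ q := by
          rintro rfl
          rcases hp with h | h
          · exact h ((hmem _).2 (Or.inl rfl))
          · exact hP h
        rw [Function.update_of_ne hpq]
        exact hI.2 p (hp.imp (fun h h' => h ((hmem p).2 (Or.inr h'))) id)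

/-- The squared distance of a point to its center. -/
noncomputable def Store.dist2 (s : Store) (d : ℕ) (p : ℤ) : ℝ := sqd d (s.pt p) (s.pt (s.iarr aasg p))

/-- The squared distance of the current point to its center. -/
def curDist2 (d : ℕ) : Expr Ty.real := sqdist d (varI vp) (loadI aasg (varI vp))

theorem curDist2_eval (d : ℕ) (s : Store) :
    ((curDist2 d).eval s : ℝ) = s.dist2 d (s.ivar vp) := by
  rw [curDist2, sqdist_eval]; rfl

/-- A clustering with at most `k` centers, which are the first `vm` points. Only the squared
distances of the points of the current segment to their centers may be greater than the value of
`rlo`, which is the square of a lower bound for twice the optimal radius. -/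
structure Refining (d : ℕ) (n k : ℤ) (x : ℤ → ℕ → ℝ) (b : ℕ) (R2 : ℝ) (s : Store) : Prop where
  base : Base n k x s
  nonneg : 0 ≤ s.ivar vm
  vm_le : s.ivar vm ≤ s.ivar ve
  ve_le : s.ivar ve ≤ n
  vm_le_k : s.ivar vm ≤ k
  table : s.Table d (s.ivar vm)
  near : ∀ p q, sqd d (x p) (x q) < R2 → s.Near d b p q
  same : ∀ p q, (∀ l < d, cell (s.rvar rg) (x p) l = cell (s.rvar rg) (x q) l) →
    sqd d (x p) (x q) < s.rvar rlo
  asg_mem : ∀ p ∈ Finset.Ico 0 n, s.iarr aasg p ∈ seg (s.iarr aL) 0 (s.ivar vm)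
  dist2_lt : ∀ p ∈ Finset.Ico 0 n, s.dist2 d p < R2
  inactive : ∀ z, 0 ≤ z → z < n → z < s.ivar vm ∨ s.ivar ve ≤ z →
    s.dist2 d (s.iarr aL z) ≤ s.rvar rlo
  apart : ∀ j, j < s.ivar vm → ∀ i, 0 ≤ i → i < j → ∀ z, s.ivar vm ≤ z → z < s.ivar ve →
    s.dist2 d (s.iarr aL z) ≤ sqd d (x (s.iarr aL j)) (x (s.iarr aL i))
  cert : ∃ S ⊆ Finset.Ico 0 n, k < S.card ∧ ∀ p ∈ S, ∀ q ∈ S, p ≠ q →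
    s.rvar rlo ≤ sqd d (x p) (x q)

/-- Remove the points with a small distance to their center from the current segment. -/
def sift (d : ℕ) : Prog :=
  seq (partition (ltR (varR rlo) (curDist2 d))) (setI ve (varI vb))

theorem sift_spec {b : ℕ} {R2 : ℝ} {s₀ : Store} (h : Refining d n k x b R2 s₀) :
    Spec (sift d) s₀ ((s₀.ivar ve - s₀.ivar vm).toNat *
        ((partitionBody (ltR (varR rlo) (curDist2 d))).cost + 12) + 20)
      (fun s => Refining d n k x b R2 s ∧
        (∀ z, s.ivar vm ≤ z → z < s.ivar ve → s.rvar rlo < s.dist2 d (s.iarr aL z)) ∧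
        s.ivar vm = s₀.ivar vm ∧ s.rvar = s₀.rvar ∧ s.iarr aasg = s₀.iarr aasg ∧
        seg (s.iarr aL) 0 (s.ivar vm) = seg (s₀.iarr aL) 0 (s₀.ivar vm) ∧
        ∀ p, p ∈ seg (s.iarr aL) (s.ivar vm) (s.ivar ve) ↔
          p ∈ seg (s₀.iarr aL) (s₀.ivar vm) (s₀.ivar ve) ∧ s₀.rvar rlo < s₀.dist2 d p) := by
  refine Spec.seq (partition_spec (P := fun p => s₀.rvar rlo < s₀.dist2 d p)
    (fun s h1 h2 h3 => ?_) h.vm_le) (c₂ := 3) ?_ (by omega)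
  · rw [ltR_ne_zero, curDist2_eval, Store.dist2, h3 aasg (by simp)]
    have hpt : s.pt = s₀.pt := by unfold Store.pt; rw [h1]
    simp only [eval, h2, Store.dist2, hpt]
  rintro s₁ ⟨⟨hsh, hb0, hbe, hkeep, hdrop⟩, hK⟩
  refine Spec.setI ?_ (by simp [Expr.size])
  set s := s₁.setI ve _ with hs
  have hvm : s.ivar vm = s₀.ivar vm := by
    rw [hs, Store.setI_ivar, if_neg (by simp), hK.ivar _ (by simp)]
  have hve : s.ivar ve = s₁.ivar vb := by simp [hs, eval]
  have hL : s.iarr aL = s₁.iarr aL := rfl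
  have hr : s.rvar = s₀.rvar := hK.rvar
  have hra : s.rarr = s₀.rarr := hK.rarr
  have hasg : s.iarr aasg = s₀.iarr aasg := hK.iarr aasg (by simp)
  have hT : s.iarr aT = s₀.iarr aT := hK.iarr aT (by simp)
  have hpt : s.pt = s₀.pt := by unfold Store.pt; rw [hra]
  have hd2 : s.dist2 d = s₀.dist2 d := by
    funext p; unfold Store.dist2; rw [hpt, hasg]
  have hbase : Base n k x s := h.base.of_shuffle hsh h.nonneg h.ve_le hra
    (by rw [hs, Store.setI_ivar, if_neg (by simp), hK.ivar _ (by simp)])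
    (by rw [hs, Store.setI_ivar, if_neg (by simp), hK.ivar _ (by simp)])
  have hout : ∀ z, z < s₀.ivar vm ∨ s₀.ivar ve ≤ z → s.iarr aL z = s₀.iarr aL z :=
    fun z hz => hsh.outside hz
  have hseg : seg (s.iarr aL) 0 (s.ivar vm) = seg (s₀.iarr aL) 0 (s₀.ivar vm) := by
    rw [hvm]; exact seg_congr fun z _ hz => hout z (Or.inl hz)
  have hin : ∀ z, s₀.ivar vm ≤ z → z < s₀.ivar ve → (z < s.ivar ve ↔
      s₀.rvar rlo < s₀.dist2 d (s.iarr aL z)) := by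
    intro z h1 h2
    rw [hve]
    refine ⟨hkeep z h1, fun h3 => ?_⟩
    by_contra h4
    exact hdrop z (not_lt.1 h4) h2 h3
  clear_value s
  refine ⟨⟨hbase, ?_, ?_, ?_, ?_, ?_, ?_, ?_, ?_, ?_, ?_, ?_, ?_⟩, ?_, hvm, hr, hasg, hseg, ?_⟩
  · rw [hvm]; exact h.nonneg
  · rw [hvm, hve]; exact hb0
  · rw [hve]; exact hbe.trans h.ve_le
  · rw [hvm]; exact h.vm_le_k
  · intro i h0 hi
    rw [hvm] at hi
    rw [hout i (Or.inl hi), hT, Store.key, hr, hpt]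
    exact h.table i h0 hi
  · intro p q hpq
    have := h.near p q hpq
    unfold Store.Near at this ⊢
    rwa [hr, hpt]
  · rw [hr]; exact h.same
  · rw [hasg, hseg]; exact h.asg_mem
  · rw [hd2]; exact h.dist2_lt
  · intro z h0 hz hzz
    rw [hd2, hr]
    by_cases h1 : z < s₀.ivar vm ∨ s₀.ivar ve ≤ z
    · rw [hout z h1]; exact h.inactive z h0 hz h1
    · push Not at h1
      refine not_lt.1 fun h2 => ?_
      have := (hin z h1.1 h1.2).2 h2
      omega
  · intro j hj i hi0 hij z hz0 hz
    rw [hvm] at hj hz0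
    rw [hout j (Or.inl hj), hout i (Or.inl (hij.trans hj)), hd2]
    obtain ⟨w, hw, hzw⟩ := hsh.inside (z := z) ⟨hz0, by omega⟩
    rw [hL, hzw]
    exact h.apart j hj i hi0 hij w hw.1 hw.2
  · rw [hr]; exact h.cert
  · intro z hz0 hz
    rw [hvm] at hz0
    rw [hr, hd2]
    exact (hin z hz0 (by omega)).1 hz
  · intro p
    rw [← hsh.seg_eq, mem_seg, mem_seg, ← hL, hvm]
    constructor
    · rintro ⟨z, hz, rfl⟩
      exact ⟨⟨z, ⟨hz.1, by omega⟩, rfl⟩, (hin z hz.1 (by omega)).1 hz.2⟩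
    · rintro ⟨⟨z, hz, rfl⟩, h2⟩
      exact ⟨z, ⟨hz.1, (hin z hz.1 hz.2).2 h2⟩, rfl⟩

end RealRAM

/-! ### Accepting a tentative clustering. -/

namespace RealRAM

open KCenter RealRAM.Expr RealRAM.Prog

variable {d : ℕ} {n k : ℤ} {x : ℤ → ℕ → ℝ}

/-- Make the tentative clustering the current one. -/
def accept (keep : Expr Ty.int) : Prog := seq (commit keep) (setI vm (varI vc))

/-- After a covering pass with threshold `m`, all points of the segment have a center within squared
distance less than `m`, while the centers are pairwise at least `m` apart: the old ones by `hap`,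
the new ones by the greedy choice. Both facts together restore the invariant `apart`. The points for
which `keep` holds retain their center. -/
theorem accept_spec {keep : Expr Ty.int} {P : ℤ → Prop} {b : ℕ} {R2 m lo : ℝ} {s₀ s₁ : Store}
    (hbase : Base n k x s₀) (h0 : 0 ≤ s₀.ivar vm) (hme : s₀.ivar vm ≤ s₀.ivar ve)
    (hen : s₀.ivar ve ≤ n) (hlo : s₀.rvar rlo = lo)
    (hcov : Covered d b P (fun p q => sqd d (x p) (x q) < m) (s₀.ivar ve) s₀ s₁)
    (hK : Keeps [vi, vc, vp, vt, vj, vq, vf] [aL, aasg', aT, anear] s₀ s₁)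
    (hc : s₁.ivar vc ≤ k) (hnear : ∀ p q, sqd d (x p) (x q) < R2 → s₀.Near d b p q)
    (hsame : ∀ p q, (∀ l < d, cell (s₀.rvar rg) (x p) l = cell (s₀.rvar rg) (x q) l) →
      sqd d (x p) (x q) < lo) (hmR : m ≤ R2) (hlm : lo < m)
    (hP : ∀ p ∈ seg (s₀.iarr aL) (s₀.ivar vm) (s₀.ivar ve), P p →
      s₀.dist2 d p < m ∧ s₀.iarr aasg p ∈ seg (s₀.iarr aL) 0 (s₀.ivar vm))
    (hin : ∀ z, 0 ≤ z → z < n → z < s₀.ivar vm ∨ s₀.ivar ve ≤ z →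
      s₀.dist2 d (s₀.iarr aL z) ≤ lo ∧
      s₀.iarr aasg (s₀.iarr aL z) ∈ seg (s₀.iarr aL) 0 (s₀.ivar vm))
    (hap : ∀ j, j < s₀.ivar vm → ∀ i, 0 ≤ i → i < j →
      m ≤ sqd d (x (s₀.iarr aL j)) (x (s₀.iarr aL i)))
    (hcert : ∃ S ⊆ Finset.Ico 0 n, k < S.card ∧ ∀ p ∈ S, ∀ q ∈ S, p ≠ q → lo ≤ sqd d (x p) (x q))
    (hkeep : ∀ s, s.rarr = s₁.rarr → s.rvar = s₁.rvar →
      s.iarr aasg (s.ivar vp) = s₁.iarr aasg (s.ivar vp) →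
      ((keep.eval s : ℤ) ≠ 0 ↔ P (s.ivar vp))) :
    Spec (accept keep) s₁ ((s₀.ivar ve - s₀.ivar vm).toNat * ((commitBody keep).cost + 12) + 14)
      (fun s => Refining d n k x b R2 s ∧ s.ivar vm = s₁.ivar vc ∧ s.ivar ve = s₀.ivar ve ∧
        s.rvar = s₀.rvar ∧ s.iarr aL = s₁.iarr aL ∧
        (∀ p ∈ seg (s₀.iarr aL) (s₀.ivar vm) (s₀.ivar ve), s.dist2 d p < m) ∧
        ∀ p, p ∉ seg (s₀.iarr aL) (s₀.ivar vm) (s₀.ivar ve) ∨ P p →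
          s.iarr aasg p = s₀.iarr aasg p) := by
  have h1m : s₁.ivar vm = s₀.ivar vm := hK.ivar _ (by simp)
  have h1e : s₁.ivar ve = s₀.ivar ve := hK.ivar _ (by simp)
  have h1asg : s₁.iarr aasg = s₀.iarr aasg := hK.iarr _ (by simp)
  have hsh := hcov.shuffle
  have hb1 : Base n k x s₁ := hbase.of_shuffle hsh h0 hen hK.rarr (hK.ivar _ (by simp))
    (hK.ivar _ (by simp))
  set L := s₁.iarr aL with hL
  have hseg : seg L (s₀.ivar vm) (s₀.ivar ve) = seg (s₀.iarr aL) (s₀.ivar vm) (s₀.ivar ve) :=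
    hsh.seg_eq
  have hseg0 : seg L 0 (s₀.ivar vm) = seg (s₀.iarr aL) 0 (s₀.ivar vm) :=
    seg_congr fun z _ hz => hsh.outside (Or.inl hz)
  have hcommit := commit_spec (s₀ := s₁) hkeep (by rw [h1m, h1e]; exact hme)
    (by rw [h1m, h1e]; exact hb1.inj.mono (Set.Ico_subset_Ico h0 hen))
  rw [h1m, h1e, ← hL, hseg] at hcommit
  refine Spec.seq hcommit (c₂ := 2) ?_ (by omega)
  rintro s₂ ⟨hc1, hc2, hK2⟩
  refine Spec.setI ?_ (by simp [Expr.size])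
  rw [h1asg] at hc2
  set s := s₂.setI vm _ with hs
  have hsm : s.ivar vm = s₁.ivar vc := by
    rw [hs, Store.setI_ivar, if_pos rfl]; exact hK2.ivar _ (by simp)
  have hse : s.ivar ve = s₀.ivar ve := by
    rw [hs, Store.setI_ivar, if_neg (by simp), hK2.ivar _ (by simp), h1e]
  have hsr : s.rvar = s₀.rvar := hK2.rvar.trans hK.rvar
  have hsra : s.rarr = s₀.rarr := hK2.rarr.trans hK.rarr
  have hsL : s.iarr aL = L := hK2.iarr aL (by simp)
  have hsT : s.iarr aT = s₁.iarr aT := hK2.iarr aT (by simp)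
  have hsb : Base n k x s := hb1.of_eq hsL hK2.rarr
    (by rw [hs, Store.setI_ivar, if_neg (by simp), hK2.ivar _ (by simp)])
    (by rw [hs, Store.setI_ivar, if_neg (by simp), hK2.ivar _ (by simp)])
  change (∀ p ∈ seg (s₀.iarr aL) (s₀.ivar vm) (s₀.ivar ve), ¬P p →
          s.iarr aasg p = s₁.iarr aasg' p) at hc1
  change (∀ p, p ∉ seg (s₀.iarr aL) (s₀.ivar vm) (s₀.ivar ve) ∨ P p →
          s.iarr aasg p = s₀.iarr aasg p) at hc2
  clear_value s
  have h1c := hcov.le_count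
  have h1ce := hcov.count_le
  have hnear1 : ∀ p q, sqd d (x p) (x q) < R2 → s₁.Near d b p q := by
    intro p q hpq
    have := hnear p q hpq
    unfold Store.Near at this ⊢
    rwa [hK.rvar, hK.pt]
  have hlo0 : 0 < lo := by
    -- A point lies in its own cell, so `hsame` forces `lo` to be positive.
    have := hsame 0 0 fun _ _ => rfl
    rwa [sqd_self] at this
  have hd2 : ∀ p, s.dist2 d p = sqd d (x p) (x (s.iarr aasg p)) := fun p => by
    unfold Store.dist2; rw [hsb.pt]
  have hd0 : ∀ p, s₀.dist2 d p = sqd d (x p) (x (s₀.iarr aasg p)) := fun p => by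
    unfold Store.dist2; rw [hbase.pt]
  have hfar : ∀ j, s₀.ivar vm ≤ j → j < s₁.ivar vc → ∀ i, 0 ≤ i → i < j →
      m ≤ sqd d (x (L j)) (x (L i)) := by
    intro j hj0 hj i hi0 hij
    refine not_lt.1 fun h => hcov.apart j hj0 hj i hi0 hij ⟨hnear1 _ _ (h.trans_le hmR), h⟩
  have hnewasg : ∀ z, s₀.ivar vm ≤ z → z < s₀.ivar ve → ¬P (L z) → ∃ j, 0 ≤ j ∧ j < s₁.ivar vc ∧
      s.iarr aasg (L z) = L j ∧ (L j = L z ∨ sqd d (x (L z)) (x (L j)) < m) := by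
    intro z h1 h2 h3
    rcases hcov.cov z h1 h2 with ⟨h4, _⟩ | ⟨j, hj0, hj, h4, h5⟩
    · exact absurd h4 h3
    · refine ⟨j, hj0, hj, ?_, h5.imp id fun h6 => h6.2⟩
      rw [hc1 _ (by rw [← hseg]; exact seg_mem h1 h2) h3]
      exact h4
  have hact : ∀ z, s₀.ivar vm ≤ z → z < s₀.ivar ve → s.dist2 d (L z) < m ∧
      s.iarr aasg (L z) ∈ seg L 0 (s₁.ivar vc) := by
    intro z h1 h2
    rw [hd2]
    by_cases h3 : P (L z)
    · rw [hc2 _ (Or.inr h3), ← hd0]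
      obtain ⟨h4, h5⟩ := hP _ (by rw [← hseg]; exact seg_mem h1 h2) h3
      rw [← hseg0] at h5
      exact ⟨h4, seg_subset le_rfl h1c h5⟩
    · obtain ⟨j, hj0, hj, h4, h5⟩ := hnewasg z h1 h2 h3
      rw [h4]
      refine ⟨?_, seg_mem hj0 hj⟩
      rcases h5 with h5 | h5
      · rw [h5, sqd_self]; exact hlo0.trans hlm
      · exact h5
  have hinact : ∀ z, 0 ≤ z → z < n → z < s₀.ivar vm ∨ s₀.ivar ve ≤ z →
      s.dist2 d (L z) ≤ lo ∧ s.iarr aasg (L z) ∈ seg L 0 (s₁.ivar vc) := by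
    intro z h1 h2 h3
    have h4 : L z ∉ seg (s₀.iarr aL) (s₀.ivar vm) (s₀.ivar ve) := by
      rw [← hseg, mem_seg]
      rintro ⟨w, hw, hwz⟩
      have := hb1.inj (x₁ := w) (x₂ := z) ⟨by omega, by omega⟩ ⟨h1, h2⟩ hwz
      omega
    have h5 := hin z h1 h2 h3
    rw [hd2, hc2 _ (Or.inl h4), ← hd0, hsh.outside h3]
    rw [← hseg0] at h5
    exact ⟨h5.1, seg_subset le_rfl h1c h5.2⟩
  refine ⟨⟨hsb, ?_, ?_, ?_, ?_, ?_, ?_, ?_, ?_, ?_, ?_, ?_, ?_⟩, hsm, hse, hsr, hsL, ?_, hc2⟩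
  · rw [hsm]; omega
  · rw [hsm, hse]; exact h1ce
  · rw [hse]; exact hen
  · rw [hsm]; exact hc
  · rw [hsm]
    intro i hi0 hi
    have ht := hcov.table i hi0 hi
    unfold Store.key at ht ⊢
    rw [hK.rvar, hb1.pt] at ht
    rw [hsL, hsT, hsr, hsb.pt]
    exact ht
  · intro p q hpq
    have := hnear p q hpq
    unfold Store.Near at this ⊢
    rwa [hsr, hsb.pt, ← hbase.pt]
  · rw [hsr, hlo]; exact hsame
  · intro p hp
    rw [hsL, hsm]
    rw [← hb1.seg_eq] at hp
    obtain ⟨z, hz, rfl⟩ := mem_seg.1 hp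
    by_cases h3 : z < s₀.ivar vm ∨ s₀.ivar ve ≤ z
    · exact (hinact z hz.1 hz.2 h3).2
    · push Not at h3
      exact (hact z h3.1 h3.2).2
  · intro p hp
    rw [← hb1.seg_eq] at hp
    obtain ⟨z, hz, rfl⟩ := mem_seg.1 hp
    by_cases h3 : z < s₀.ivar vm ∨ s₀.ivar ve ≤ z
    · exact (hinact z hz.1 hz.2 h3).1.trans_lt (hlm.trans_le hmR)
    · push Not at h3
      exact (hact z h3.1 h3.2).1.trans_le hmR
  · intro z hz0 hz hzz
    rw [hsm, hse] at hzz
    rw [hsL, hsr, hlo]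
    by_cases h3 : z < s₀.ivar vm ∨ s₀.ivar ve ≤ z
    · exact (hinact z hz0 hz h3).1
    · push Not at h3
      obtain ⟨j, hj0, hj, h4, h5⟩ := hnewasg z h3.1 h3.2 (hcov.not_pre z h3.1 (by omega))
      -- A new center is assigned to itself: another center would be at squared distance at least
      -- `m`, whereas assignments are closer. So it may leave the active segment.
      have hjz : j = z := by
        rcases lt_trichotomy j z with h6 | h6 | h6
        · rcases h5 with h5 | h5
          · exact hb1.inj ⟨hj0, by omega⟩ ⟨hz0, hz⟩ h5
          · exact absurd h5 (not_lt.2 (hfar z h3.1 (by omega) j hj0 h6))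
        · exact h6
        · rcases h5 with h5 | h5
          · exact hb1.inj ⟨hj0, by omega⟩ ⟨hz0, hz⟩ h5
          · rw [sqd_comm] at h5
            exact absurd h5 (not_lt.2 (hfar j (by omega) hj z hz0 h6))
      rw [hd2, h4, hjz, sqd_self]
      exact hlo0.le
  · intro j hj i hi0 hij z hz0 hz
    rw [hsm] at hj hz0
    rw [hse] at hz
    rw [hsL]
    refine (hact z (by omega) hz).1.le.trans ?_
    by_cases h6 : j < s₀.ivar vm
    · rw [hsh.outside (Or.inl h6), hsh.outside (Or.inl (hij.trans h6))]
      exact hap j h6 i hi0 hij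
    · exact hfar j (not_lt.1 h6) hj i hi0 hij
  · rw [hsr, hlo]; exact hcert
  · intro p hp
    rw [← hseg] at hp
    obtain ⟨z, hz, rfl⟩ := mem_seg.1 hp
    exact (hact z hz.1 hz.2).1

end RealRAM

/-! ### The potential of the refinement, and one round of it. -/

namespace KCenter

/-- A unit is lost for each element of `A` with `Q`: if it leaves the set, its whole summand
disappears, which is at least 1; if it stays, its summand decreases. -/
theorem sum_add_card_le {A A' : Finset ℤ} {f f' : ℤ → ℕ} (Q : ℤ → Prop) [DecidablePred Q]
    (hA : A' ⊆ A) (hf : ∀ p ∈ A, 1 ≤ f p) (hf' : ∀ p ∈ A', f' p + (if Q p then 1 else 0) ≤ f p) :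
    ∑ p ∈ A', f' p + (A.filter Q).card ≤ ∑ p ∈ A, f p := by
  rw [Finset.card_filter, ← Finset.sum_sdiff hA, ← Finset.sum_sdiff hA, add_left_comm,
    ← Finset.sum_add_distrib]
  refine add_le_add (Finset.sum_le_sum fun p hp => ?_) (Finset.sum_le_sum hf')
  have := hf p (Finset.sdiff_subset hp)
  split_ifs <;> omega

end KCenter

namespace RealRAM

open KCenter RealRAM.Expr RealRAM.Prog

variable {d : ℕ} {n k : ℤ} {x : ℤ → ℕ → ℝ}

open scoped Classical in
/-- The centers that are not closer to the point `p` than its own one, but near it. -/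
noncomputable def Store.others (s : Store) (d : ℕ) (R2 : ℝ) (p : ℤ) : Finset ℤ :=
  (seg (s.iarr aL) 0 (s.ivar vm)).filter fun c =>
    s.dist2 d p ≤ sqd d (s.pt p) (s.pt c) ∧ sqd d (s.pt p) (s.pt c) < R2

open scoped Classical in
/-- The potential of the refinement. -/
noncomputable def refinePotential (d b : ℕ) (R2 : ℝ) (s : Store) : ℕ :=
  ∑ p ∈ (seg (s.iarr aL) (s.ivar vm) (s.ivar ve)).filter fun p => s.rvar rlo < s.dist2 d p,
    ((2 * b + 1) ^ d + 1 - (s.others d R2 p).card)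

/-- Centers within the initial radius lie in the bounded grid neighborhood given by `near`, and the
table invariant puts distinct centers into distinct cells. -/
theorem Refining.card_others_le {b : ℕ} {R2 : ℝ} {s : Store} (h : Refining d n k x b R2 s) (p : ℤ) :
    (s.others d R2 p).card ≤ (2 * b + 1) ^ d := by
  classical
  refine card_le_of_near (b := b) (d := d) _ (fun c => cell (s.rvar rg) (s.pt c))
    (cell (s.rvar rg) (s.pt p)) (fun c hc => ?_) fun c hc c' hc' hcc => ?_
  · simp only [Store.others, Finset.mem_filter] at hc
    have := hc.2.2
    rw [h.base.pt] at this
    exact h.near _ _ this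
  · simp only [Store.others, Finset.mem_filter] at hc hc'
    obtain ⟨i, hi, rfl⟩ := mem_seg.1 hc.1
    obtain ⟨j, hj, rfl⟩ := mem_seg.1 hc'.1
    rw [← h.table i hi.1 hi.2, ← h.table j hj.1 hj.2]
    unfold Store.key
    rw [key_inj.2 hcc]

/-- The loop invariant of the refinement. -/
structure Active (d : ℕ) (n k : ℤ) (x : ℤ → ℕ → ℝ) (b : ℕ) (R2 : ℝ) (s : Store) : Prop where
  refining : Refining d n k x b R2 s
  lt : ∀ z, s.ivar vm ≤ z → z < s.ivar ve → s.rvar rlo < s.dist2 d (s.iarr aL z)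

theorem Active.potential_eq {b : ℕ} {R2 : ℝ} {s : Store} (h : Active d n k x b R2 s) :
    refinePotential d b R2 s = ∑ p ∈ seg (s.iarr aL) (s.ivar vm) (s.ivar ve),
      ((2 * b + 1) ^ d + 1 - (s.others d R2 p).card) := by
  classical
  rw [refinePotential, Finset.filter_true_of_mem]
  intro p hp
  obtain ⟨z, hz, rfl⟩ := mem_seg.1 hp
  exact h.lt z hz.1 hz.2

/-- The potential counts only points above the certified bound, so removing the others does not
change it. -/
theorem sift_spec' {b : ℕ} {R2 : ℝ} {s₀ : Store} (h : Refining d n k x b R2 s₀) :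
    Spec (sift d) s₀ ((s₀.ivar ve - s₀.ivar vm).toNat *
        ((partitionBody (ltR (varR rlo) (curDist2 d))).cost + 12) + 20)
      (fun s => Active d n k x b R2 s ∧ refinePotential d b R2 s = refinePotential d b R2 s₀) := by
  classical
  refine (sift_spec h).mono le_rfl ?_
  rintro s ⟨h1, h2, h3, h4, h5, h6, h7⟩
  have hA : Active d n k x b R2 s := ⟨h1, h2⟩
  have hd : s.dist2 d = s₀.dist2 d := by
    funext p; unfold Store.dist2; rw [h1.base.pt, h.base.pt, h5]
  have ho : ∀ p, s.others d R2 p = s₀.others d R2 p := by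
    intro p
    unfold Store.others
    rw [h6, hd, h1.base.pt, h.base.pt]
  refine ⟨hA, ?_⟩
  rw [hA.potential_eq, refinePotential]
  refine Finset.sum_congr ?_ fun p _ => by rw [ho]
  ext p
  rw [h7, Finset.mem_filter]

/-- One round of the refinement, for the point with a sampled index. -/
def refineRound (d b : ℕ) : Prog :=
  seq (setI vp (loadI aL (addI (varI vm) (varI vu)))) <|
  seq (setR rm (curDist2 d)) <|
  seq (RealRAM.cover d b (ltR (curDist2 d) (varR rm)) (ltR (sqdist d (varI vp) (varI vq)) (varR rm))) <|
  seq (cond (leI (varI vc) (varI vk)) (accept (ltR (curDist2 d) (varR rm))) (setR rlo (varR rm)))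
    (sift d)

/-- A bound for the cost of one round per point. -/
def refineCost (d b : ℕ) : ℕ :=
  (coverBody d b (ltR (curDist2 d) (varR rm)) (ltR (sqdist d (varI vp) (varI vq)) (varR rm))).cost +
  12 + ((commitBody (ltR (curDist2 d) (varR rm))).cost + 12) +
  ((partitionBody (ltR (varR rlo) (curDist2 d))).cost + 12) + (curDist2 d).size + 200

/-- If the centers suffice, every point with squared distance at least `m` gets a strictly closer
center and its term drops. If they do not, the certified bound rises to `m`, and every point with
squared distance at most `m` stops being counted. Either way the drop is at least the smaller of the
two counts. -/
theorem refineRound_spec {b : ℕ} {R2 : ℝ} {s₀ : Store} {r : ℕ} (h : Active d n k x b R2 s₀)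
    (hr : r < (s₀.ivar ve - s₀.ivar vm).toNat) :
    Spec (refineRound d b) (s₀.setI vu r) (refineCost d b * (s₀.ivar ve - s₀.ivar vm).toNat)
      (fun s => Active d n k x b R2 s ∧ refinePotential d b R2 s +
        min ((Finset.range (s₀.ivar ve - s₀.ivar vm).toNat).filter fun j : ℕ =>
            s₀.dist2 d (s₀.iarr aL (s₀.ivar vm + r)) ≤
              s₀.dist2 d (s₀.iarr aL (s₀.ivar vm + j))).card
          ((Finset.range (s₀.ivar ve - s₀.ivar vm).toNat).filter fun j : ℕ =>
            s₀.dist2 d (s₀.iarr aL (s₀.ivar vm + j)) ≤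
              s₀.dist2 d (s₀.iarr aL (s₀.ivar vm + r))).card ≤ refinePotential d b R2 s₀) := by
  classical
  have hR := h.refining
  have hb := hR.base
  set L := s₀.iarr aL with hL
  set a := s₀.ivar vm with ha
  set e := s₀.ivar ve with he
  set m := s₀.dist2 d (L (a + r)) with hm
  set N := (e - a).toNat with hN
  have hinj : Set.InjOn L (Set.Ico a e) := hb.inj.mono (Set.Ico_subset_Ico hR.nonneg hR.ve_le)
  have hΦ := h.potential_eq
  rw [← hL, ← ha, ← he] at hΦ
  set P := seg L a e with hP
  have hlm : s₀.rvar rlo < m := h.lt _ (by omega) (by omega)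
  have hPn : ∀ p ∈ P, p ∈ Finset.Ico 0 n := fun p hp => by
    rw [← hb.seg_eq]; exact seg_subset hR.nonneg hR.ve_le hp
  have hmR : m < R2 := hR.dist2_lt _ (hPn _ (seg_mem (by omega) (by omega)))
  have hfil : ∀ p : ℤ → Prop, ((Finset.range N).filter fun j : ℕ => p (L (a + j))).card =
      (P.filter p).card := by
    intro p
    have hinj' : Set.InjOn (fun z => L (a + z)) (Set.Ico 0 (e - a)) := by
      intro z hz w hw hzw
      have := hinj (x₁ := a + z) (x₂ := a + w) ⟨by linarith [hz.1], by linarith [hz.2]⟩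
        ⟨by linarith [hw.1], by linarith [hw.2]⟩ hzw
      linarith
    rw [hN, card_filter_range_seg (p := p) hinj']
    congr 2
    ext q
    rw [mem_seg, hP, mem_seg]
    constructor
    · rintro ⟨z, hz, rfl⟩
      exact ⟨a + z, by omega, rfl⟩
    · rintro ⟨z, hz, rfl⟩
      exact ⟨z - a, by omega, by simp⟩
  rw [hfil fun p => m ≤ s₀.dist2 d p, hfil fun p => s₀.dist2 d p ≤ m]
  set B := N * ((coverBody d b (ltR (curDist2 d) (varR rm))
    (ltR (sqdist d (varI vp) (varI vq)) (varR rm))).cost + 12) with hB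
  set M := N * ((commitBody (ltR (curDist2 d) (varR rm))).cost + 12) with hM
  set Q := N * ((partitionBody (ltR (varR rlo) (curDist2 d))).cost + 12) with hQ
  have hcost : B + M + Q + (curDist2 d).size + 200 ≤ refineCost d b * N := by
    have h1 : refineCost d b * N = B + M + Q + (curDist2 d).size * N + 200 * N := by
      rw [refineCost, hB, hM, hQ]; ring
    have h2 : (curDist2 d).size * 1 ≤ (curDist2 d).size * N := Nat.mul_le_mul_left _ (by omega)
    omega
  refine Spec.setI_seq (c₂ := B + M + Q + (curDist2 d).size + 190) ?_
    (by simp only [Expr.size]; omega)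
  refine Spec.setR_seq (c₂ := B + M + Q + 180) ?_ (by omega)
  set s₁ := Store.setR _ rm _ with hs₁
  have h1i : ∀ y, y ≠ vu → y ≠ vp → s₁.ivar y = s₀.ivar y := by
    intro y hy1 hy2
    rw [hs₁, Store.setR_ivar, Store.setI_ivar, if_neg hy2, Store.setI_ivar, if_neg hy1]
  have h1m : s₁.rvar rm = m := by
    rw [hs₁, Store.setR_rvar, if_pos rfl, curDist2_eval, Store.setI_ivar, if_pos rfl, hm]
    simp only [eval, Store.setI_ivar]
    rfl
  have h1r : ∀ y, y ≠ rm → s₁.rvar y = s₀.rvar y := by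
    intro y hy
    rw [hs₁, Store.setR_rvar, if_neg hy]; rfl
  have h1a : s₁.iarr = s₀.iarr := rfl
  have h1ra : s₁.rarr = s₀.rarr := rfl
  clear_value s₁
  have h1vm : s₁.ivar vm = a := h1i _ (by simp) (by simp)
  have h1ve : s₁.ivar ve = e := h1i _ (by simp) (by simp)
  have h1g : s₁.rvar rg = s₀.rvar rg := h1r _ (by simp)
  have h1lo : s₁.rvar rlo = s₀.rvar rlo := h1r _ (by simp)
  have hpt1 : s₁.pt = s₀.pt := by unfold Store.pt; rw [h1ra]
  have hd1 : s₁.dist2 d = s₀.dist2 d := by funext p; unfold Store.dist2; rw [hpt1, h1a]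
  have hb1 : Base n k x s₁ := hb.of_eq (by rw [h1a]) h1ra (h1i _ (by simp) (by simp))
    (h1i _ (by simp) (by simp))
  have htab1 : s₁.Table d (s₁.ivar vm) := by
    rw [h1vm]
    intro i hi0 hi
    unfold Store.key
    rw [h1a, h1g, hpt1]
    exact hR.table i hi0 hi
  have hpre : ∀ s : Store, s.rarr = s₁.rarr → s.rvar = s₁.rvar →
      s.iarr aasg (s.ivar vp) = s₁.iarr aasg (s.ivar vp) →
      (((ltR (curDist2 d) (varR rm)).eval s : ℤ) ≠ 0 ↔ s₀.dist2 d (s.ivar vp) < m) := by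
    intro s hs1 hs2 hs3
    have hpts : s.pt = s₁.pt := by unfold Store.pt; rw [hs1]
    rw [ltR_ne_zero, curDist2_eval, Store.dist2, hs3, ← hd1, Store.dist2, hpts]
    simp only [eval, hs2, h1m]
  have hsame1 : ∀ p q, (∀ l < d, cell (s₁.rvar rg) (x p) l = cell (s₁.rvar rg) (x q) l) →
      sqd d (x p) (x q) < s₀.rvar rlo := by rw [h1g]; exact hR.same
  have hnear1 : ∀ p q, sqd d (x p) (x q) < R2 → s₁.Near d b p q := by
    intro p q hpq
    have := hR.near p q hpq
    unfold Store.Near at this ⊢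
    rwa [h1g, hpt1]
  have hcover := cover_spec (d := d) (b := b) (s₀ := s₁) (P := fun p => s₀.dist2 d p < m)
    (T := fun p q => sqd d (x p) (x q) < m) (pre := ltR (curDist2 d) (varR rm))
    (test := ltR (sqdist d (varI vp) (varI vq)) (varR rm))
    (fun s hs1 hs2 hs3 => hpre s hs1 hs2 (by rw [hs3])) (fun s hs1 hs2 => by
      have hpts : s.pt = s₁.pt := by unfold Store.pt; rw [hs1]
      rw [ltR_ne_zero, sqdist_eval, hpts, hb1.pt]
      simp only [eval, hs2, h1m]) (fun p q hpq => by
        rw [hb1.pt] at hpq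
        exact (hsame1 p q hpq).trans hlm) (by rw [h1vm]; exact hR.nonneg)
    (by rw [h1vm, h1ve]; exact hR.vm_le)
    (by rw [h1vm, h1ve, h1a]; exact hinj) htab1
  rw [h1vm, h1ve, ← hN] at hcover
  refine Spec.seq hcover (c₂ := M + Q + 100) ?_ (by omega)
  rintro s₂ ⟨hcov, hK⟩
  have h2k : s₂.ivar vk = k := by rw [hK.ivar _ (by simp), hb1.vk_eq]
  have hsh := hcov.shuffle
  rw [h1vm, h1a] at hsh
  have hapm : ∀ j, j < a → ∀ i, 0 ≤ i → i < j → m ≤ sqd d (x (L j)) (x (L i)) :=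
    fun j hj i hi0 hij => hR.apart j hj i hi0 hij _ (by omega) (by omega)
  have hcle := hcov.le_count
  have hce := hcov.count_le
  rw [h1vm] at hcle
  have hone : ∀ p ∈ P, 1 ≤ (2 * b + 1) ^ d + 1 - (s₀.others d R2 p).card := fun p _ => by
    have := hR.card_others_le p; omega
  refine Spec.seq (c₁ := M + 30) (c₂ := Q + 20) (Q := fun s => Refining d n k x b R2 s ∧
    refinePotential d b R2 s + min (P.filter fun p => m ≤ s₀.dist2 d p).card
      (P.filter fun p => s₀.dist2 d p ≤ m).card ≤ refinePotential d b R2 s₀ ∧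
      (s.ivar ve - s.ivar vm).toNat ≤ N) ?_ ?_ (by omega)
  swap
  · rintro s ⟨hs1, hs2, hs3⟩
    refine (sift_spec' hs1).mono ?_ ?_
    · have := Nat.mul_le_mul_right ((partitionBody (ltR (varR rlo) (curDist2 d))).cost + 12) hs3
      omega
    · rintro s' ⟨hs4, hs5⟩
      rw [hs5]
      exact ⟨hs4, hs2⟩
  refine Spec.cond (c₁ := M + 20) (fun hc => ?_) (fun hc => ?_) (by simp only [Expr.size]; omega)
  · replace hc : s₂.ivar vc ≤ k := by
      rw [← h2k]
      exact leI_ne_zero.1 hc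
    have hacc := accept_spec (keep := ltR (curDist2 d) (varR rm)) (R2 := R2) (lo := s₀.rvar rlo) hb1
      (by rw [h1vm]; exact hR.nonneg) (by rw [h1vm, h1ve]; exact hR.vm_le)
      (by rw [h1ve]; exact hR.ve_le) h1lo (by rw [h1ve]; exact hcov) hK hc hnear1 hsame1 hmR.le hlm
      (by
        rw [h1vm, h1ve, h1a, hd1]
        exact fun p hp hpm => ⟨hpm, hR.asg_mem p (hPn p hp)⟩)
      (by
        rw [h1vm, h1ve, h1a, hd1]
        refine fun z hz0 hz hzz => ⟨hR.inactive z hz0 hz hzz, hR.asg_mem _ ?_⟩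
        rw [← hb.seg_eq]; exact seg_mem hz0 hz)
      (by rw [h1vm, h1a]; exact hapm) hR.cert
      (fun s hs1 hs2 hs3 => hpre s (hs1.trans hK.rarr) (hs2.trans hK.rvar)
        (by rw [hs3, hK.iarr _ (by simp)]))
    rw [h1vm, h1ve, h1a, ← hN] at hacc
    refine hacc.mono (by omega) ?_
    rintro s₃ ⟨hR3, h3m, h3e, h3r, h3L, h3d, h3asg⟩
    refine ⟨hR3, ?_, by rw [h3m, h3e]; omega⟩
    refine (add_le_add le_rfl (min_le_left _ _)).trans ?_
    rw [hΦ, refinePotential]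
    refine sum_add_card_le _ ?_ hone ?_
    · refine (Finset.filter_subset _ _).trans ?_
      rw [h3m, h3e, h3L, hP, ← hsh.seg_eq]
      exact seg_subset hcle le_rfl
    · intro p hp
      have hp' : p ∈ P := by
        have := (Finset.mem_filter.1 hp).1
        rw [h3m, h3e, h3L] at this
        rw [hP, ← hsh.seg_eq]
        exact seg_subset hcle le_rfl this
      have h4 := hR3.card_others_le p
      have h5 := hR.card_others_le p
      have h7 : seg L 0 a ⊆ seg (s₃.iarr aL) 0 (s₃.ivar vm) := by
        rw [h3m, h3L, ← seg_congr (L := L) (L' := s₂.iarr aL) fun z _ hz => hsh.outside (Or.inl hz)]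
        exact seg_subset le_rfl hcle
      -- Centers are only added, so the set `others` can only grow as long as the point does not get
      -- farther from its own center.
      have h8 : s₃.dist2 d p ≤ s₀.dist2 d p → s₀.others d R2 p ⊆ s₃.others d R2 p := by
        intro h8 c hc
        simp only [Store.others, Finset.mem_filter] at hc ⊢
        rw [hR3.base.pt, ← hb.pt]
        exact ⟨h7 hc.1, h8.trans hc.2.1, hc.2.2⟩
      split_ifs with h6
      · have h9 : s₃.dist2 d p < s₀.dist2 d p := (h3d p hp').trans_le h6
        -- The new center of `p` belongs to the new set. It is not in the old one, because it is
        -- closer than the old center.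
        have h10 : insert (s₃.iarr aasg p) (s₀.others d R2 p) ⊆ s₃.others d R2 p := by
          refine Finset.insert_subset ?_ (h8 h9.le)
          simp only [Store.others, Finset.mem_filter]
          exact ⟨hR3.asg_mem p (hPn p hp'), le_rfl, hR3.dist2_lt p (hPn p hp')⟩
        have h11 := Finset.card_le_card h10
        rw [Finset.card_insert_of_notMem] at h11
        · omega
        · intro h12
          simp only [Store.others, Finset.mem_filter] at h12
          refine absurd h12.2.1 (not_le.2 (lt_of_eq_of_lt ?_ h9))
          unfold Store.dist2
          rw [hR3.base.pt, ← hb.pt]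
      · have h9 : s₃.dist2 d p = s₀.dist2 d p := by
          unfold Store.dist2
          rw [hR3.base.pt, ← hb.pt, h3asg p (Or.inr (not_le.1 h6))]
        have h10 := Finset.card_le_card (h8 h9.le)
        omega
  · replace hc : k < s₂.ivar vc := by
      rw [← h2k]
      exact not_le.1 fun h' => (leI_ne_zero (e := varI vc) (f := varI vk)).2 h' hc
    refine Spec.setR ?_ (by simp only [Expr.size]; omega)
    set s₃ := s₂.setR rlo _ with hs₃
    have h3m : s₃.ivar vm = a := by rw [hs₃, Store.setR_ivar, hK.ivar _ (by simp), h1vm]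
    have h3e : s₃.ivar ve = e := by rw [hs₃, Store.setR_ivar, hK.ivar _ (by simp), h1ve]
    have h3lo : s₃.rvar rlo = m := by
      rw [hs₃, Store.setR_rvar, if_pos rfl, ← h1m, ← hK.rvar]; rfl
    have h3g : s₃.rvar rg = s₀.rvar rg := by
      rw [hs₃, Store.setR_rvar, if_neg (by simp), hK.rvar, h1g]
    have h3L : s₃.iarr aL = s₂.iarr aL := rfl
    have h3T : s₃.iarr aT = s₂.iarr aT := rfl
    have h3asg : s₃.iarr aasg = s₀.iarr aasg := by
      rw [← h1a]; exact hK.iarr aasg (by simp)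
    have hb3 : Base n k x s₃ := hb.of_shuffle hsh hR.nonneg hR.ve_le (hK.rarr.trans h1ra)
      ((hK.ivar _ (by simp)).trans (h1i _ (by simp) (by simp)))
      ((hK.ivar _ (by simp)).trans (h1i _ (by simp) (by simp)))
    have htab2 : s₂.Table d (s₂.ivar vc) := hcov.table
    have hkey : ∀ p, s₃.key d p = s₂.key d p := by
      intro p
      unfold Store.key
      rw [h3g, hK.rvar, h1g]
      rfl
    clear_value s₃
    have hd3 : s₃.dist2 d = s₀.dist2 d := by
      funext p; unfold Store.dist2; rw [hb3.pt, hb.pt, h3asg]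
    have hout : ∀ z, z < a ∨ e ≤ z → s₃.iarr aL z = L z := fun z hz => by
      rw [h3L]; exact hsh.outside hz
    have hseg0 : seg (s₃.iarr aL) 0 a = seg L 0 a :=
      seg_congr fun z _ hz => hout z (Or.inl hz)
    have hsegP : seg (s₃.iarr aL) a e = P := by rw [h3L]; exact hsh.seg_eq
    have hfar : ∀ j, j < s₂.ivar vc → ∀ i, 0 ≤ i → i < j →
        m ≤ sqd d (x (s₃.iarr aL j)) (x (s₃.iarr aL i)) := by
      intro j hj i hi0 hij
      by_cases hja : j < a
      · rw [hout j (Or.inl hja), hout i (Or.inl (hij.trans hja))]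
        exact hapm j hja i hi0 hij
      · have h4 := hcov.apart j (by rw [h1vm]; omega) hj i hi0 hij
        rw [h3L]
        refine not_lt.1 fun h5 => h4 ⟨?_, h5⟩
        have h6 := hR.near _ _ (h5.trans hmR)
        unfold Store.Near at h6 ⊢
        rwa [hK.rvar, hK.pt, h1g, hpt1]
    have ho : ∀ p, s₃.others d R2 p = s₀.others d R2 p := by
      intro p
      unfold Store.others
      rw [h3m, hseg0, hd3, hb3.pt, hb.pt]
    refine ⟨⟨hb3, ?_, ?_, ?_, ?_, ?_, ?_, ?_, ?_, ?_, ?_, ?_, ?_⟩, ?_, by rw [h3m, h3e]⟩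
    · rw [h3m]; exact hR.nonneg
    · rw [h3m, h3e]; exact hR.vm_le
    · rw [h3e]; exact hR.ve_le
    · rw [h3m]; exact hR.vm_le_k
    · intro i hi0 hi
      rw [h3m] at hi
      rw [h3T, hkey, h3L]
      exact htab2 i hi0 (by omega)
    · intro p q hpq
      have := hR.near p q hpq
      unfold Store.Near at this ⊢
      rwa [h3g, hb3.pt, ← hb.pt]
    · rw [h3g, h3lo]
      exact fun p q hpq => (hR.same p q hpq).trans hlm
    · rw [h3asg, h3m, hseg0]; exact hR.asg_mem
    · rw [hd3]; exact hR.dist2_lt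
    · intro z hz0 hz hzz
      rw [h3m, h3e] at hzz
      rw [hd3, hout z hzz, h3lo]
      exact (hR.inactive z hz0 hz hzz).trans hlm.le
    · intro j hj i hi0 hij z hz0 hz
      rw [h3m] at hj hz0
      rw [h3e] at hz
      rw [hd3, hout j (Or.inl hj), hout i (Or.inl (hij.trans hj)), h3L]
      obtain ⟨w, hw, hzw⟩ := hsh.inside (z := z) ⟨hz0, hz⟩
      rw [hzw]
      exact hR.apart j hj i hi0 hij w hw.1 hw.2
    -- The centers of the failed attempt are the certificate: more than `k` points with pairwise
    -- squared distances at least `m`.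
    · refine ⟨seg (s₃.iarr aL) 0 (s₂.ivar vc), ?_, ?_, ?_⟩
      · rw [← hb3.seg_eq]
        exact seg_subset le_rfl (hce.trans hR.ve_le)
      · rw [card_seg (hb3.inj.mono (Set.Ico_subset_Ico le_rfl (hce.trans hR.ve_le)))]
        omega
      · intro p hp q hq hpq
        rw [h3lo]
        obtain ⟨i, hi, rfl⟩ := mem_seg.1 hp
        obtain ⟨j, hj, rfl⟩ := mem_seg.1 hq
        rcases lt_trichotomy i j with h4 | rfl | h4
        · rw [sqd_comm]; exact hfar j hj.2 i hi.1 h4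
        · exact absurd rfl hpq
        · exact hfar i hi.2 j hj.1 h4
    · refine (add_le_add le_rfl (min_le_right _ _)).trans ?_
      rw [hΦ, refinePotential, h3m, h3e, h3lo, hd3, hsegP]
      refine sum_add_card_le _ (Finset.filter_subset _ _) hone ?_
      intro p hp
      rw [ho, if_neg (not_le.2 (Finset.mem_filter.1 hp).2), add_zero]

end RealRAM

/-! ### The two sampling loops and the first clustering. -/

namespace RealRAM

open KCenter RealRAM.Expr RealRAM.Prog

variable {d : ℕ} {n k : ℤ} {x : ℤ → ℕ → ℝ}

theorem spec_sampling_loop {e f : Expr Ty.int} {y : ℕ} {A : Prog} (I : Store → Prop)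
    (Φ : Store → ℕ) (κ C : ℕ)
    (hA : ∀ s, I s → (e.eval s : ℤ) ≠ 0 → ∃ (α : ℕ) (v : ℕ → ℝ), 0 < α ∧
      α ≤ κ * Φ s ∧ f.eval s = (α : ℤ) ∧
      ∀ i < α, Spec A (s.setI y i) (C * α) (fun s' => I s' ∧
        κ * Φ s' + min ((Finset.range α).filter fun j => v i ≤ v j).card
          ((Finset.range α).filter fun j => v j ≤ v i).card ≤ κ * Φ s)) (s : Store) (hs : I s) :
    Spec (loop e (Prog.seq (rand y f) A)) s
      (8 * (C + e.size + f.size + 3) * (κ * Φ s) + (e.size + 1))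
      (fun s' => I s' ∧ (e.eval s' : ℤ) = 0) := fun g b hg =>
  ert_sampling_loop I Φ κ C g b hA (fun s h1 h2 => hg s ⟨h1, h2⟩) s hs

/-- Find the optimal radius up to constant factors. -/
def search (d : ℕ) : Prog := loop (varI vw) (seq (rand vu (varI ve)) (searchRound d))

/-- The drift bound with `κ = 3 ^ d + 1`. A round always has at least two points to choose from,
since more points than available centers remain and at least one center does. -/
theorem search_spec
    (hx : ∀ p ∈ Finset.Ico 0 n, ∀ q ∈ Finset.Ico 0 n, p ≠ q → 0 < supd d (x p) (x q))
    (s : Store) (h : Searching d n k x s) :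
    Spec (search d) s (8 * (searchCost d + 5) * ((3 ^ d + 1) * n.toNat) + 2)
      (fun s' => Searching d n k x s' ∧ s'.ivar vw = 0) := by
  refine (spec_sampling_loop (Searching d n k x) searchPotential (3 ^ d + 1) (searchCost d) ?_ s
    h).mono ?_ fun s' h => h
  · intro s hs hw
    replace hw : s.ivar vw ≠ 0 := hw
    have hpr := hs.pruned hw
    have h1 := hpr.lt
    have h2 := hpr.pos
    have h3 := Finset.card_image_le (s := Finset.Ico 0 (s.ivar ve)) (f := s.iarr aL)
    rw [Int.card_Ico, sub_zero] at h3
    change (seg (s.iarr aL) 0 (s.ivar ve)).card ≤ _ at h3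
    refine ⟨(s.ivar ve).toNat, fun j => nnd d x (seg (s.iarr aL) 0 (s.ivar ve)) (s.iarr aL j),
      by omega, ?_, ?_, fun i hi => searchRound_spec hs hw hx hi⟩
    · rw [searchPotential, if_neg hw]
      exact Nat.le_mul_of_pos_left _ (Nat.succ_pos _)
    · simp only [eval]
      rw [Int.toNat_of_nonneg hs.nonneg]
  · have h1 : searchPotential s ≤ n.toNat := by
      unfold searchPotential
      have := h.le
      split_ifs <;> omega
    have h2 : 8 * (searchCost d + 5) * ((3 ^ d + 1) * searchPotential s) ≤
        8 * (searchCost d + 5) * ((3 ^ d + 1) * n.toNat) :=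
      Nat.mul_le_mul_left _ (Nat.mul_le_mul_left _ h1)
    simp only [Expr.size]
    exact Nat.add_le_add_right h2 2

/-- Refine the clustering until it is good enough. -/
def refineLoop (d b : ℕ) : Prog :=
  loop (ltI (varI vm) (varI ve)) (seq (rand vu (subI (varI ve) (varI vm))) (refineRound d b))

/-- Here `κ = 1`: each active point contributes at least 1 to the potential and at most the number
of cells in the neighborhood plus 1. -/
theorem refineLoop_spec {b : ℕ} {R2 : ℝ} (s : Store) (h : Active d n k x b R2 s) :
    Spec (refineLoop d b) s
      (8 * (refineCost d b + 11) * (((2 * b + 1) ^ d + 1) * n.toNat) + 6)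
      (fun s' => Refining d n k x b R2 s' ∧ s'.ivar vm = s'.ivar ve) := by
  refine (spec_sampling_loop (Active d n k x b R2) (refinePotential d b R2) 1 (refineCost d b) ?_ s
    h).mono ?_ ?_
  · intro s hs hw
    replace hw : s.ivar vm < s.ivar ve := ltI_ne_zero.1 hw
    refine ⟨(s.ivar ve - s.ivar vm).toNat, fun j => s.dist2 d (s.iarr aL (s.ivar vm + j)),
      by omega, ?_, ?_, fun i hi => ?_⟩
    · rw [one_mul, hs.potential_eq, ← card_seg (hs.refining.base.inj.mono
        (Set.Ico_subset_Ico hs.refining.nonneg hs.refining.ve_le)), Finset.card_eq_sum_ones]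
      refine Finset.sum_le_sum fun p _ => ?_
      have := hs.refining.card_others_le p
      omega
    · simp only [eval]
      rw [Int.toNat_of_nonneg (by omega)]
    · simp only [one_mul]
      exact refineRound_spec hs hi
  · have h1 : refinePotential d b R2 s ≤ ((2 * b + 1) ^ d + 1) * n.toNat := by
      rw [h.potential_eq]
      refine (Finset.sum_le_card_nsmul _ _ ((2 * b + 1) ^ d + 1) fun p _ => Nat.sub_le _ _).trans ?_
      rw [card_seg (h.refining.base.inj.mono
        (Set.Ico_subset_Ico h.refining.nonneg h.refining.ve_le)), smul_eq_mul, mul_comm]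
      have := h.refining.nonneg
      have := h.refining.ve_le
      exact Nat.mul_le_mul_left _ (by omega)
    have h2 := Nat.mul_le_mul_left (8 * (refineCost d b + 11)) h1
    simp only [Expr.size, ltI, one_mul]
    exact Nat.add_le_add_right h2 6
  · rintro s' ⟨h1, h2⟩
    refine ⟨h1.refining, le_antisymm h1.refining.vm_le ?_⟩
    exact not_lt.1 fun h' => (ltI_ne_zero (e := varI vm) (f := varI ve)).2 h' h2

/-- The number of cells in every direction that are searched for near centers. -/
def reach (d : ℕ) : ℕ := 37 * (d + 1) ^ 2

/-- A first clustering, when the optimal radius is known up to constant factors. -/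
def start (d : ℕ) : Prog :=
  seq (setR rg (divR (varR rg) (ofInt (litI (d + 1 : ℕ))))) <|
  seq (setR rm (mulR (mulR (ofInt (litI (reach d))) (varR rg))
    (mulR (ofInt (litI (reach d))) (varR rg)))) <|
  seq (setR rlo (mulR (mulR (ofInt (litI (d + 1 : ℕ))) (varR rg))
    (mulR (ofInt (litI (d + 1 : ℕ))) (varR rg)))) <|
  seq (setI ve (varI vn)) <|
  seq (RealRAM.cover d (reach d) (litI 0) (ltR (sqdist d (varI vp) (varI vq)) (varR rm))) <|
  seq (accept (litI 0)) (sift d)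

/-- The side `g = σ / (d + 1)` makes points of one cell closer than `σ` in Euclidean distance. The
covering radius is `reach d * g = 37 * (d + 1) * σ`, so centers within it are found by scanning
`reach d` cells in each direction. The square of `σ` is the first certified bound. -/
theorem start_spec {σ : ℝ} {s₀ : Store} (h : Base n k x s₀) (hn : 0 ≤ n) (hm : s₀.ivar vm = 0)
    (hg : s₀.rvar rg = σ) (hσ : IsScale d x n k σ) :
    Spec (start d) s₀ (n.toNat * ((coverBody d (reach d) (litI 0) (ltR (sqdist d (varI vp)
        (varI vq)) (varR rm))).cost + 12) + n.toNat * ((commitBody (litI 0)).cost + 12) +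
        n.toNat * ((partitionBody (ltR (varR rlo) (curDist2 d))).cost + 12) + 100)
      (fun s => ∃ R2, Active d n k x (reach d) R2 s) := by
  set B := n.toNat * ((coverBody d (reach d) (litI 0) (ltR (sqdist d (varI vp)
        (varI vq)) (varR rm))).cost + 12)
  set M := n.toNat * ((commitBody (litI 0)).cost + 12)
  set Q := n.toNat * ((partitionBody (ltR (varR rlo) (curDist2 d))).cost + 12)
  set g := σ / (d + 1 : ℕ) with hg'
  set R := (reach d : ℝ) * g with hR
  have hg0 : 0 < g := div_pos hσ.pos (by positivity)
  have hσg : σ = (d + 1 : ℕ) * g := by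
    rw [hg']; field_simp
  have hRσ : R = 37 * (d + 1) * σ := by
    rw [hR, hσg, reach]; push_cast; ring
  refine Spec.setR_seq (c₂ := B + M + Q + 94) ?_ (by simp only [Expr.size]; omega)
  refine Spec.setR_seq (c₂ := B + M + Q + 83) ?_ (by simp only [Expr.size]; omega)
  refine Spec.setR_seq (c₂ := B + M + Q + 72) ?_ (by simp only [Expr.size]; omega)
  refine Spec.setI_seq (c₂ := B + M + Q + 69) ?_ (by simp only [Expr.size]; omega)
  set s₁ := Store.setI _ ve _ with hs₁
  have h1i : ∀ y, y ≠ ve → s₁.ivar y = s₀.ivar y := by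
    intro y hy
    rw [hs₁, Store.setI_ivar, if_neg hy]; rfl
  have h1e : s₁.ivar ve = n := by
    rw [hs₁, Store.setI_ivar, if_pos rfl]; exact h.vn_eq
  have h1g : s₁.rvar rg = g := by
    rw [hs₁, hg', ← hg]; simp [eval]
  have h1m : s₁.rvar rm = R * R := by
    rw [hs₁, hR, hg', ← hg]; simp [eval]
  have h1lo : s₁.rvar rlo = σ * σ := by
    rw [hσg, hs₁, hg', ← hg]; simp [eval]
  have h1L : s₁.iarr aL = s₀.iarr aL := rfl
  have hb1 : Base n k x s₁ := h.of_eq rfl rfl (h1i _ (by simp)) (h1i _ (by simp))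
  have h1vm : s₁.ivar vm = 0 := (h1i _ (by simp)).trans hm
  clear_value s₁
  have hnear : ∀ p q, sqd d (x p) (x q) < R * R → s₁.Near d (reach d) p q := by
    intro p q hpq
    unfold Store.Near
    rw [h1g, hb1.pt]
    refine near_of_supd_le hg0 (le_of_lt ?_)
    refine lt_of_mul_self_lt_mul_self₀ (by positivity) ?_
    exact (supd_mul_self_le_sqd _ _ _).trans_lt hpq
  have hdσ : (d : ℝ) * (g * g) < σ * σ := by
    rw [hσg]; push_cast
    have h1 : 0 < g * g := mul_pos hg0 hg0
    have h2 : (0 : ℝ) ≤ d := Nat.cast_nonneg d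
    nlinarith [mul_nonneg h2 h1.le, mul_nonneg h2 (mul_nonneg h2 h1.le)]
  have hsame : ∀ p q, (∀ l < d, cell (s₁.rvar rg) (x p) l = cell (s₁.rvar rg) (x q) l) →
      sqd d (x p) (x q) < σ * σ := by
    intro p q hpq
    rw [h1g] at hpq
    have h1 := supd_lt_of_near (b := 0) hg0 (near_of_eq hpq)
    rw [Nat.cast_zero, zero_add, one_mul] at h1
    exact (sqd_le_of_supd_le h1.le).trans_lt hdσ
  have hσR : σ * σ < R * R := by
    have h1 : σ < R := by
      rw [hRσ]
      have := hσ.pos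
      have h2 : (0 : ℝ) ≤ d := Nat.cast_nonneg d
      nlinarith [mul_nonneg h2 this.le]
    exact mul_self_lt_mul_self hσ.pos.le h1
  have hcover := cover_spec (d := d) (b := reach d) (s₀ := s₁) (P := fun _ => False)
    (T := fun p q => sqd d (x p) (x q) < R * R) (pre := litI 0)
    (test := ltR (sqdist d (varI vp) (varI vq)) (varR rm)) (fun s _ _ _ => by simp [eval])
    (fun s hs1 hs2 => by
      have hpts : s.pt = s₁.pt := by unfold Store.pt; rw [hs1]
      rw [ltR_ne_zero, sqdist_eval, hpts, hb1.pt]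
      simp only [eval, hs2, h1m]) (fun p q hpq => by
        rw [hb1.pt] at hpq
        exact (hsame p q hpq).trans hσR) h1vm.ge
    (by rw [h1vm, h1e]; exact hn) (by rw [h1vm, h1e]; exact hb1.inj)
    (by rw [h1vm]; intro i h1 h2; omega)
  rw [h1vm, h1e, sub_zero] at hcover
  refine Spec.seq hcover (c₂ := M + Q + 50) ?_ (by omega)
  rintro s₂ ⟨hcov, hK⟩
  have hsh := hcov.shuffle
  have hb2 : Base n k x s₂ := hb1.of_shuffle hsh h1vm.ge le_rfl hK.rarr (hK.ivar _ (by simp))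
    (hK.ivar _ (by simp))
  have hcle := hcov.le_count
  have hcn := hcov.count_le
  rw [h1vm] at hcle
  -- With more than `k` greedy centers, two would share a point of the cover in `hσ.upper`. Their
  -- maximum distance would be at most `2 * 18 * σ` and their Euclidean distance below `37 * (d + 1)
  -- * σ`, contrary to the greedy choice.
  have hc : s₂.ivar vc ≤ k := by
    by_contra hc
    obtain ⟨S, hS, hSk, hcS⟩ := hσ.upper
    choose! f hf using hcS
    have hsub : seg (s₂.iarr aL) 0 (s₂.ivar vc) ⊆ Finset.Ico 0 n := by
      rw [← hb2.seg_eq]; exact seg_subset le_rfl hcn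
    obtain ⟨u, hu, v, hv, huv, hfuv⟩ := Finset.exists_ne_map_eq_of_card_lt_of_maps_to
      (s := seg (s₂.iarr aL) 0 (s₂.ivar vc)) (t := S) (f := f) (by
        rw [card_seg (hb2.inj.mono (Set.Ico_subset_Ico le_rfl hcn))]; omega)
      (fun u hu => (hf u (hsub hu)).1)
    have h4 := (hf u (hsub hu)).2
    have h5 := (hf v (hsub hv)).2
    rw [← hfuv, supd_comm] at h5
    have h6 : supd d (x u) (x v) ≤ 36 * σ := by
      have := supd_triangle d (x u) (x (f u)) (x v)
      linarith
    have h7 : sqd d (x u) (x v) < R * R := by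
      refine (sqd_le_of_supd_le h6).trans_lt ?_
      rw [hRσ]
      have h1 : 0 < σ * σ := mul_pos hσ.pos hσ.pos
      have h2 : (0 : ℝ) ≤ d := Nat.cast_nonneg d
      nlinarith [mul_nonneg h2 h1.le, mul_nonneg h2 (mul_nonneg h2 h1.le)]
    have hN : ∀ p q, sqd d (x p) (x q) < R * R → s₂.Near d (reach d) p q := by
      intro p q hpq
      have := hnear p q hpq
      unfold Store.Near at this ⊢
      rwa [hK.rvar, hK.pt]
    obtain ⟨i, hi, rfl⟩ := mem_seg.1 hu
    obtain ⟨j, hj, rfl⟩ := mem_seg.1 hv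
    rcases lt_trichotomy i j with h8 | rfl | h8
    · rw [sqd_comm] at h7
      exact hcov.apart j (by omega) hj.2 i hi.1 h8 ⟨hN _ _ h7, h7⟩
    · exact huv rfl
    · exact hcov.apart i (by omega) hi.2 j hj.1 h8 ⟨hN _ _ h7, h7⟩
  have hcert : ∃ S ⊆ Finset.Ico 0 n, k < S.card ∧ ∀ p ∈ S, ∀ q ∈ S, p ≠ q →
      σ * σ ≤ sqd d (x p) (x q) := by
    obtain ⟨S, hS, hSk, h1⟩ := hσ.lower
    refine ⟨S, hS, hSk, fun p hp q hq hpq => ?_⟩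
    exact (mul_self_le_mul_self hσ.pos.le (h1 p hp q hq hpq)).trans (supd_mul_self_le_sqd _ _ _)
  have hacc := accept_spec (P := fun _ => False) (keep := litI 0) (R2 := R * R) (lo := σ * σ) hb1 h1vm.ge
    (by rw [h1vm, h1e]; exact hn) h1e.le h1lo (by rw [h1e]; exact hcov) hK hc hnear hsame le_rfl hσR
    (fun _ _ h => h.elim) (fun z h1 h2 h3 => by omega) (fun j hj i hi hij => by omega) hcert
    (fun s _ _ _ => by simp [eval])
  rw [h1vm, h1e, sub_zero] at hacc
  refine Spec.seq hacc (c₂ := Q + 20) ?_ (by omega)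
  rintro s₃ ⟨hR3, -, h3e, -⟩
  refine (sift_spec' hR3).mono ?_ fun s hs => ⟨_, hs.1⟩
  have h1 : (s₃.ivar ve - s₃.ivar vm).toNat ≤ n.toNat := by
    have := hR3.nonneg
    omega
  have := Nat.mul_le_mul_right ((partitionBody (ltR (varR rlo) (curDist2 d))).cost + 12) h1
  omega

end RealRAM

/-! ### The whole program -/

namespace RealRAM

open KCenter RealRAM.Expr RealRAM.Prog

variable {d : ℕ} {n k : ℤ} {x : ℤ → ℕ → ℝ}

/-- Initialize the permutation and the clustering in which every point is a center. -/
def init : Prog :=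
  seq (forRange vi (litI 0) vn (seq (storeI aL (varI vi) (varI vi)) (storeI aasg (varI vi) (varI vi))))
    (seq (setI ve (varI vn)) (seq (setI vk' (varI vk)) (setI vw (litI 1))))

theorem init_spec {s₀ : Store} (hn : 0 ≤ s₀.ivar vn) :
    Spec init s₀ ((s₀.ivar vn).toNat * 19 + 30) (fun s =>
      (∀ i, 0 ≤ i → i < s₀.ivar vn → s.iarr aL i = i ∧ s.iarr aasg i = i) ∧
      s.ivar vn = s₀.ivar vn ∧ s.ivar vk = s₀.ivar vk ∧ s.ivar ve = s₀.ivar vn ∧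
      s.ivar vk' = s₀.ivar vk ∧ s.ivar vw = 1 ∧ s.ivar vm = s₀.ivar vm ∧ s.rvar = s₀.rvar ∧
      s.rarr = s₀.rarr) := by
  have hfor := spec_forRange (s := s₀) (v := vi) (h := vn) (lo := litI 0)
    (body := seq (storeI aL (varI vi) (varI vi)) (storeI aasg (varI vi) (varI vi))) (z := 0)
    (fun i s => ∀ j, 0 ≤ j → j < i → s.iarr aL j = j ∧ s.iarr aasg j = j)
    ⟨trivial, trivial⟩ (by simp [WritesI]) (by simp [WritesI]) (by simp) rfl hn
    (fun j h1 h2 => by omega) ?_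
  · refine Spec.seq hfor (c₂ := 12) ?_ (by simp only [cost, Expr.size]; omega)
    rintro s ⟨h1, hA⟩
    refine Spec.setI_seq (c₂ := 8) ?_ (by simp [Expr.size])
    refine Spec.setI_seq (c₂ := 4) ?_ (by simp [Expr.size])
    refine Spec.setI ?_ (by simp [Expr.size])
    have hi : ∀ y, y ≠ vi → s.ivar y = s₀.ivar y := fun y hy =>
      hA.ivar y (by simp only [forRange, WritesI]; tauto)
    refine ⟨h1, ?_, ?_, ?_, ?_, ?_, ?_, ?_, ?_⟩
    · simpa using hi vn (by simp)
    · simpa using hi vk (by simp)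
    · simpa [eval] using hi vn (by simp)
    · simpa [eval] using hi vk (by simp)
    · simp [eval]
    · simpa using hi vm (by simp)
    · exact funext fun y => hA.rvar y (by simp [forRange, WritesR])
    · exact hA.rarr (by simp [forRange, KeepsRArr])
  · intro i s hi0 hin hvi hA hI j hj0 hj
    have hL : (((seq (storeI aL (varI vi) (varI vi)) (storeI aasg (varI vi) (varI vi))).exec
        s).setI vi (i + 1)).iarr aL = Function.update (s.iarr aL) i i := by
      rw [← hvi]; simp [exec, eval]
    have hasg : (((seq (storeI aL (varI vi) (varI vi)) (storeI aasg (varI vi) (varI vi))).exec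
        s).setI vi (i + 1)).iarr aasg = Function.update (s.iarr aasg) i i := by
      rw [← hvi]; simp [exec, eval]
    rw [hL, hasg]
    rcases (Int.lt_add_one_iff.1 hj).lt_or_eq with h6 | rfl
    · rw [Function.update_of_ne h6.ne, Function.update_of_ne h6.ne]
      exact hI j hj0 h6
    · simp

/-- Write the number of the center of every point. -/
def output : Prog :=
  seq (forRange vi (litI 0) vk (storeI apos (loadI aL (varI vi)) (varI vi)))
    (forRange vi (litI 0) vn (storeI aout (varI vi) (loadI apos (loadI aasg (varI vi)))))

/-- The first loop inverts the permutation on its first `k` entries, which are distinct; the second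
composes the inverse with the assignment. -/
theorem output_spec {s₀ : Store} (hk : 0 ≤ s₀.ivar vk) (hn : 0 ≤ s₀.ivar vn)
    (hinj : Set.InjOn (s₀.iarr aL) (Set.Ico 0 (s₀.ivar vk))) :
    Spec output s₀ ((s₀.ivar vk).toNat * 16 + (s₀.ivar vn).toNat * 17 + 30) (fun s =>
      s.iarr aL = s₀.iarr aL ∧ ∀ i, 0 ≤ i → i < s₀.ivar vn → ∀ j, 0 ≤ j → j < s₀.ivar vk →
        s₀.iarr aasg i = s₀.iarr aL j → s.iarr aout i = j) := by
  have hfor₁ := spec_forRange (s := s₀) (v := vi) (h := vk) (lo := litI 0)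
    (body := storeI apos (loadI aL (varI vi)) (varI vi)) (z := 0)
    (fun i s => ∀ j, 0 ≤ j → j < i → s.iarr apos (s₀.iarr aL j) = j)
    trivial (by simp [WritesI]) (by simp [WritesI]) (by simp) rfl hk
    (fun j h1 h2 => by omega) ?_
  · refine Spec.seq hfor₁ (c₂ := (s₀.ivar vn).toNat * 17 + 11) ?_
      (by simp only [cost, Expr.size]; omega)
    rintro s₁ ⟨h1, hA1⟩
    have hi1 : ∀ y, y ≠ vi → s₁.ivar y = s₀.ivar y := fun y hy =>
      hA1.ivar y (by simp only [forRange, WritesI]; tauto)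
    have ha1 : ∀ a, a ≠ apos → s₁.iarr a = s₀.iarr a := fun a ha =>
      hA1.iarr a (by simp only [forRange, WritesArr]; tauto)
    have h1n : s₁.ivar vn = s₀.ivar vn := hi1 _ (by simp)
    have hfor₂ := spec_forRange (s := s₁) (v := vi) (h := vn) (lo := litI 0)
      (body := storeI aout (varI vi) (loadI apos (loadI aasg (varI vi)))) (z := 0)
      (fun i s => ∀ i', 0 ≤ i' → i' < i → s.iarr aout i' = s₁.iarr apos (s₁.iarr aasg i'))
      trivial (by simp [WritesI]) (by simp [WritesI]) (by simp) rfl (by rw [h1n]; exact hn)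
      (fun j h1 h2 => by omega) ?_
    · rw [h1n] at hfor₂
      refine hfor₂.mono (by simp only [cost, Expr.size]; omega) ?_
      rintro s ⟨h2, hA2⟩
      have ha2 : ∀ a, a ≠ aout → s.iarr a = s₁.iarr a := fun a ha =>
        hA2.iarr a (by simp only [forRange, WritesArr]; tauto)
      refine ⟨by rw [ha2 _ (by simp), ha1 _ (by simp)], fun i hi0 hi j hj0 hj hij => ?_⟩
      rw [h2 i hi0 hi, ha1 aasg (by simp), hij]
      exact h1 j hj0 hj
    · intro i s hi0 hin hvi hA hI j hj0 hj
      have ha2 : ∀ a, a ≠ aout → s.iarr a = s₁.iarr a := fun a ha =>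
        hA.iarr a (by simp only [forRange, WritesArr]; tauto)
      have hL : (((storeI aout (varI vi) (loadI apos (loadI aasg (varI vi)))).exec
          s).setI vi (i + 1)).iarr aout =
          Function.update (s.iarr aout) i (s₁.iarr apos (s₁.iarr aasg i)) := by
        rw [← hvi, ← ha2 apos (by simp), ← ha2 aasg (by simp)]; simp [exec, eval]
      rw [hL]
      rcases (Int.lt_add_one_iff.1 hj).lt_or_eq with h6 | rfl
      · rw [Function.update_of_ne h6.ne]
        exact hI j hj0 h6
      · simp
  · intro i s hi0 hin hvi hA hI j hj0 hj
    have ha : ∀ a, a ≠ apos → s.iarr a = s₀.iarr a := fun a ha =>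
      hA.iarr a (by simp only [forRange, WritesArr]; tauto)
    have hL : (((storeI apos (loadI aL (varI vi)) (varI vi)).exec s).setI vi (i + 1)).iarr apos =
        Function.update (s.iarr apos) (s₀.iarr aL i) i := by
      rw [← hvi, ← ha aL (by simp)]; simp [exec, eval]
    rw [hL]
    rcases (Int.lt_add_one_iff.1 hj).lt_or_eq with h6 | rfl
    · rw [Function.update_of_ne]
      · exact hI j hj0 h6
      · intro h7
        have := hinj (x₁ := j) (x₂ := i) ⟨hj0, by omega⟩ ⟨hi0, hin⟩ h7
        omega
    · simp

/-- The squared distances of the points to the `k` centers that are assigned to them are at most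
`lo`, and so are the squared distances of some `k + 1` points from below, unless `lo = 0`. -/
structure Clustered (d : ℕ) (n k : ℤ) (x : ℤ → ℕ → ℝ) (lo : ℝ) (L c : ℤ → ℤ) : Prop where
  inj : Set.InjOn L (Set.Ico 0 k)
  mem : ∀ j, 0 ≤ j → j < k → 0 ≤ L j ∧ L j < n
  le : ∀ i, 0 ≤ i → i < n → ∃ j, 0 ≤ j ∧ j < k ∧ c i = L j ∧ sqd d (x i) (x (L j)) ≤ lo
  cert : lo = 0 ∨ ∃ S ⊆ Finset.Ico 0 n, k < S.card ∧ ∀ p ∈ S, ∀ q ∈ S, p ≠ q →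
    lo ≤ sqd d (x p) (x q)

/-- The program that computes a clustering in expected linear time. -/
def kCenter (d : ℕ) : Prog :=
  seq init <| seq (cond (ltI (varI vk) (varI vn))
    (seq (search d) (seq (start d) (refineLoop d (reach d)))) skip) output

/-- When the active segment is empty, every point is inactive and hence within the certified bound.
The loop may end with fewer than `k` centers; the first `k` entries of the permutation are then
output, since surplus centers do no harm. -/
theorem Base.clustered {b : ℕ} {R2 : ℝ} {s : Store} (h : Refining d n k x b R2 s) (hkn : k ≤ n)
    (hm : s.ivar vm = s.ivar ve) : Clustered d n k x (s.rvar rlo) (s.iarr aL) (s.iarr aasg) := by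
  have hb := h.base
  refine ⟨hb.inj.mono (Set.Ico_subset_Ico le_rfl hkn), fun j hj0 hj => ?_, fun i hi0 hi => ?_,
    Or.inr h.cert⟩
  · have := seg_mem (L := s.iarr aL) hj0 (hj.trans_le hkn)
    rw [hb.seg_eq] at this
    exact Finset.mem_Ico.1 this
  · have hi' : i ∈ Finset.Ico 0 n := Finset.mem_Ico.2 ⟨hi0, hi⟩
    obtain ⟨j, hj, hji⟩ := mem_seg.1 (h.asg_mem i hi')
    refine ⟨j, hj.1, hj.2.trans_le h.vm_le_k, hji.symm, ?_⟩
    rw [← hb.seg_eq] at hi'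
    obtain ⟨z, hz, rfl⟩ := mem_seg.1 hi'
    have := h.inactive z hz.1 hz.2 (by omega)
    unfold Store.dist2 at this
    rwa [hb.pt, ← hji] at this

/-- Initially nothing is discarded, and all points cover themselves with `E = 0`. -/
theorem initial_pruned (hk : 1 ≤ k) (hkn : k < n) : Pruned d x n k (Finset.Ico 0 n) k 0 := by
  refine ⟨le_rfl, hk, by rw [Int.card_Ico]; omega, ∅, 0, by simp, by simp, by simp,
    fun p hp => ⟨p, by simpa using hp, by rw [supd_self]⟩, fun u _ v _ _ => ?_, Or.inl ⟨rfl, rfl⟩⟩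
  have := supd_nonneg d (x u) (x v)
  linarith

/-- A bound for the expected running time per point. -/
def kCenterCost (d : ℕ) : ℕ :=
  8 * (searchCost d + 5) * (3 ^ d + 1) +
  ((coverBody d (reach d) (litI 0) (ltR (sqdist d (varI vp) (varI vq)) (varR rm))).cost + 12) +
  ((commitBody (litI 0)).cost + 12) +
  ((partitionBody (ltR (varR rlo) (curDist2 d))).cost + 12) +
  8 * (refineCost d (reach d) + 11) * ((2 * reach d + 1) ^ d + 1) + 800

/-- The search needs more points than centers, so `k = n` is treated separately: the initialization
has made every point its own center, with `lo = 0`. -/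
theorem kCenter_spec {s₀ : Store} (hpt : s₀.pt = x) (hn : s₀.ivar vn = n) (hk : s₀.ivar vk = k)
    (hm : s₀.ivar vm = 0) (hrs : s₀.rvar rs = 0) (hk1 : 1 ≤ k) (hkn : k ≤ n)
    (hx : ∀ p ∈ Finset.Ico 0 n, ∀ q ∈ Finset.Ico 0 n, p ≠ q → 0 < supd d (x p) (x q)) :
    Spec (kCenter d) s₀ (kCenterCost d * n.toNat) (fun s => ∃ lo c,
      Clustered d n k x lo (s.iarr aL) c ∧
      ∀ i, 0 ≤ i → i < n → ∀ j, 0 ≤ j → j < k → c i = s.iarr aL j → s.iarr aout i = j) := by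
  set N := n.toNat with hN
  set S := 8 * (searchCost d + 5) * ((3 ^ d + 1) * N) with hS
  set B := N * ((coverBody d (reach d) (litI 0) (ltR (sqdist d (varI vp)
        (varI vq)) (varR rm))).cost + 12) with hB
  set M := N * ((commitBody (litI 0)).cost + 12) with hM
  set Q := N * ((partitionBody (ltR (varR rlo) (curDist2 d))).cost + 12) with hQ
  set F := 8 * (refineCost d (reach d) + 11) * (((2 * reach d + 1) ^ d + 1) * N) with hF
  have hcost : kCenterCost d * N = S + B + M + Q + F + 800 * N := by
    rw [kCenterCost, hS, hB, hM, hQ, hF]; ring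
  have hinit := init_spec (s₀ := s₀) (by rw [hn]; omega)
  rw [hn, hk, ← hN] at hinit
  refine Spec.seq hinit (c₂ := S + B + M + Q + F + 60 * N + 300) ?_ (by omega)
  rintro s₁ ⟨h1a, h1n, h1k, h1e, h1k', h1w, h1m, h1r, h1ra⟩
  refine Spec.seq (c₁ := S + B + M + Q + F + 160) (c₂ := 60 * N + 130) (Q := fun s =>
    s.ivar vn = n ∧ s.ivar vk = k ∧ ∃ lo, Clustered d n k x lo (s.iarr aL) (s.iarr aasg)) ?_ ?_
    (by omega)
  · refine Spec.cond (c₁ := S + B + M + Q + F + 150) (fun hc => ?_) (fun hc => ?_)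
      (by simp only [ltI, Expr.size]; omega)
    · replace hc : s₁.ivar vk < s₁.ivar vn := ltI_ne_zero.1 hc
      rw [h1k, h1n] at hc
      have hL : seg (s₁.iarr aL) 0 n = Finset.Ico 0 n := by
        unfold seg
        rw [Finset.image_congr (g := id), Finset.image_id]
        intro z hz
        simp only [Finset.coe_Ico, Set.mem_Ico] at hz
        exact (h1a z hz.1 hz.2).1
      have hb1 : Base n k x s₁ := by
        refine ⟨by rw [← hpt]; unfold Store.pt; rw [h1ra], h1n, h1k, ?_, hL⟩
        intro z hz w hw hzw
        rwa [(h1a z hz.1 hz.2).1, (h1a w hw.1 hw.2).1] at hzw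
      have hs1 : Searching d n k x s₁ := by
        refine ⟨hb1, h1m.trans hm, by rw [h1e]; omega, h1e.le, fun _ => ?_, fun h0 => ?_⟩
        · rw [h1e, hL, h1k', h1r, hrs]
          exact initial_pruned hk1 hc
        · rw [h1w] at h0; omega
      have hsearch := search_spec hx s₁ hs1
      rw [← hN] at hsearch
      refine Spec.seq hsearch (c₂ := B + M + Q + F + 120) ?_ (by omega)
      rintro s₂ ⟨hs2, h2w⟩
      have hstart := start_spec hs2.base (by omega) hs2.vm_eq rfl (hs2.isScale h2w)
      rw [← hN] at hstart
      refine Spec.seq hstart (c₂ := F + 10) ?_ (by omega)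
      rintro s₃ ⟨R2, hs3⟩
      have hloop := refineLoop_spec s₃ hs3
      rw [← hN] at hloop
      refine hloop.mono (by omega) ?_
      rintro s₄ ⟨hs4, h4m⟩
      exact ⟨hs4.base.vn_eq, hs4.base.vk_eq, _, Base.clustered hs4 hkn h4m⟩
    · replace hc : n ≤ k := by
        rw [← h1n, ← h1k]
        exact not_lt.1 fun h' => (ltI_ne_zero (e := varI vk) (f := varI vn)).2 h' hc
      have hkn' : k = n := le_antisymm hkn hc
      refine (Prog.Simple.spec (A := skip) trivial s₁).mono (by simp only [cost]; omega) ?_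
      intro s hs
      rw [show s = s₁ from hs]
      refine ⟨h1n, h1k, 0, ?_⟩
      refine ⟨?_, ?_, ?_, Or.inl rfl⟩
      · intro z hz w hw hzw
        rw [hkn'] at hz hw
        rwa [(h1a z hz.1 hz.2).1, (h1a w hw.1 hw.2).1] at hzw
      · intro j hj0 hj
        rw [(h1a j hj0 (hj.trans_le hkn)).1]
        omega
      · intro i hi0 hi
        refine ⟨i, hi0, by omega, ?_, ?_⟩
        · rw [(h1a i hi0 hi).1, (h1a i hi0 hi).2]
        · rw [(h1a i hi0 hi).1, sqd_self]
  · rintro s₂ ⟨h2n, h2k, lo, hcl⟩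
    have hout := output_spec (s₀ := s₂) (by omega) (by omega) (by rw [h2k]; exact hcl.inj)
    rw [h2n, h2k] at hout
    refine hout.mono (by omega) ?_
    rintro s ⟨hsL, hso⟩
    refine ⟨lo, s₂.iarr aasg, by rw [hsL]; exact hcl, ?_⟩
    rw [hsL]
    exact hso

end RealRAM

/-! ### Correctness and running time -/

namespace KCenter

theorem dist_mul_self_eq_sqd {d : ℕ} (u v : EuclideanSpace ℝ (Fin d)) (x y : ℕ → ℝ)
    (hx : ∀ j : Fin d, x j = u j) (hy : ∀ j : Fin d, y j = v j) :
    dist u v * dist u v = sqd d x y := by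
  have h : ∀ m, sqd m x y = ∑ j : Fin m, (x j - y j) ^ 2 := by
    intro m
    induction m with
    | zero => simp [sqd]
    | succ m ih => rw [Fin.sum_univ_castSucc, sqd, ih]; simp [sq]
  rw [h, EuclideanSpace.dist_eq, Real.mul_self_sqrt (Finset.sum_nonneg fun _ _ => sq_nonneg _)]
  refine Finset.sum_congr rfl fun j _ => ?_
  rw [hx, hy, Real.dist_eq, sq_abs]

theorem radius_nonneg {d : ℕ} (P C : Finset (EuclideanSpace ℝ (Fin d))) : 0 ≤ radius P C :=
  Real.iSup_nonneg fun _ => Metric.infDist_nonneg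

theorem exists_dist_le_radius {d : ℕ} {P C : Finset (EuclideanSpace ℝ (Fin d))} (hC : C.Nonempty)
    {u : EuclideanSpace ℝ (Fin d)} (hu : u ∈ P) : ∃ c ∈ C, dist u c ≤ radius P C := by
  obtain ⟨c, hc, h⟩ := C.finite_toSet.isCompact.exists_infDist_eq_dist (Finset.coe_nonempty.2 hC) u
  refine ⟨c, hc, ?_⟩
  rw [← h]
  exact le_ciSup (f := fun x : P => Metric.infDist (x : EuclideanSpace ℝ (Fin d))
    (C : Set (EuclideanSpace ℝ (Fin d)))) (Set.finite_range _).bddAbove ⟨u, hu⟩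

theorem radius_le {d : ℕ} {P C : Finset (EuclideanSpace ℝ (Fin d))} {ρ : ℝ} (hρ : 0 ≤ ρ)
    (h : ∀ u ∈ P, ∃ c ∈ C, dist u c ≤ ρ) : radius P C ≤ ρ := by
  refine Real.iSup_le (fun u => ?_) hρ
  obtain ⟨c, hc, h1⟩ := h u u.2
  exact (Metric.infDist_le_dist_of_mem hc).trans h1

theorem exists_subset_card {d k : ℕ} {P : Finset (EuclideanSpace ℝ (Fin d))} (hk : k ≤ P.card) :
    {ρ : ℝ | ∃ C : Finset (EuclideanSpace ℝ (Fin d)), C ⊆ P ∧ C.card = k ∧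
      ρ = radius P C}.Nonempty := by
  obtain ⟨C, hC, hCk⟩ := Finset.exists_subset_card_eq hk
  exact ⟨_, C, hC, hCk, rfl⟩

theorem optRadius_nonneg {d : ℕ} (P : Finset (EuclideanSpace ℝ (Fin d))) (k : ℕ) :
    0 ≤ optRadius P k :=
  Real.sInf_nonneg (by rintro _ ⟨C, _, _, rfl⟩; exact radius_nonneg P C)

/-- If more than `k` points have pairwise distances at least `t`, then the optimal radius is at least
`t / 2`. -/
theorem le_two_mul_optRadius {d k : ℕ} {P S : Finset (EuclideanSpace ℝ (Fin d))} {t : ℝ}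
    (hk : 1 ≤ k) (hS : S ⊆ P) (hkS : k < S.card) (h : ∀ u ∈ S, ∀ v ∈ S, u ≠ v → t ≤ dist u v) :
    t ≤ 2 * optRadius P k := by
  have h1 : t / 2 ≤ optRadius P k := by
    refine le_csInf (exists_subset_card (hkS.le.trans (Finset.card_le_card hS))) ?_
    rintro _ ⟨C, hC, hCk, rfl⟩
    have hne : C.Nonempty := Finset.card_pos.1 (by omega)
    have hex : ∀ u ∈ S, ∃ c ∈ C, dist u c ≤ radius P C := fun u hu =>
      exists_dist_le_radius hne (hS hu)
    choose! f hf using hex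
    obtain ⟨u, hu, v, hv, huv, hfuv⟩ := Finset.exists_ne_map_eq_of_card_lt_of_maps_to
      (s := S) (t := C) (f := f) (by omega) fun u hu => (hf u hu).1
    have h2 := (hf u hu).2
    have h3 := (hf v hv).2
    rw [← hfuv] at h3
    have h4 := dist_triangle_right u v (f u)
    linarith [h u hu v hv huv]
  linarith

theorem input_pt {d n : ℕ} (p : Fin n → EuclideanSpace ℝ (Fin d)) (k : ℕ) (i : Fin n) (j : Fin d) :
    (input p k).pt (i : ℤ) j = p i j := by
  simp [RealRAM.Store.pt, input]

theorem supd_input_pos {d n : ℕ} {p : Fin n → EuclideanSpace ℝ (Fin d)} (hp : Function.Injective p)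
    (k : ℕ) {i j : Fin n} (hij : i ≠ j) :
    0 < supd d ((input p k).pt (i : ℤ)) ((input p k).pt (j : ℤ)) := by
  by_contra h
  apply hij
  apply hp
  ext l
  have h1 := abs_sub_le_supd ((input p k).pt (i : ℤ)) ((input p k).pt (j : ℤ)) l.2
  rw [input_pt, input_pt] at h1
  have h2 := abs_nonpos_iff.1 (h1.trans (not_lt.1 h))
  linarith

theorem mem_pointSet {d m : ℕ} {p : Fin m → EuclideanSpace ℝ (Fin d)} {u : EuclideanSpace ℝ (Fin d)} :
    u ∈ pointSet p ↔ ∃ i, p i = u := by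
  simp [pointSet]

theorem isApproxClustering_of_clustered {d n k : ℕ} {p : Fin n → EuclideanSpace ℝ (Fin d)}
    (hp : Function.Injective p) (hk : 1 ≤ k) {s : RealRAM.Store} {lo : ℝ} {c : ℤ → ℤ}
    (h : RealRAM.Clustered d n k (input p k).pt lo (s.iarr 0) c)
    (hout : ∀ i, 0 ≤ i → i < (n : ℤ) → ∀ j, 0 ≤ j → j < (k : ℤ) → c i = s.iarr 0 j →
      s.iarr 1 i = j) : IsApproxClustering 2 p k s := by
  have hd : ∀ i j : Fin n, dist (p i) (p j) * dist (p i) (p j) =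
      sqd d ((input p k).pt (i : ℤ)) ((input p k).pt (j : ℤ)) := fun i j =>
    dist_mul_self_eq_sqd _ _ _ _ (input_pt p k i) (input_pt p k j)
  have hlo0 : 0 ≤ lo := by
    rcases h.cert with h1 | ⟨S, hS, hSk, h1⟩
    · exact h1.ge
    · have hn : 0 < n := by
        by_contra hn
        have h2 := Finset.card_le_card hS
        rw [Int.card_Ico] at h2
        omega
      obtain ⟨j, _, _, _, h2⟩ := h.le 0 le_rfl (by omega)
      exact (sqd_nonneg _ _ _).trans h2
  have hopt : √lo ≤ 2 * optRadius (pointSet p) k := by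
    rcases h.cert with h1 | ⟨S, hS, hSk, h1⟩
    · rw [h1, Real.sqrt_zero]
      have := optRadius_nonneg (pointSet p) k
      linarith
    · classical
      have hn : 0 < n := by
        by_contra hn
        have h2 := Finset.card_le_card hS
        rw [Int.card_Ico] at h2
        omega
      -- The certificate consists of indices; the second branch is a dummy value that is never used
      -- on `S`.
      set q : ℤ → EuclideanSpace ℝ (Fin d) := fun z =>
        if hz : z.toNat < n then p ⟨z.toNat, hz⟩ else p ⟨0, hn⟩ with hq
      have hqS : ∀ z ∈ S, ∃ i : Fin n, z = (i : ℤ) ∧ q z = p i := by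
        intro z hz
        have h2 := Finset.mem_Ico.1 (hS hz)
        have h3 : z.toNat < n := by omega
        refine ⟨⟨z.toNat, h3⟩, ?_, by simp [hq, h3]⟩
        simp only
        omega
      have hinj : Set.InjOn q S := by
        intro z hz w hw hzw
        obtain ⟨i, rfl, hi⟩ := hqS z hz
        obtain ⟨j, rfl, hj⟩ := hqS w hw
        rw [hi, hj] at hzw
        rw [hp hzw]
      refine le_two_mul_optRadius (S := S.image q) hk ?_ ?_ ?_
      · intro u hu
        obtain ⟨z, hz, rfl⟩ := Finset.mem_image.1 hu
        obtain ⟨i, _, hi⟩ := hqS z hz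
        exact mem_pointSet.2 ⟨i, hi.symm⟩
      · rw [Finset.card_image_of_injOn hinj]
        exact_mod_cast hSk
      · intro u hu v hv huv
        obtain ⟨z, hz, rfl⟩ := Finset.mem_image.1 hu
        obtain ⟨w, hw, rfl⟩ := Finset.mem_image.1 hv
        have h2 := h1 z hz w hw fun h3 => huv (by rw [h3])
        obtain ⟨i, rfl, hi⟩ := hqS z hz
        obtain ⟨j, rfl, hj⟩ := hqS w hw
        rw [hi, hj]
        rw [← hd] at h2
        exact Real.sqrt_le_iff.2 ⟨dist_nonneg, by rwa [sq]⟩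
  have hcl : ∀ j : Fin k, (s.iarr 0 (j : ℤ)).toNat < n := fun j => by
    have := h.mem (j : ℤ) (by omega) (by exact_mod_cast j.2)
    omega
  have hcen : ∀ j : Fin k, s.iarr 0 (j : ℤ) = ((s.iarr 0 (j : ℤ)).toNat : ℤ) := fun j => by
    have := h.mem (j : ℤ) (by omega) (by exact_mod_cast j.2)
    omega
  have hasg : ∀ i : Fin n, ∃ j : Fin k, s.iarr 1 (i : ℤ) = (j : ℤ) ∧
      dist (p i) (p ⟨(s.iarr 0 (j : ℤ)).toNat, hcl j⟩) ≤ 2 * optRadius (pointSet p) k := by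
    intro i
    have hi0 : (0 : ℤ) ≤ (i : ℤ) := by omega
    have hin : (i : ℤ) < n := by exact_mod_cast i.2
    obtain ⟨j, hj0, hj, hc, hle⟩ := h.le i hi0 hin
    obtain ⟨m, rfl⟩ := Int.eq_ofNat_of_zero_le hj0
    have hm : m < k := by exact_mod_cast hj
    refine ⟨⟨m, hm⟩, hout i hi0 hin m hj0 hj hc, le_trans ?_ hopt⟩
    refine Real.le_sqrt_of_sq_le ?_
    rw [sq, hd, ← hcen ⟨m, hm⟩]
    exact hle
  choose a ha using hasg
  refine ⟨fun j => ⟨(s.iarr 0 (j : ℤ)).toNat, hcl j⟩, a, fun j j' hjj => ?_, fun j => hcen j,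
    fun i => (ha i).1, ?_, fun i => (ha i).2⟩
  · have h1 : (s.iarr 0 (j : ℤ)).toNat = (s.iarr 0 (j' : ℤ)).toNat := congrArg Fin.val hjj
    have h2 := h.inj (x₁ := (j : ℤ)) (x₂ := (j' : ℤ)) ⟨by omega, by exact_mod_cast j.2⟩
      ⟨by omega, by exact_mod_cast j'.2⟩ (by rw [hcen j, hcen j', h1])
    exact Fin.ext (by exact_mod_cast h2)
  · refine radius_le (by have := optRadius_nonneg (pointSet p) k; linarith) fun u hu => ?_
    obtain ⟨i, rfl⟩ := mem_pointSet.1 hu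
    exact ⟨_, mem_pointSet.2 ⟨a i, rfl⟩, (ha i).2⟩

end KCenter

theorem theoremk (d : ℕ) :
    ∃ (A : RealRAM.Prog) (K : ℕ), ∀ (n k : ℕ) (p : Fin n → EuclideanSpace ℝ (Fin d)),
      Function.Injective p → 1 ≤ k → k ≤ n →
        RealRAM.expectedTime A (KCenter.input p k) ≤ (K : ENNReal) * (n : ENNReal) ∧
        ∀ s : RealRAM.Store, RealRAM.IsOutcome A (KCenter.input p k) s →
          KCenter.IsApproxClustering 2 p k s := by
  classical
  refine ⟨RealRAM.kCenter d, RealRAM.kCenterCost d, fun n k p hp hk hkn => ?_⟩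
  have hspec := RealRAM.kCenter_spec (d := d) (n := n) (k := k) (s₀ := KCenter.input p k) rfl
    (by simp [KCenter.input]) (by simp [KCenter.input]) (by simp [KCenter.input])
    (by simp [KCenter.input]) (by exact_mod_cast hk) (by exact_mod_cast hkn) (by
      intro i hi j hj hij
      rw [Finset.mem_Ico] at hi hj
      obtain ⟨i, rfl⟩ := Int.eq_ofNat_of_zero_le hi.1
      obtain ⟨j, rfl⟩ := Int.eq_ofNat_of_zero_le hj.1
      exact KCenter.supd_input_pos hp k (i := ⟨i, by exact_mod_cast hi.2⟩)
        (j := ⟨j, by exact_mod_cast hj.2⟩) (by simpa using hij))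
  -- The payment is infinite exactly on the stores without a correct clustering, so finiteness of
  -- the bound excludes them as outcomes.
  have hert : RealRAM.ert (RealRAM.kCenter d)
      (fun s => if KCenter.IsApproxClustering 2 p k s then 0 else ⊤) (KCenter.input p k) ≤
      (RealRAM.kCenterCost d : ENNReal) * (n : ENNReal) := by
    refine (hspec _ 0 ?_).trans (by simp)
    rintro s ⟨lo, c, h1, h2⟩
    rw [if_pos (KCenter.isApproxClustering_of_clustered hp hk h1 h2)]
  refine ⟨(RealRAM.expectedTime_le_ert _ _ _).trans hert, fun s hs => ?_⟩
  by_contra h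
  refine hs.ne_top_of_ert (ne_top_of_le_ne_top ?_ hert) (if_neg h)
  exact ENNReal.mul_ne_top (ENNReal.natCast_ne_top _) (ENNReal.natCast_ne_top _)
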